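/- \textbf{Setting.} Let $(S,\mu)$ be a $\sigma$-finite measure space, with scalars $\mathbb R$ or $\mathbb C$. A Köthe function space $\mathcal K$ is a linear subspace of $L_0(\mu)$ with a quasi-norm such that $|f|\le |g|$ a.e., $g\in\mathcal K$ imply $f\in\mathcal K$, $\|f\|\le\|g\|$, and such that $1_A\in\mathcal K$ whenever $\mu(A)<\infty$ (completeness is not needed). For a quasi-normed space $V$ and an ultrafilter $\mathscr U$ on a set $I$, the ultrapower $V_{\mathscr U}$ is $\ell_\infty(I,V)$ modulo the families tending to $0$ along $\mathscr U$, with the quotient quasi-norm; $\mathcal K_{\mathscr U}$ has the coordinatewise lattice structure, and $\xi,\eta\in\mathcal K_{\mathscr U}$ are disjoint if $|\xi|\wedge|\eta|=0$. A map $\Omega:\mathcal K\to Y$ into a quasi-normed space is quasi-linear if it is homogeneous and $\|\Omega(x+y)-\Omega x-\Omega y\|\le C(\|x\|+\|y\|)$. It defines the exact sequence $0\to Y\to Y\oplus_\Omega\mathcal K\to\mathcal K\to0$, where $\|(y,x)\|=\|y-\Omega x\|+\|x\|$. A centralizer is a homogeneous map $\Omega:\mathcal K\to L_0$ with $\Omega(fx)-f\Omega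 x\in\mathcal K$ and $\|\Omega(fx)-f\Omega x\|\le C\|f\|_\infty\|x\|$ for $f\in L_\infty$, $x\in\mathcal K$. It defines the exact sequence $0\to\mathcal K\to d_\Omega\mathcal K\xrightarrow{q_\Omega}\mathcal K\to0$, where $d_\Omega\mathcal K=\{(w,x)\in L_0\times\mathcal K: w-\Omega x\in\mathcal K\}$, $\|(w,x)\|=\|x\|+\|w-\Omega x\|$ and $q_\Omega(w,x)=x$. The ultrapower $\Omega_{\mathscr U}$ is any quasi-linear map associated to the ultrapower of the sequence defined by $\Omega$, that is, any quasi-linear map whose twisted-sum sequence is equivalent to it. A quasi-linear map is disjointly singular if its restriction to every infinite-dimensional closed subspace generated by a disjoint sequence is non-trivial, i.e. at infinite distance from the linear (not necessarily continuous) maps. Put $$\psi_\Omega(n)=\inf_{E_n}\ \inf_{L}\ \sup_{x\in E_n,\ \|x\|\le1}\|\Omega x-Lx\|\in[0,\infty],$$ where $E_n$ runs over the subspaces of $\mathcal K$ generated by $n$ disjointly supported nonzero vectors ($\inf\emptyset=\infty$) and $L$ over the linear maps $E_n\to Y$; for a centralizer, $L$ runs over the linear maps $E_n\to L_0$, and $\|\cdot\|=\|\cdot\|_{\mathcal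 K}$ is $\infty$ off $\mathcal K$. Two elements of $d_\Omega\mathcal K$ are disjoint if they have disjoint supports as functions with values in pairs of scalars; two elements of $(d_\Omega\mathcal K)_{\mathscr U}$ are disjoint if they have disjoint representatives. An operator is disjointly singular if it is not an isomorphism onto its image on any infinite-dimensional closed subspace generated by a disjoint sequence, and $q_\Omega$ is super-disjointly singular if all its ultrapowers $(q_\Omega)_{\mathscr U}$ are disjointly singular. \textbf{Lemma.} (a) For every quasi-linear map $\Omega:\mathcal K\to Y$ on a Köthe function space the following are equivalent: (1) all ultrapowers of $\Omega$ are disjointly singular; (2) $\lim_n\psi_\Omega(n)=+\infty$. (b) For every centralizer $\Omega$ on $\mathcal K$, (1) and (2) are equivalent, and they imply each of the following conditions: (3) $q_\Omega$ is super-disjointly singular; (3$'$) whenever $E_n\subset d_\Omega\mathcal K$ ($n\in\mathbb N$) is generated by $n$ disjoint nonzero vectors, there are subspaces $F_n\subset E_n$ generated by disjoint vectors with $\dim F_n\to\infty$ and $\|q_\Omega|_{F_n}\|\to0$. If moreover $\mathcal K$ is $q$-convex for some $q>0$, i.e. $\|(\sum_i|x_i|^q)^{1/q}\|\le M(\sum_i\|x_i\|^q)^{1/q}$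 for some constant $M$ and all finite families in $\mathcal K$ (with $q=1$ this holds whenever the quasi-norm of $\mathcal K$ is a norm), then (1), (2), (3) and (3$'$) are all equivalent. -/

import Mathlib

open MeasureTheory Filter Topology
open scoped ENNReal

universe u v w x y

/-! ### Quasi-normed spaces -/

/-- A quasi-norm on a vector space over `𝕜 = ℝ` or `ℂ`. -/
structure QuasiNorm (𝕜 : Type u) (V : Type v) [RCLike 𝕜] [AddCommGroup V] [Module 𝕜 V] where
  toFun : V → ℝ
  nonneg' : ∀ a, 0 ≤ toFun a
  eq_zero_iff' : ∀ a, toFun a = 0 ↔ a = 0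
  smul' : ∀ (c : 𝕜) (a : V), toFun (c • a) = ‖c‖ * toFun a
  add_le' : ∃ D : ℝ, ∀ a b, toFun (a + b) ≤ D * (toFun a + toFun b)

namespace QuasiNorm

section General

variable {𝕜 : Type u} [RCLike 𝕜] {V : Type v} [AddCommGroup V] [Module 𝕜 V]

instance : CoeFun (QuasiNorm 𝕜 V) (fun _ => V → ℝ) := ⟨QuasiNorm.toFun⟩

theorem map_zero (N : QuasiNorm 𝕜 V) : N 0 = 0 := (N.eq_zero_iff' 0).2 rfl

theorem exists_add_le (N : QuasiNorm 𝕜 V) :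
    ∃ D : ℝ, 1 ≤ D ∧ ∀ a b, N (a + b) ≤ D * (N a + N b) := by
  obtain ⟨D, hD⟩ := N.add_le'
  refine ⟨max D 1, le_max_right _ _, fun a b => (hD a b).trans ?_⟩
  exact mul_le_mul_of_nonneg_right (le_max_left _ _) (add_nonneg (N.nonneg' a) (N.nonneg' b))

theorem map_neg (N : QuasiNorm 𝕜 V) (a : V) : N (-a) = N a := by
  have h := N.smul' (-1) a
  simpa using h

/-- The closed linear span of a set, for the topology of the quasi-norm. -/
def closedSpan (N : QuasiNorm 𝕜 V) (s : Set V) : Submodule 𝕜 V where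
  carrier := {a | ∀ ε : ℝ, 0 < ε → ∃ b ∈ Submodule.span 𝕜 s, N (a - b) < ε}
  zero_mem' := fun ε hε => ⟨0, Submodule.zero_mem _, by rw [sub_zero, N.map_zero]; exact hε⟩
  add_mem' := by
    intro a a' ha ha' ε hε
    obtain ⟨D, hD1, hD⟩ := N.exists_add_le
    have hpos : 0 < ε / (2 * D) := by positivity
    obtain ⟨b, hb, hab⟩ := ha _ hpos
    obtain ⟨b', hb', hab'⟩ := ha' _ hpos
    refine ⟨b + b', Submodule.add_mem _ hb hb', ?_⟩
    have h1 : a + a' - (b + b') = (a - b) + (a' - b') := by abel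
    rw [h1]
    refine (hD _ _).trans_lt ?_
    have h2 : D * (N (a - b) + N (a' - b')) < D * (ε / (2 * D) + ε / (2 * D)) := by
      apply mul_lt_mul_of_pos_left _ (by linarith)
      linarith
    refine h2.trans_le (le_of_eq ?_)
    field_simp
    ring
  smul_mem' := by
    intro c a ha ε hε
    obtain ⟨b, hb, hab⟩ := ha (ε / (‖c‖ + 1)) (by positivity)
    refine ⟨c • b, Submodule.smul_mem _ c hb, ?_⟩
    rw [← smul_sub, N.smul']
    have hc : 0 ≤ ‖c‖ := norm_nonneg c
    have h1 : ‖c‖ * N (a - b) ≤ (‖c‖ + 1) * N (a - b) :=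
      mul_le_mul_of_nonneg_right (by linarith) (N.nonneg' _)
    refine h1.trans_lt ?_
    rw [lt_div_iff₀ (by linarith)] at hab
    linarith

/-! ### Ultrapowers of quasi-normed spaces -/

/-- The space `ℓ_∞(ι, V)` of bounded families. -/
def boundedFamilies (N : QuasiNorm 𝕜 V) (ι : Type w) : Submodule 𝕜 (ι → V) where
  carrier := {a | ∃ C : ℝ, ∀ i, N (a i) ≤ C}
  zero_mem' := ⟨0, fun _ => le_of_eq N.map_zero⟩
  add_mem' := by
    rintro a b ⟨C, hC⟩ ⟨C', hC'⟩
    obtain ⟨D, hD1, hD⟩ := N.exists_add_le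
    refine ⟨D * (C + C'), fun i => (hD _ _).trans ?_⟩
    exact mul_le_mul_of_nonneg_left (add_le_add (hC i) (hC' i)) (by linarith)
  smul_mem' := by
    rintro c a ⟨C, hC⟩
    refine ⟨‖c‖ * C, fun i => ?_⟩
    rw [Pi.smul_apply, N.smul']
    exact mul_le_mul_of_nonneg_left (hC i) (norm_nonneg c)

/-- The bounded families that tend to `0` along the ultrafilter. -/
def nullFamilies (N : QuasiNorm 𝕜 V) {ι : Type w} (U : Ultrafilter ι) :
    Submodule 𝕜 (N.boundedFamilies ι) where
  carrier := {a | Tendsto (fun i => N ((a : ι → V) i)) U (𝓝 0)}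
  zero_mem' := by
    have h : (fun i : ι => N (((0 : N.boundedFamilies ι) : ι → V) i)) = fun _ => 0 :=
      funext fun _ => N.map_zero
    change Tendsto _ _ _
    rw [h]
    exact tendsto_const_nhds
  add_mem' := by
    intro a b ha hb
    obtain ⟨D, hD1, hD⟩ := N.exists_add_le
    have h : Tendsto (fun i => D * (N ((a : ι → V) i) + N ((b : ι → V) i))) U (𝓝 0) := by
      have h' := (Tendsto.add ha hb).const_mul D
      simpa using h'
    exact squeeze_zero (fun i => N.nonneg' _) (fun i => hD _ _) h
  smul_mem' := by
    intro c a ha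
    have h : Tendsto (fun i => ‖c‖ * N ((a : ι → V) i)) U (𝓝 0) := by
      have h' := Tendsto.const_mul ‖c‖ ha
      simpa using h'
    refine h.congr fun i => ?_
    exact (N.smul' c _).symm

/-- The ultrapower `V_U`: bounded families modulo the families that are null along `U`. -/
abbrev Ultrapower (N : QuasiNorm 𝕜 V) {ι : Type w} (U : Ultrafilter ι) :=
  (N.boundedFamilies ι) ⧸ (N.nullFamilies U)

/-- The class in the ultrapower of a bounded family. -/
def ultraMk (N : QuasiNorm 𝕜 V) {ι : Type w} (U : Ultrafilter ι) (a : N.boundedFamilies ι) :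
    N.Ultrapower U :=
  (N.nullFamilies U).mkQ a

theorem ultraMk_eq_zero_iff (N : QuasiNorm 𝕜 V) {ι : Type w} (U : Ultrafilter ι)
    (a : N.boundedFamilies ι) :
    N.ultraMk U a = 0 ↔ Tendsto (fun i => N ((a : ι → V) i)) U (𝓝 0) := by
  unfold ultraMk
  rw [Submodule.mkQ_apply, Submodule.Quotient.mk_eq_zero]
  exact Iff.rfl

theorem ultraMk_surjective (N : QuasiNorm 𝕜 V) {ι : Type w} (U : Ultrafilter ι)
    (ξ : N.Ultrapower U) : ∃ a, N.ultraMk U a = ξ :=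
  Submodule.mkQ_surjective _ ξ

/-- The nonnegative bounds of the representatives of an element of the ultrapower. -/
def ultraBounds (N : QuasiNorm 𝕜 V) {ι : Type w} (U : Ultrafilter ι) (ξ : N.Ultrapower U) :
    Set ℝ :=
  {C | 0 ≤ C ∧ ∃ a : N.boundedFamilies ι, N.ultraMk U a = ξ ∧ ∀ i, N ((a : ι → V) i) ≤ C}

theorem ultraBounds_nonempty (N : QuasiNorm 𝕜 V) {ι : Type w} (U : Ultrafilter ι)
    (ξ : N.Ultrapower U) : (N.ultraBounds U ξ).Nonempty := by
  obtain ⟨a, rfl⟩ := N.ultraMk_surjective U ξ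
  obtain ⟨C, hC⟩ := a.2
  exact ⟨max C 0, le_max_right _ _, a, rfl, fun i => (hC i).trans (le_max_left _ _)⟩

theorem ultraBounds_bddBelow (N : QuasiNorm 𝕜 V) {ι : Type w} (U : Ultrafilter ι)
    (ξ : N.Ultrapower U) : BddBelow (N.ultraBounds U ξ) := ⟨0, fun _ hC => hC.1⟩

theorem ultraBounds_smul (N : QuasiNorm 𝕜 V) {ι : Type w} (U : Ultrafilter ι)
    (ξ : N.Ultrapower U) (c : 𝕜) {C : ℝ} (hC : C ∈ N.ultraBounds U ξ) :
    ‖c‖ * C ∈ N.ultraBounds U (c • ξ) := by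
  obtain ⟨h0, a, rfl, ha⟩ := hC
  refine ⟨mul_nonneg (norm_nonneg c) h0, c • a, ?_, fun i => ?_⟩
  · exact LinearMap.map_smul _ c a
  · have h : N (((c • a : N.boundedFamilies ι) : ι → V) i) = ‖c‖ * N ((a : ι → V) i) :=
      N.smul' c _
    rw [h]
    exact mul_le_mul_of_nonneg_left (ha i) (norm_nonneg c)

theorem sInf_ultraBounds_smul_le (N : QuasiNorm 𝕜 V) {ι : Type w} (U : Ultrafilter ι)
    (ξ : N.Ultrapower U) (c : 𝕜) :
    sInf (N.ultraBounds U (c • ξ)) ≤ ‖c‖ * sInf (N.ultraBounds U ξ) := by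
  have h0 : 0 ≤ sInf (N.ultraBounds U ξ) := Real.sInf_nonneg fun _ h => h.1
  refine le_of_forall_pos_le_add fun ε hε => ?_
  obtain ⟨C, hC, hlt⟩ := Real.lt_sInf_add_pos (N.ultraBounds_nonempty U ξ)
    (show 0 < ε / (‖c‖ + 1) by positivity)
  refine (csInf_le (N.ultraBounds_bddBelow U _) (N.ultraBounds_smul U ξ c hC)).trans ?_
  have hc : 0 ≤ ‖c‖ := norm_nonneg c
  have h1 : ‖c‖ * C ≤ ‖c‖ * (sInf (N.ultraBounds U ξ) + ε / (‖c‖ + 1)) :=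
    mul_le_mul_of_nonneg_left hlt.le hc
  have h2 : ‖c‖ * (ε / (‖c‖ + 1)) ≤ ε := by
    rw [mul_div_assoc', div_le_iff₀ (by linarith)]
    nlinarith
  linarith

/-- The quasi-norm of the ultrapower: the quotient quasi-norm of the supremum quasi-norm of
`ℓ_∞(ι, V)`. (When `N` is continuous, in particular a norm, it is `lim_U N (a i)`.) -/
noncomputable def ultrapower (N : QuasiNorm 𝕜 V) {ι : Type w} (U : Ultrafilter ι) :
    QuasiNorm 𝕜 (N.Ultrapower U) where
  toFun := fun ξ => sInf (N.ultraBounds U ξ)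
  nonneg' := fun ξ => Real.sInf_nonneg fun _ h => h.1
  eq_zero_iff' := by
    intro ξ
    constructor
    · intro h
      obtain ⟨D, hD1, hD⟩ := N.exists_add_le
      obtain ⟨a, rfl⟩ := N.ultraMk_surjective U ξ
      rw [ultraMk_eq_zero_iff, Metric.tendsto_nhds]
      intro ε hε
      obtain ⟨C, ⟨hC0, b, hb, hbC⟩, hlt⟩ := Real.lt_sInf_add_pos
        (N.ultraBounds_nonempty U (N.ultraMk U a)) (show 0 < ε / (2 * D) by positivity)
      rw [h, zero_add] at hlt
      have hsub : N.ultraMk U (a - b) = 0 := by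
        have h1 : N.ultraMk U (a - b) = N.ultraMk U a - N.ultraMk U b :=
          LinearMap.map_sub _ a b
        rw [h1, hb, sub_self]
      rw [ultraMk_eq_zero_iff, Metric.tendsto_nhds] at hsub
      filter_upwards [hsub (ε / (2 * D)) (by positivity)] with i hi
      rw [Real.dist_eq, sub_zero, abs_of_nonneg (N.nonneg' _)] at hi ⊢
      have h2 : (a : ι → V) i = (b : ι → V) i + ((a - b : N.boundedFamilies ι) : ι → V) i := by
        simp
      rw [h2]
      refine (hD _ _).trans_lt ?_
      have h3 : D * (N ((b : ι → V) i) + N (((a - b : N.boundedFamilies ι) : ι → V) i)) <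
          D * (ε / (2 * D) + ε / (2 * D)) := by
        apply mul_lt_mul_of_pos_left _ (by linarith)
        linarith [hbC i]
      refine h3.trans_le (le_of_eq ?_)
      field_simp
      ring
    · rintro rfl
      refine le_antisymm (csInf_le (N.ultraBounds_bddBelow U _) ⟨le_rfl, 0, ?_, fun i => ?_⟩)
        (Real.sInf_nonneg fun _ h => h.1)
      · exact LinearMap.map_zero _
      · exact le_of_eq N.map_zero
  smul' := by
    intro c ξ
    refine le_antisymm (N.sInf_ultraBounds_smul_le U ξ c) ?_
    rcases eq_or_ne c 0 with rfl | hc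
    · rw [norm_zero, zero_mul]
      exact Real.sInf_nonneg fun _ h => h.1
    · have h := N.sInf_ultraBounds_smul_le U (c • ξ) c⁻¹
      rw [smul_smul, inv_mul_cancel₀ hc, one_smul, norm_inv] at h
      have hpos : 0 < ‖c‖ := norm_pos_iff.2 hc
      rw [inv_mul_eq_div, le_div_iff₀ hpos] at h
      linarith
  add_le' := by
    obtain ⟨D, hD1, hD⟩ := N.exists_add_le
    refine ⟨D, fun ξ η => le_of_forall_pos_le_add fun ε hε => ?_⟩
    obtain ⟨C, ⟨hC0, a, rfl, ha⟩, hlt⟩ := Real.lt_sInf_add_pos (N.ultraBounds_nonempty U ξ)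
      (show 0 < ε / (2 * D) by positivity)
    obtain ⟨C', ⟨hC0', b, rfl, hb⟩, hlt'⟩ := Real.lt_sInf_add_pos (N.ultraBounds_nonempty U η)
      (show 0 < ε / (2 * D) by positivity)
    have hmem : D * (C + C') ∈ N.ultraBounds U (N.ultraMk U a + N.ultraMk U b) := by
      refine ⟨by positivity, a + b, LinearMap.map_add _ a b, fun i => (hD _ _).trans ?_⟩
      exact mul_le_mul_of_nonneg_left (add_le_add (ha i) (hb i)) (by linarith)
    refine (csInf_le (N.ultraBounds_bddBelow U _) hmem).trans ?_
    have h1 : D * (C + C') ≤ D * ((sInf (N.ultraBounds U (N.ultraMk U a)) + ε / (2 * D)) +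
        (sInf (N.ultraBounds U (N.ultraMk U b)) + ε / (2 * D))) :=
      mul_le_mul_of_nonneg_left (by linarith) (by linarith)
    refine h1.trans (le_of_eq ?_)
    field_simp
    ring

end General

section Maps

variable {𝕜 : Type u} [RCLike 𝕜] {V : Type v} [AddCommGroup V] [Module 𝕜 V]
  {W : Type x} [AddCommGroup W] [Module 𝕜 W]

/-- Boundedness of a linear map between quasi-normed spaces. -/
def IsBoundedMap (NV : QuasiNorm 𝕜 V) (NW : QuasiNorm 𝕜 W) (T : V →ₗ[𝕜] W) : Prop :=
  ∃ C : ℝ, ∀ a, NW (T a) ≤ C * NV a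

/-- The map that a bounded operator induces on bounded families. -/
def boundedFamiliesMap (NV : QuasiNorm 𝕜 V) (NW : QuasiNorm 𝕜 W) (T : V →ₗ[𝕜] W)
    (hT : IsBoundedMap NV NW T) (ι : Type w) :
    NV.boundedFamilies ι →ₗ[𝕜] NW.boundedFamilies ι where
  toFun := fun a => ⟨fun i => T ((a : ι → V) i), by
    obtain ⟨C, hC⟩ := hT
    obtain ⟨B, hB⟩ := a.2
    refine ⟨|C| * B, fun i => (hC _).trans ?_⟩
    exact (mul_le_mul_of_nonneg_right (le_abs_self C) (NV.nonneg' _)).trans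
      (mul_le_mul_of_nonneg_left (hB i) (abs_nonneg C))⟩
  map_add' := fun a b => Subtype.ext (funext fun i => T.map_add _ _)
  map_smul' := fun c a => Subtype.ext (funext fun i => T.map_smul c _)

/-- The ultrapower `T_U : V_U → W_U`, `[a_i] ↦ [T a_i]`, of a bounded operator. -/
def ultrapowerMap (NV : QuasiNorm 𝕜 V) (NW : QuasiNorm 𝕜 W) (T : V →ₗ[𝕜] W)
    (hT : IsBoundedMap NV NW T) {ι : Type w} (U : Ultrafilter ι) :
    NV.Ultrapower U →ₗ[𝕜] NW.Ultrapower U :=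
  Submodule.mapQ _ _ (boundedFamiliesMap NV NW T hT ι) (by
    intro a ha
    obtain ⟨C, hC⟩ := hT
    have ha' : Tendsto (fun i => NV ((a : ι → V) i)) U (𝓝 0) := ha
    have h : Tendsto (fun i => C * NV ((a : ι → V) i)) U (𝓝 0) := by
      have h' := ha'.const_mul C
      simpa using h'
    exact squeeze_zero (fun i => NW.nonneg' _) (fun i => hC _) h)

end Maps

end QuasiNorm

/-! ### Quasi-linear maps, twisted sums, disjoint singularity -/

section QuasiLinear

variable {𝕜 : Type u} [RCLike 𝕜]

/-- Quasi-linear maps: homogeneous maps with `‖Ω(a+b) - Ωa - Ωb‖ ≤ C (‖a‖ + ‖b‖)`. -/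
def IsQuasiLinear {X : Type v} [AddCommGroup X] [Module 𝕜 X] {Y : Type w} [AddCommGroup Y]
    [Module 𝕜 Y] (NX : QuasiNorm 𝕜 X) (NY : QuasiNorm 𝕜 Y) (Ω : X → Y) : Prop :=
  (∀ (c : 𝕜) (a : X), Ω (c • a) = c • Ω a) ∧
  ∃ C : ℝ, ∀ a b, NY (Ω (a + b) - Ω a - Ω b) ≤ C * (NX a + NX b)

/-- The quasi-norm `‖(y, a)‖ = ‖y - Ω a‖ + ‖a‖` on `Y × X`, which gives the twisted sum
`Y ⊕_Ω X`. -/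
noncomputable def twistedQuasiNorm {X : Type v} [AddCommGroup X] [Module 𝕜 X] {Y : Type w}
    [AddCommGroup Y] [Module 𝕜 Y] (NX : QuasiNorm 𝕜 X) (NY : QuasiNorm 𝕜 Y) (Ω : X → Y)
    (hΩ : IsQuasiLinear NX NY Ω) : QuasiNorm 𝕜 (Y × X) where
  toFun := fun z => NY (z.1 - Ω z.2) + NX z.2
  nonneg' := fun z => add_nonneg (NY.nonneg' _) (NX.nonneg' _)
  eq_zero_iff' := by
    have hz : Ω 0 = 0 := by simpa using hΩ.1 0 0
    rintro ⟨y, a⟩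
    constructor
    · intro h
      have h1 : NX a = 0 :=
        le_antisymm (by have := NY.nonneg' (y - Ω a); simp only at h; linarith) (NX.nonneg' a)
      have h2 : NY (y - Ω a) = 0 := by simp only at h; linarith
      rw [NX.eq_zero_iff'] at h1
      subst h1
      rw [NY.eq_zero_iff', hz, sub_zero] at h2
      rw [h2]
      rfl
    · intro h
      rw [Prod.mk_eq_zero] at h
      obtain ⟨rfl, rfl⟩ := h
      simp only [hz, sub_zero, NX.map_zero, NY.map_zero, add_zero]
  smul' := by
    rintro c ⟨y, a⟩
    simp only [Prod.smul_mk, hΩ.1, ← smul_sub, NY.smul', NX.smul']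
    ring
  add_le' := by
    obtain ⟨C, hC⟩ := hΩ.2
    obtain ⟨D, hD1, hD⟩ := NY.exists_add_le
    obtain ⟨D', hD1', hD'⟩ := NX.exists_add_le
    refine ⟨D * D + D * |C| + D', ?_⟩
    rintro ⟨y, a⟩ ⟨y', a'⟩
    simp only [Prod.mk_add_mk]
    have e : y + y' - Ω (a + a') =
        ((y - Ω a) + (y' - Ω a')) + -(Ω (a + a') - Ω a - Ω a') := by abel
    have h1 := hD ((y - Ω a) + (y' - Ω a')) (-(Ω (a + a') - Ω a - Ω a'))
    rw [← e, NY.map_neg] at h1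
    have h2 := hD (y - Ω a) (y' - Ω a')
    have h3 := hC a a'
    have h4 := hD' a a'
    have p1 := NY.nonneg' (y - Ω a)
    have p2 := NY.nonneg' (y' - Ω a')
    have p3 := NX.nonneg' a
    have p4 := NX.nonneg' a'
    have h5 : NY (Ω (a + a') - Ω a - Ω a') ≤ |C| * (NX a + NX a') :=
      h3.trans (mul_le_mul_of_nonneg_right (le_abs_self C) (by linarith))
    have h6 : NY (y + y' - Ω (a + a')) ≤
        D * (D * (NY (y - Ω a) + NY (y' - Ω a')) + |C| * (NX a + NX a')) :=
      h1.trans (mul_le_mul_of_nonneg_left (by linarith) (by linarith))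
    have hD0 : 0 ≤ D := by linarith
    have hC0 := abs_nonneg C
    have q1 : 0 ≤ D * D * (NX a + NX a') := by positivity
    have q2 : 0 ≤ D * |C| * (NY (y - Ω a) + NY (y' - Ω a')) := by positivity
    have q3 : 0 ≤ D' * (NY (y - Ω a) + NY (y' - Ω a')) := by positivity
    nlinarith

/-- `ω : X → Y` is a quasi-linear map associated to the short exact sequence
`0 → Y → Z → X → 0` with inclusion `j` and quotient map `q`: the sequence is equivalent to
`0 → Y → Y ⊕_ω X → X → 0`. -/
def IsAssociated {X : Type v} [AddCommGroup X] [Module 𝕜 X] {Y : Type w} [AddCommGroup Y]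
    [Module 𝕜 Y] {Z : Type x} [AddCommGroup Z] [Module 𝕜 Z] (NX : QuasiNorm 𝕜 X)
    (NY : QuasiNorm 𝕜 Y) (NZ : QuasiNorm 𝕜 Z) (j : Y →ₗ[𝕜] Z) (q : Z →ₗ[𝕜] X) (ω : X → Y) :
    Prop :=
  ∃ hω : IsQuasiLinear NX NY ω, ∃ T : (Y × X) ≃ₗ[𝕜] Z,
    (twistedQuasiNorm NX NY ω hω).IsBoundedMap NZ T.toLinearMap ∧
    NZ.IsBoundedMap (twistedQuasiNorm NX NY ω hω) T.symm.toLinearMap ∧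
    (∀ y, T (y, 0) = j y) ∧ ∀ y a, q (T (y, a)) = a

/-- The restriction of `ω` to the subspace `E` is trivial: it is at finite distance from a
linear, not necessarily bounded, map. -/
def IsTrivialOn {X : Type v} [AddCommGroup X] [Module 𝕜 X] {Y : Type w} [AddCommGroup Y]
    [Module 𝕜 Y] (NX : QuasiNorm 𝕜 X) (NY : QuasiNorm 𝕜 Y) (ω : X → Y) (E : Submodule 𝕜 X) :
    Prop :=
  ∃ L : E →ₗ[𝕜] Y, ∃ C : ℝ, ∀ a : E, NY (ω a - L a) ≤ C * NX a

/-- `ω` is disjointly singular: it is not trivial on any infinite-dimensional (closed) subspace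
generated by a disjoint sequence. -/
def IsDisjointlySingular {X : Type v} [AddCommGroup X] [Module 𝕜 X] {Y : Type w}
    [AddCommGroup Y] [Module 𝕜 Y] (NX : QuasiNorm 𝕜 X) (NY : QuasiNorm 𝕜 Y)
    (disj : X → X → Prop) (ω : X → Y) : Prop :=
  ∀ e : ℕ → X, Pairwise (fun m n => disj (e m) (e n)) →
    ¬ FiniteDimensional 𝕜 (NX.closedSpan (Set.range e)) →
    ¬ IsTrivialOn NX NY ω (NX.closedSpan (Set.range e))

/-- An operator `τ : Z → X` is disjointly singular: it is not an isomorphism onto its image on any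
infinite-dimensional (closed) subspace generated by a disjoint sequence. -/
def IsDisjointlySingularOp {Z : Type v} [AddCommGroup Z] [Module 𝕜 Z] {X : Type w}
    [AddCommGroup X] [Module 𝕜 X] (NZ : QuasiNorm 𝕜 Z) (NX : QuasiNorm 𝕜 X)
    (disj : Z → Z → Prop) (τ : Z →ₗ[𝕜] X) : Prop :=
  ∀ e : ℕ → Z, Pairwise (fun m n => disj (e m) (e n)) →
    ¬ FiniteDimensional 𝕜 (NZ.closedSpan (Set.range e)) →
    ¬ ∃ c : ℝ, 0 < c ∧ ∀ z ∈ NZ.closedSpan (Set.range e), c * NZ z ≤ NX (τ z)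

/-- The finite-dimensional form of super disjoint singularity of an operator `τ`: whenever each
`E n` is generated by `n` disjoint nonzero vectors, there are subspaces `F n` of `E n` generated by
`k n` disjoint nonzero vectors such that `k n → ∞` and `‖τ|_{F n}‖ → 0`. -/
def IsFinitelySuperDisjointlySingularOp {Z : Type v} [AddCommGroup Z] [Module 𝕜 Z] {X : Type w}
    [AddCommGroup X] [Module 𝕜 X] (NZ : QuasiNorm 𝕜 Z) (NX : QuasiNorm 𝕜 X)
    (disj : Z → Z → Prop) (τ : Z →ₗ[𝕜] X) : Prop :=
  ∀ e : (n : ℕ) → Fin n → Z,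
    (∀ n i, e n i ≠ 0) → (∀ n, Pairwise (fun i i' => disj (e n i) (e n i'))) →
    ∃ (k : ℕ → ℕ) (f : (n : ℕ) → Fin (k n) → Z) (ε : ℕ → ℝ),
      (∀ n i, f n i ≠ 0) ∧ (∀ n, Pairwise (fun i i' => disj (f n i) (f n i'))) ∧
      (∀ n i, f n i ∈ Submodule.span 𝕜 (Set.range (e n))) ∧
      Tendsto k atTop atTop ∧ Tendsto ε atTop (𝓝 0) ∧
      ∀ n, ∀ z ∈ Submodule.span 𝕜 (Set.range (f n)), NX (τ z) ≤ ε n * NZ z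

end QuasiLinear

/-! ### The space `L₀(μ)` -/

/-- The space `L₀(μ)` of the (classes of) measurable functions `S → 𝕜`. -/
def L0 (𝕜 : Type u) [RCLike 𝕜] {S : Type v} [MeasurableSpace S] (μ : Measure S) : Type (max u v) :=
  S →ₘ[μ] 𝕜

namespace L0

variable {𝕜 : Type u} [RCLike 𝕜] {S : Type v} [MeasurableSpace S] {μ : Measure S}

noncomputable instance : AddCommGroup (L0 𝕜 μ) := inferInstanceAs (AddCommGroup (S →ₘ[μ] 𝕜))

noncomputable instance : Module 𝕜 (L0 𝕜 μ) := inferInstanceAs (Module 𝕜 (S →ₘ[μ] 𝕜))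

noncomputable instance : Mul (L0 𝕜 μ) := inferInstanceAs (Mul (S →ₘ[μ] 𝕜))

noncomputable instance : CoeFun (L0 𝕜 μ) (fun _ => S → 𝕜) := ⟨fun f => AEEqFun.cast f⟩

/-- The class of a measurable function. -/
def mk (f : S → 𝕜) (hf : AEStronglyMeasurable f μ) : L0 𝕜 μ := AEEqFun.mk f hf

theorem coeFn_mk (f : S → 𝕜) (hf : AEStronglyMeasurable f μ) : ⇑(mk f hf) =ᵐ[μ] f :=
  AEEqFun.coeFn_mk f hf

theorem aestronglyMeasurable (f : L0 𝕜 μ) : AEStronglyMeasurable (⇑f) μ :=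
  AEEqFun.aestronglyMeasurable f

theorem ext {f g : L0 𝕜 μ} (h : ⇑f =ᵐ[μ] ⇑g) : f = g := AEEqFun.ext h

theorem coeFn_add (f g : L0 𝕜 μ) : ⇑(f + g) =ᵐ[μ] fun t => f t + g t := AEEqFun.coeFn_add f g

theorem coeFn_smul (c : 𝕜) (f : L0 𝕜 μ) : ⇑(c • f) =ᵐ[μ] fun t => c * f t :=
  AEEqFun.coeFn_smul c f

theorem coeFn_mul (f g : L0 𝕜 μ) : ⇑(f * g) =ᵐ[μ] fun t => f t * g t := AEEqFun.coeFn_mul f g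

theorem add_mul (f g h : L0 𝕜 μ) : (f + g) * h = f * h + g * h := by
  refine ext ?_
  filter_upwards [coeFn_mul (f + g) h, coeFn_add f g, coeFn_mul f h, coeFn_mul g h,
    coeFn_add (f * h) (g * h)] with t h1 h2 h3 h4 h5
  rw [h1, h5, h2, h3, h4, _root_.add_mul]

/-- The function `|f| ∧ |g|`. -/
noncomputable def infAbs (f g : L0 𝕜 μ) : L0 𝕜 μ :=
  mk (fun t => ((min ‖f t‖ ‖g t‖ : ℝ) : 𝕜))
    (RCLike.continuous_ofReal.comp_aestronglyMeasurable
      ((continuous_fst.min continuous_snd : Continuous fun p : ℝ × ℝ => min p.1 p.2)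
        |>.comp_aestronglyMeasurable
          (f.aestronglyMeasurable.norm.prodMk g.aestronglyMeasurable.norm)))

theorem coeFn_infAbs (f g : L0 𝕜 μ) :
    ⇑(infAbs f g) =ᵐ[μ] fun t => ((min ‖f t‖ ‖g t‖ : ℝ) : 𝕜) :=
  coeFn_mk _ _

/-- If `|f| ≤ |g|`, then `f = m g` for some `m` with `|m| ≤ 1`. -/
theorem exists_eq_mul {f g : L0 𝕜 μ} (h : ∀ᵐ t ∂μ, ‖f t‖ ≤ ‖g t‖) :
    ∃ m : L0 𝕜 μ, (∀ᵐ t ∂μ, ‖m t‖ ≤ 1) ∧ f = m * g := by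
  have hmeas : AEStronglyMeasurable (fun t => f t / g t) μ := by
    refine AEMeasurable.aestronglyMeasurable ?_
    exact f.aestronglyMeasurable.aemeasurable.div g.aestronglyMeasurable.aemeasurable
  refine ⟨mk _ hmeas, ?_, ?_⟩
  · filter_upwards [h, coeFn_mk _ hmeas] with t ht hm
    rw [hm, norm_div]
    exact div_le_one_of_le₀ ht (norm_nonneg _)
  · refine ext ?_
    filter_upwards [h, coeFn_mk _ hmeas, coeFn_mul (mk _ hmeas) g] with t ht hm hmul
    rw [hmul, hm]
    rcases eq_or_ne (g t) 0 with h0 | h0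
    · rw [h0, norm_zero, norm_le_zero_iff] at ht
      rw [ht, h0, mul_zero]
    · rw [div_mul_cancel₀ _ h0]

end L0

/-! ### Köthe function spaces -/

/-- A Köthe function space: a solid linear subspace of `L₀(μ)` with a monotone quasi-norm which
contains the characteristic functions of the sets of finite measure. -/
structure KotheSpace (𝕜 : Type u) [RCLike 𝕜] {S : Type v} [MeasurableSpace S]
    (μ : Measure S) where
  carrier : Submodule 𝕜 (L0 𝕜 μ)
  qnorm : QuasiNorm 𝕜 carrier
  solid : ∀ (f : L0 𝕜 μ) (g : carrier),
    (∀ᵐ t ∂μ, ‖f t‖ ≤ ‖(g : L0 𝕜 μ) t‖) → ∃ hf : f ∈ carrier, qnorm ⟨f, hf⟩ ≤ qnorm g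
  indicator_mem : ∀ A : Set S, MeasurableSet A → μ A < ∞ → ∀ f : L0 𝕜 μ,
    (⇑f =ᵐ[μ] A.indicator fun _ => (1 : 𝕜)) → f ∈ carrier

namespace KotheSpace

variable {𝕜 : Type u} [RCLike 𝕜] {S : Type v} [MeasurableSpace S] {μ : Measure S}

/-- Disjointly supported elements. -/
def Disj (K : KotheSpace 𝕜 μ) (a b : K.carrier) : Prop :=
  ∀ᵐ t ∂μ, (a : L0 𝕜 μ) t = 0 ∨ (b : L0 𝕜 μ) t = 0

theorem infAbs_mem (K : KotheSpace 𝕜 μ) (f : L0 𝕜 μ) (g : K.carrier) :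
    L0.infAbs f (g : L0 𝕜 μ) ∈ K.carrier := by
  refine (K.solid _ g ?_).1
  filter_upwards [L0.coeFn_infAbs f (g : L0 𝕜 μ)] with t ht
  rw [ht, RCLike.norm_ofReal, abs_of_nonneg (le_min (norm_nonneg _) (norm_nonneg _))]
  exact min_le_right _ _

/-- Disjointness `|ξ| ∧ |η| = 0` in the ultrapower, whose lattice operations are the
coordinatewise ones: `|[a_i]| ∧ |[b_i]| = [|a_i| ∧ |b_i|]`. -/
def UltraDisj (K : KotheSpace 𝕜 μ) {ι : Type w} (U : Ultrafilter ι)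
    (ξ η : K.qnorm.Ultrapower U) : Prop :=
  ∃ a b : K.qnorm.boundedFamilies ι, K.qnorm.ultraMk U a = ξ ∧ K.qnorm.ultraMk U b = η ∧
    Tendsto (fun i => K.qnorm ⟨L0.infAbs ((a : ι → K.carrier) i : L0 𝕜 μ)
      ((b : ι → K.carrier) i), K.infAbs_mem _ _⟩) U (𝓝 0)

/-- The quasi-norm of `K`, extended to all of `L₀` by the value `∞` outside `K`. -/
noncomputable def extNorm (K : KotheSpace 𝕜 μ) (f : L0 𝕜 μ) : ℝ≥0∞ :=
  open Classical in
  if hf : f ∈ K.carrier then ENNReal.ofReal (K.qnorm ⟨f, hf⟩) else ⊤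

/-- `q`-convexity for some `q > 0`: there are `q > 0` and `M` such that
`‖(∑ |a_i| ^ q) ^ (1/q)‖ ≤ M (∑ ‖a_i‖ ^ q) ^ (1/q)` for all finite families. -/
def HasConvexity (K : KotheSpace 𝕜 μ) : Prop :=
  ∃ q : ℝ, 0 < q ∧ ∃ M : ℝ, ∀ (n : ℕ) (a : Fin n → K.carrier) (f : L0 𝕜 μ),
    (∀ᵐ t ∂μ, ‖f t‖ ≤ (∑ i, ‖(a i : L0 𝕜 μ) t‖ ^ q) ^ (1 / q)) →
    ∃ hf : f ∈ K.carrier, K.qnorm ⟨f, hf⟩ ≤ M * (∑ i, K.qnorm (a i) ^ q) ^ (1 / q)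

/-- The distance of `Ω|_E` to the linear maps `E → W`, where `‖T‖` is the supremum over the unit
ball of `E` and `size` is the (extended) quasi-norm used in the target. -/
noncomputable def distLinear (K : KotheSpace 𝕜 μ) {W : Type w} [AddCommGroup W] [Module 𝕜 W]
    (size : W → ℝ≥0∞) (Ω : K.carrier → W) (E : Submodule 𝕜 K.carrier) : ℝ≥0∞ :=
  ⨅ L : E →ₗ[𝕜] W, ⨆ (a : E) (_ : K.qnorm (a : K.carrier) ≤ 1), size (Ω a - L a)

/-- The modulus of super disjoint singularity `ψ_Ω(n)`: the infimum of the distances of `Ω|_E` to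
the linear maps, over the subspaces `E` generated by `n` disjoint nonzero vectors
(`∞` if there is none). -/
noncomputable def modulus (K : KotheSpace 𝕜 μ) {W : Type w} [AddCommGroup W] [Module 𝕜 W]
    (size : W → ℝ≥0∞) (Ω : K.carrier → W) (n : ℕ) : ℝ≥0∞ :=
  ⨅ (e : Fin n → K.carrier) (_ : ∀ i, e i ≠ 0) (_ : Pairwise fun i i' => K.Disj (e i) (e i')),
    K.distLinear size Ω (Submodule.span 𝕜 (Set.range e))

/-- Let `0 → Y → Z → K → 0` be the sequence defined by a quasi-linear map or a centralizer. Its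
ultrapower `K_U → Y_U`, which is any quasi-linear map associated to the ultrapower sequence
`0 → Y_U → Z_U → K_U → 0`, is disjointly singular. -/
def UltrapowerDisjointlySingular {Y : Type w} [AddCommGroup Y] [Module 𝕜 Y] {Z : Type x}
    [AddCommGroup Z] [Module 𝕜 Z] (K : KotheSpace 𝕜 μ) (NY : QuasiNorm 𝕜 Y)
    (NZ : QuasiNorm 𝕜 Z) (j : Y →ₗ[𝕜] Z) (hj : NY.IsBoundedMap NZ j)
    (q : Z →ₗ[𝕜] K.carrier) (hq : NZ.IsBoundedMap K.qnorm q) {ι : Type y} (U : Ultrafilter ι) :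
    Prop :=
  ∀ ω : K.qnorm.Ultrapower U → NY.Ultrapower U,
    IsAssociated (K.qnorm.ultrapower U) (NY.ultrapower U) (NZ.ultrapower U)
      (NY.ultrapowerMap NZ j hj U) (NZ.ultrapowerMap K.qnorm q hq U) ω →
    IsDisjointlySingular (K.qnorm.ultrapower U) (NY.ultrapower U) (K.UltraDisj U) ω

/-! ### The sequence defined by a quasi-linear map -/

section QuasiLinearSequence

variable {Y : Type w} [AddCommGroup Y] [Module 𝕜 Y] (K : KotheSpace 𝕜 μ) (NY : QuasiNorm 𝕜 Y)
  (Ω : K.carrier → Y) (hΩ : IsQuasiLinear K.qnorm NY Ω)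

theorem inl_isBoundedMap : NY.IsBoundedMap (twistedQuasiNorm K.qnorm NY Ω hΩ)
    (LinearMap.inl 𝕜 Y K.carrier) := by
  have hz : Ω 0 = 0 := by simpa using hΩ.1 0 0
  refine ⟨1, fun a => ?_⟩
  change NY (a - Ω 0) + K.qnorm 0 ≤ 1 * NY a
  rw [hz, sub_zero, K.qnorm.map_zero]
  linarith

theorem snd_isBoundedMap : (twistedQuasiNorm K.qnorm NY Ω hΩ).IsBoundedMap K.qnorm
    (LinearMap.snd 𝕜 Y K.carrier) := by
  refine ⟨1, fun z => ?_⟩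
  change K.qnorm z.2 ≤ 1 * (NY (z.1 - Ω z.2) + K.qnorm z.2)
  have := NY.nonneg' (z.1 - Ω z.2)
  linarith

end QuasiLinearSequence

/-! ### Centralizers -/

/-- Centralizers `Ω : K → L₀`: homogeneous maps for which there is `C` such that
`Ω(f a) - f Ω(a) ∈ K` and `‖Ω(f a) - f Ω(a)‖ ≤ C ‖f‖_∞ ‖a‖` for all `f ∈ L_∞` and `a ∈ K`.
Here `b` is the element `f a` of `K`. -/
def IsCentralizer (K : KotheSpace 𝕜 μ) (Ω : K.carrier → (L0 𝕜 μ)) : Prop :=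
  (∀ (c : 𝕜) (a : K.carrier), Ω (c • a) = c • Ω a) ∧
  ∃ C : ℝ, ∀ (f : L0 𝕜 μ) (M : ℝ), (∀ᵐ t ∂μ, ‖f t‖ ≤ M) →
    ∀ a b : K.carrier, (b : L0 𝕜 μ) = f * (a : L0 𝕜 μ) →
      ∃ h : Ω b - f * Ω a ∈ K.carrier, K.qnorm ⟨_, h⟩ ≤ C * M * K.qnorm a

theorem exists_dominating (K : KotheSpace 𝕜 μ) :
    ∃ B : ℝ, 0 ≤ B ∧ ∀ a b : K.carrier, ∃ c : K.carrier,
      (∀ᵐ t ∂μ, ‖(a : L0 𝕜 μ) t‖ ≤ ‖(c : L0 𝕜 μ) t‖) ∧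
      (∀ᵐ t ∂μ, ‖(b : L0 𝕜 μ) t‖ ≤ ‖(c : L0 𝕜 μ) t‖) ∧
      K.qnorm c ≤ B * (K.qnorm a + K.qnorm b) := by
  obtain ⟨D, hD1, hD⟩ := K.qnorm.exists_add_le
  have habs : ∀ a : K.carrier, ∃ a' : K.carrier, K.qnorm a' ≤ K.qnorm a ∧
      ∀ᵐ t ∂μ, (a' : L0 𝕜 μ) t = ((‖(a : L0 𝕜 μ) t‖ : ℝ) : 𝕜) := by
    intro a
    have h := L0.coeFn_mk (μ := μ) (fun t => ((‖(a : L0 𝕜 μ) t‖ : ℝ) : 𝕜))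
      (RCLike.continuous_ofReal.comp_aestronglyMeasurable (a : L0 𝕜 μ).aestronglyMeasurable.norm)
    obtain ⟨hm, hle⟩ := K.solid _ a (by
      filter_upwards [h] with t ht
      rw [ht, RCLike.norm_ofReal, abs_norm])
    exact ⟨⟨_, hm⟩, hle, h⟩
  refine ⟨D, by linarith, fun a b => ?_⟩
  obtain ⟨a', ha, ha'⟩ := habs a
  obtain ⟨b', hb, hb'⟩ := habs b
  have hsum : ∀ᵐ t ∂μ, ‖((a' + b' : K.carrier) : L0 𝕜 μ) t‖ =
      ‖(a : L0 𝕜 μ) t‖ + ‖(b : L0 𝕜 μ) t‖ := by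
    filter_upwards [ha', hb', L0.coeFn_add (a' : L0 𝕜 μ) b'] with t h1 h2 h3
    rw [Submodule.coe_add, h3, h1, h2, ← RCLike.ofReal_add, RCLike.norm_ofReal,
      abs_of_nonneg (by positivity)]
  refine ⟨a' + b', ?_, ?_, ?_⟩
  · filter_upwards [hsum] with t ht
    rw [ht]
    exact le_add_of_nonneg_right (norm_nonneg _)
  · filter_upwards [hsum] with t ht
    rw [ht]
    exact le_add_of_nonneg_left (norm_nonneg _)
  · exact (hD _ _).trans (mul_le_mul_of_nonneg_left (add_le_add ha hb) (by linarith))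

/-- A centralizer is quasi-linear. -/
theorem IsCentralizer.quasiLinear {K : KotheSpace 𝕜 μ} {Ω : K.carrier → (L0 𝕜 μ)}
    (hΩ : K.IsCentralizer Ω) : ∃ C : ℝ, ∀ a b : K.carrier,
      ∃ h : Ω (a + b) - Ω a - Ω b ∈ K.carrier,
        K.qnorm ⟨_, h⟩ ≤ C * (K.qnorm a + K.qnorm b) := by
  obtain ⟨C, hC⟩ := hΩ.2
  obtain ⟨B, hB0, hB⟩ := K.exists_dominating
  obtain ⟨D, hD1, hD⟩ := K.qnorm.exists_add_le
  refine ⟨D * D * (4 * |C|) * B, fun a b => ?_⟩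
  obtain ⟨c, hac, hbc, hc⟩ := hB a b
  obtain ⟨f, hf, hfa⟩ := L0.exists_eq_mul hac
  obtain ⟨g, hg, hgb⟩ := L0.exists_eq_mul hbc
  have hfg : ∀ᵐ t ∂μ, ‖(f + g) t‖ ≤ 2 := by
    filter_upwards [hf, hg, L0.coeFn_add f g] with t h1 h2 h3
    rw [h3]
    exact (norm_add_le _ _).trans (by linarith)
  obtain ⟨m1, n1⟩ := hC f 1 hf c a hfa
  obtain ⟨m2, n2⟩ := hC g 1 hg c b hgb
  obtain ⟨m3, n3⟩ := hC (f + g) 2 hfg c (a + b) (by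
    rw [Submodule.coe_add, L0.add_mul, ← hfa, ← hgb])
  have e : Ω (a + b) - Ω a - Ω b =
      (Ω (a + b) - (f + g) * Ω c) + -(Ω a - f * Ω c) + -(Ω b - g * Ω c) := by
    rw [L0.add_mul]
    abel
  have hmem : Ω (a + b) - Ω a - Ω b ∈ K.carrier := by
    rw [e]
    exact K.carrier.add_mem (K.carrier.add_mem m3 (K.carrier.neg_mem m1)) (K.carrier.neg_mem m2)
  refine ⟨hmem, ?_⟩
  have e' : (⟨_, hmem⟩ : K.carrier) = (⟨_, m3⟩ + -⟨_, m1⟩) + -⟨_, m2⟩ := Subtype.ext e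
  rw [e']
  have h1 := hD (⟨_, m3⟩ + -⟨_, m1⟩) (-⟨_, m2⟩)
  have h2 := hD ⟨_, m3⟩ (-⟨_, m1⟩)
  rw [K.qnorm.map_neg] at h1 h2
  have p := K.qnorm.nonneg' c
  have p2 := K.qnorm.nonneg' ⟨_, m2⟩
  have hCc : C * K.qnorm c ≤ |C| * K.qnorm c := mul_le_mul_of_nonneg_right (le_abs_self C) p
  have hD0 : 0 ≤ D := by linarith
  have h3 : K.qnorm ⟨_, m2⟩ ≤ D * K.qnorm ⟨_, m2⟩ := le_mul_of_one_le_left p2 hD1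
  calc _ ≤ D * (D * (K.qnorm ⟨_, m3⟩ + K.qnorm ⟨_, m1⟩) + D * K.qnorm ⟨_, m2⟩) :=
        h1.trans (mul_le_mul_of_nonneg_left (add_le_add h2 h3) hD0)
    _ = D * D * (K.qnorm ⟨_, m3⟩ + K.qnorm ⟨_, m1⟩ + K.qnorm ⟨_, m2⟩) := by ring
    _ ≤ D * D * (4 * |C| * K.qnorm c) :=
        mul_le_mul_of_nonneg_left (by linarith) (by positivity)
    _ ≤ D * D * (4 * |C| * (B * (K.qnorm a + K.qnorm b))) := by gcongr
    _ = _ := by ring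

section CentralizerSequence

variable (K : KotheSpace 𝕜 μ) (Ω : K.carrier → (L0 𝕜 μ)) (hΩ : K.IsCentralizer Ω)

theorem IsCentralizer.map_zero {K : KotheSpace 𝕜 μ} {Ω : K.carrier → (L0 𝕜 μ)}
    (hΩ : K.IsCentralizer Ω) : Ω 0 = 0 := by simpa using hΩ.1 0 0

/-- The space `d_Ω K` of the pairs `(w, a) ∈ L₀ × K` with `w - Ω a ∈ K`. -/
noncomputable def derived : Submodule 𝕜 ((L0 𝕜 μ) × K.carrier) where
  carrier := {z | z.1 - Ω z.2 ∈ K.carrier}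
  zero_mem' := by
    change (0 : L0 𝕜 μ) - Ω 0 ∈ K.carrier
    rw [hΩ.map_zero, sub_zero]
    exact K.carrier.zero_mem
  add_mem' := by
    intro z z' hz hz'
    obtain ⟨C, hC⟩ := hΩ.quasiLinear
    obtain ⟨h, -⟩ := hC z.2 z'.2
    have e : (z + z').1 - Ω (z + z').2 =
        (z.1 - Ω z.2) + (z'.1 - Ω z'.2) - (Ω (z.2 + z'.2) - Ω z.2 - Ω z'.2) := by
      rw [Prod.fst_add, Prod.snd_add]
      abel
    change (z + z').1 - Ω (z + z').2 ∈ K.carrier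
    rw [e]
    exact K.carrier.sub_mem (K.carrier.add_mem hz hz') h
  smul_mem' := by
    intro c z hz
    have e : (c • z).1 - Ω (c • z).2 = c • (z.1 - Ω z.2) := by
      rw [Prod.smul_fst, Prod.smul_snd, hΩ.1, smul_sub]
    change (c • z).1 - Ω (c • z).2 ∈ K.carrier
    rw [e]
    exact K.carrier.smul_mem c hz

/-- The element `w - Ω a` of `K`, for `(w, a) ∈ d_Ω K`. -/
noncomputable def defect (z : K.derived Ω hΩ) : K.carrier :=
  ⟨(z : (L0 𝕜 μ) × K.carrier).1 - Ω (z : (L0 𝕜 μ) × K.carrier).2, z.2⟩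

/-- The quasi-norm `‖(w, a)‖ = ‖a‖ + ‖w - Ω a‖` of `d_Ω K`. -/
noncomputable def derivedQuasiNorm : QuasiNorm 𝕜 (K.derived Ω hΩ) where
  toFun := fun z => K.qnorm (z : (L0 𝕜 μ) × K.carrier).2 + K.qnorm (K.defect Ω hΩ z)
  nonneg' := fun z => add_nonneg (K.qnorm.nonneg' _) (K.qnorm.nonneg' _)
  eq_zero_iff' := by
    rintro ⟨⟨f, a⟩, hz⟩
    have p1 := K.qnorm.nonneg' a
    have p2 := K.qnorm.nonneg' (K.defect Ω hΩ ⟨⟨f, a⟩, hz⟩)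
    constructor
    · intro h
      simp only at h
      have h1 : K.qnorm a = 0 := by linarith
      have h2 : K.qnorm (K.defect Ω hΩ ⟨⟨f, a⟩, hz⟩) = 0 := by linarith
      rw [K.qnorm.eq_zero_iff'] at h1 h2
      subst h1
      have h3 : f - Ω 0 = 0 := congrArg Subtype.val h2
      rw [hΩ.map_zero, sub_zero] at h3
      subst h3
      rfl
    · intro h
      have h0 : ((f, a) : (L0 𝕜 μ) × K.carrier) = 0 := congrArg Subtype.val h
      rw [Prod.mk_eq_zero] at h0
      obtain ⟨rfl, rfl⟩ := h0
      have h2 : K.defect Ω hΩ ⟨(0, 0), hz⟩ = 0 := by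
        refine Subtype.ext ?_
        change (0 : L0 𝕜 μ) - Ω 0 = 0
        rw [hΩ.map_zero, sub_zero]
      simp only [h2, K.qnorm.map_zero, add_zero]
  smul' := by
    intro c z
    have h : K.defect Ω hΩ (c • z) = c • K.defect Ω hΩ z := by
      refine Subtype.ext ?_
      change c • (z : (L0 𝕜 μ) × K.carrier).1 - Ω (c • (z : (L0 𝕜 μ) × K.carrier).2) =
        c • ((z : (L0 𝕜 μ) × K.carrier).1 - Ω (z : (L0 𝕜 μ) × K.carrier).2)
      rw [hΩ.1, smul_sub]
    rw [h, K.qnorm.smul', Submodule.coe_smul, Prod.smul_snd, K.qnorm.smul']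
    ring
  add_le' := by
    obtain ⟨C, hC⟩ := hΩ.quasiLinear
    obtain ⟨D, hD1, hD⟩ := K.qnorm.exists_add_le
    refine ⟨D * D + D * |C| + D, ?_⟩
    intro z z'
    obtain ⟨a, ha⟩ : ∃ a, a = (z : (L0 𝕜 μ) × K.carrier).2 := ⟨_, rfl⟩
    obtain ⟨a', ha'⟩ : ∃ a', a' = (z' : (L0 𝕜 μ) × K.carrier).2 := ⟨_, rfl⟩
    obtain ⟨h, hle⟩ := hC a a'
    have e : K.defect Ω hΩ (z + z') =
        (K.defect Ω hΩ z + K.defect Ω hΩ z') + -⟨_, h⟩ := by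
      refine Subtype.ext ?_
      subst ha ha'
      change (z : (L0 𝕜 μ) × K.carrier).1 + (z' : (L0 𝕜 μ) × K.carrier).1 -
          Ω ((z : (L0 𝕜 μ) × K.carrier).2 + (z' : (L0 𝕜 μ) × K.carrier).2) =
        (((z : (L0 𝕜 μ) × K.carrier).1 - Ω (z : (L0 𝕜 μ) × K.carrier).2) +
          ((z' : (L0 𝕜 μ) × K.carrier).1 - Ω (z' : (L0 𝕜 μ) × K.carrier).2)) +
        -(Ω ((z : (L0 𝕜 μ) × K.carrier).2 + (z' : (L0 𝕜 μ) × K.carrier).2) -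
          Ω (z : (L0 𝕜 μ) × K.carrier).2 - Ω (z' : (L0 𝕜 μ) × K.carrier).2)
      abel
    rw [e, Submodule.coe_add, Prod.snd_add, ← ha, ← ha']
    have h1 := hD (K.defect Ω hΩ z + K.defect Ω hΩ z') (-⟨_, h⟩)
    rw [K.qnorm.map_neg] at h1
    have h2 := hD (K.defect Ω hΩ z) (K.defect Ω hΩ z')
    have h4 := hD a a'
    have p1 := K.qnorm.nonneg' (K.defect Ω hΩ z)
    have p2 := K.qnorm.nonneg' (K.defect Ω hΩ z')
    have p3 := K.qnorm.nonneg' a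
    have p4 := K.qnorm.nonneg' a'
    have h5 : K.qnorm ⟨_, h⟩ ≤ |C| * (K.qnorm a + K.qnorm a') :=
      hle.trans (mul_le_mul_of_nonneg_right (le_abs_self C) (by linarith))
    have hD0 : 0 ≤ D := by linarith
    have h6 := h1.trans (mul_le_mul_of_nonneg_left (add_le_add h2 h5) hD0)
    have hC0 := abs_nonneg C
    have q1 : 0 ≤ D * D * (K.qnorm a + K.qnorm a') := by positivity
    have q2 : 0 ≤ D * |C| * (K.qnorm (K.defect Ω hΩ z) + K.qnorm (K.defect Ω hΩ z')) := by
      positivity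
    have q3 : 0 ≤ D * (K.qnorm (K.defect Ω hΩ z) + K.qnorm (K.defect Ω hΩ z')) := by
      positivity
    nlinarith

/-- The inclusion `a ↦ (a, 0)` of `K` into `d_Ω K`. -/
noncomputable def derivedIncl : K.carrier →ₗ[𝕜] K.derived Ω hΩ where
  toFun := fun a => ⟨((a : L0 𝕜 μ), 0), by
    change (a : L0 𝕜 μ) - Ω 0 ∈ K.carrier
    rw [hΩ.map_zero, sub_zero]
    exact a.2⟩
  map_add' := fun a b => Subtype.ext (Prod.ext rfl (add_zero (0 : K.carrier)).symm)
  map_smul' := fun c a => Subtype.ext (Prod.ext rfl (smul_zero c).symm)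

/-- The quotient map `q_Ω : d_Ω K → K`, `(w, a) ↦ a`. -/
noncomputable def derivedQuot : K.derived Ω hΩ →ₗ[𝕜] K.carrier where
  toFun := fun z => (z : (L0 𝕜 μ) × K.carrier).2
  map_add' := fun _ _ => rfl
  map_smul' := fun _ _ => rfl

theorem derivedIncl_isBoundedMap :
    K.qnorm.IsBoundedMap (K.derivedQuasiNorm Ω hΩ) (K.derivedIncl Ω hΩ) := by
  refine ⟨1, fun a => ?_⟩
  change K.qnorm 0 + K.qnorm (K.defect Ω hΩ (K.derivedIncl Ω hΩ a)) ≤ 1 * K.qnorm a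
  have h : K.defect Ω hΩ (K.derivedIncl Ω hΩ a) = a := by
    refine Subtype.ext ?_
    change (a : L0 𝕜 μ) - Ω 0 = a
    rw [hΩ.map_zero, sub_zero]
  rw [h, K.qnorm.map_zero]
  linarith

theorem derivedQuot_isBoundedMap :
    (K.derivedQuasiNorm Ω hΩ).IsBoundedMap K.qnorm (K.derivedQuot Ω hΩ) := by
  refine ⟨1, fun z => ?_⟩
  change K.qnorm (z : (L0 𝕜 μ) × K.carrier).2 ≤
    1 * (K.qnorm (z : (L0 𝕜 μ) × K.carrier).2 + K.qnorm (K.defect Ω hΩ z))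
  have := K.qnorm.nonneg' (K.defect Ω hΩ z)
  linarith

/-- Disjointness in `d_Ω K`, whose elements are functions with values in `𝕜 × 𝕜`. -/
def DerivedDisj (z z' : K.derived Ω hΩ) : Prop :=
  ∀ᵐ t ∂μ,
    ((z : (L0 𝕜 μ) × K.carrier).1 t = 0 ∧
      ((z : (L0 𝕜 μ) × K.carrier).2 : L0 𝕜 μ) t = 0) ∨
    ((z' : (L0 𝕜 μ) × K.carrier).1 t = 0 ∧
      ((z' : (L0 𝕜 μ) × K.carrier).2 : L0 𝕜 μ) t = 0)

/-- Disjointness in the ultrapower of `d_Ω K`: there are disjoint representatives. -/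
def UltraDerivedDisj {ι : Type y} (U : Ultrafilter ι)
    (ζ ζ' : (K.derivedQuasiNorm Ω hΩ).Ultrapower U) : Prop :=
  ∃ z z' : (K.derivedQuasiNorm Ω hΩ).boundedFamilies ι,
    (K.derivedQuasiNorm Ω hΩ).ultraMk U z = ζ ∧ (K.derivedQuasiNorm Ω hΩ).ultraMk U z' = ζ' ∧
    ∀ i, K.DerivedDisj Ω hΩ ((z : ι → K.derived Ω hΩ) i) ((z' : ι → K.derived Ω hΩ) i)

/-- The ultrapower `(q_Ω)_U : (d_Ω K)_U → K_U` is disjointly singular. -/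
def QuotUltrapowerDisjointlySingular {ι : Type y} (U : Ultrafilter ι) : Prop :=
  IsDisjointlySingularOp ((K.derivedQuasiNorm Ω hΩ).ultrapower U) (K.qnorm.ultrapower U)
    (K.UltraDerivedDisj Ω hΩ U)
    ((K.derivedQuasiNorm Ω hΩ).ultrapowerMap K.qnorm (K.derivedQuot Ω hΩ)
      (K.derivedQuot_isBoundedMap Ω hΩ) U)

end CentralizerSequence

end KotheSpace

/-! Every condition is compared with one finite-dimensional statement, `HasDisjointLifting`: some
`n` disjoint nonzero vectors of `K` span a subspace on which the quotient map `q` of the sequence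
has a linear lifting of norm at most `C`. Conditions (1) and (2) both say that no single `C` works
for all `n`.

For the modulus this is a translation. A linear map `L` at distance at most `C` from `Ω` on `E`
yields the lifting `a ↦ (L a, a)`, and the first coordinate of a lifting is a linear map close to
`Ω` (`tendsto_modulus_iff`).

For ultrapowers, the ultrapower of an exact sequence is exact, and an associated quasi-linear map is
trivial on a subspace exactly when the quotient map has a bounded linear lifting there
(`IsAssociated.isTrivialOn_iff`). Uniform liftings for all `n` are glued along a countably
incomplete ultrafilter: diagonals give an infinite disjoint sequence, and the ultraproduct of the
lifted spans carries a lifting (`exists_lifting_closedSpan`). Conversely, finitely many disjoint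
elements of `K_U` have disjoint representatives, liftings can be represented by families lying
exactly above these, and compactness of the unit sphere of `𝕜ⁿ` brings the bound down to some
coordinate, with a constant independent of `n` (`HasDisjointLifting.of_ultrapower`).

For a centralizer, `d_Ω K` is a module over `L_∞` with a uniform constant, so its disjoint vectors
are unconditional. If `(q_Ω)_U` were an isomorphism on a disjoint closed span, its inverse would be
a lifting; this gives (3). If liftings of norm `C` fail for `m` disjoint vectors, every block of `m`
disjoint vectors of `d_Ω K` spans a nonzero vector that `q_Ω` shrinks by the factor `C`; `k` blocks
and unconditionality give (3').

For the converse, liftings `z k` of disjoint vectors `x k` need not be disjoint in `d_Ω K`. Cutting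
each `z k` down to the support of `x k` makes them so. The cut sum is the diagonal part of randomly
signed sums, all of which are bounded, and `q`-convexity is what controls such an average
(`exists_disjoint_lifting`). -/

theorem le_mul_of_forall_gt {A K s : ℝ} (h : ∀ t, s < t → A ≤ K * t) : A ≤ K * s := by
  have h1 : Tendsto (fun t : ℝ => K * t) (𝓝[>] s) (𝓝 (K * s)) :=
    ((continuous_const.mul continuous_id).tendsto s).mono_left nhdsWithin_le_nhds
  exact ge_of_tendsto h1 (by filter_upwards [self_mem_nhdsWithin] with t ht using h t ht)

/-! ### Quasi-norm estimates, closed spans and representatives in ultrapowers -/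

namespace QuasiNorm

section General

variable {𝕜 : Type u} [RCLike 𝕜] {V : Type v} [AddCommGroup V] [Module 𝕜 V]

theorem map_sub_rev (N : QuasiNorm 𝕜 V) (a b : V) : N (a - b) = N (b - a) := by
  rw [← N.map_neg, neg_sub]

theorem pos_of_ne_zero (N : QuasiNorm 𝕜 V) {a : V} (ha : a ≠ 0) : 0 < N a :=
  lt_of_le_of_ne (N.nonneg' a) fun h => ha ((N.eq_zero_iff' a).1 h.symm)

/-- The constant is exponential in the number of summands. This is harmless: it is applied only to
sums whose length is fixed in advance. -/
theorem exists_sum_le (N : QuasiNorm 𝕜 V) : ∃ D : ℝ, 1 ≤ D ∧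
    ∀ {κ : Type w} (s : Finset κ) (a : κ → V), N (∑ i ∈ s, a i) ≤ D ^ s.card * ∑ i ∈ s, N (a i) := by
  classical
  obtain ⟨D, hD1, hD⟩ := N.exists_add_le
  refine ⟨D, hD1, fun {κ} s a => ?_⟩
  induction s using Finset.induction_on with
  | empty => simp [N.map_zero]
  | insert i s hi ih =>
    rw [Finset.sum_insert hi, Finset.sum_insert hi, Finset.card_insert_of_notMem hi]
    have hDs : 1 ≤ D ^ s.card := one_le_pow₀ hD1
    have h0 := N.nonneg' (a i)
    calc N (a i + ∑ l ∈ s, a l) ≤ D * (N (a i) + N (∑ l ∈ s, a l)) := hD _ _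
      _ ≤ D * (D ^ s.card * N (a i) + D ^ s.card * ∑ l ∈ s, N (a l)) := by
        refine mul_le_mul_of_nonneg_left (add_le_add ?_ ih) (by linarith)
        exact le_mul_of_one_le_left h0 hDs
      _ = D ^ (s.card + 1) * (N (a i) + ∑ l ∈ s, N (a l)) := by ring

theorem tendsto_sum_zero (N : QuasiNorm 𝕜 V) {ι : Type w} {κ : Type x} {l : Filter ι} (s : Finset κ)
    (a : κ → ι → V) (h : ∀ k ∈ s, Tendsto (fun i => N (a k i)) l (𝓝 0)) :
    Tendsto (fun i => N (∑ k ∈ s, a k i)) l (𝓝 0) := by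
  obtain ⟨D, -, hD⟩ := N.exists_sum_le
  refine squeeze_zero (fun _ => N.nonneg' _) (fun i => hD s fun k => a k i) ?_
  simpa using (tendsto_finsetSum s h).const_mul (D ^ s.card)

theorem tendsto_add_zero (N : QuasiNorm 𝕜 V) {ι : Type w} {l : Filter ι}
    {a b : ι → V} (ha : Tendsto (fun i => N (a i)) l (𝓝 0))
    (hb : Tendsto (fun i => N (b i)) l (𝓝 0)) :
    Tendsto (fun i => N (a i + b i)) l (𝓝 0) := by
  obtain ⟨D, -, hD⟩ := N.exists_add_le
  refine squeeze_zero (fun _ => N.nonneg' _) (fun i => hD _ _) ?_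
  simpa using (ha.add hb).const_mul D

theorem span_le_closedSpan (N : QuasiNorm 𝕜 V) (s : Set V) :
    Submodule.span 𝕜 s ≤ N.closedSpan s := fun a ha ε hε =>
  ⟨a, ha, by rwa [sub_self, N.map_zero]⟩

/-- Finite-dimensional subspaces are closed. -/
theorem mem_span_of_forall_exists_lt (N : QuasiNorm 𝕜 V) {s : Set V} (hs : s.Finite) {a : V}
    (ha : ∀ ε : ℝ, 0 < ε → ∃ b ∈ Submodule.span 𝕜 s, N (a - b) < ε) :
    a ∈ Submodule.span 𝕜 s := by
  obtain ⟨D, hD1, hD⟩ := N.exists_add_le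
  have hD0 : 0 < D := by linarith
  induction s, hs using Set.Finite.induction_on generalizing a with
  | empty =>
    have h0 : N a ≤ 0 := le_of_forall_pos_lt_add fun ε hε => by
      obtain ⟨b, hb, hab⟩ := ha ε hε
      rw [Submodule.span_empty, Submodule.mem_bot] at hb
      rw [hb, sub_zero] at hab
      linarith
    rw [(N.eq_zero_iff' a).1 (le_antisymm h0 (N.nonneg' a))]
    exact Submodule.zero_mem _
  | @insert x s hxs hs ih =>
    by_cases hx : x ∈ Submodule.span 𝕜 s
    · rw [Submodule.span_insert_eq_span hx] at ha ⊢
      exact ih ha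
    -- The induction hypothesis says that the span of `s` is closed, so `x` has positive distance
    -- from it. Hence the coefficient of `x` is controlled by the quasi-norm of the whole vector.
    obtain ⟨δ, hδ, hxδ⟩ : ∃ δ : ℝ, 0 < δ ∧ ∀ b ∈ Submodule.span 𝕜 s, δ ≤ N (x - b) := by
      by_contra! h
      exact hx (ih h)
    have hlow : ∀ (c : 𝕜), ∀ b ∈ Submodule.span 𝕜 s, ‖c‖ * δ ≤ N (c • x + b) := by
      intro c b hb
      rcases eq_or_ne c 0 with rfl | hc
      · simpa using N.nonneg' _
      · have e : c • x + b = c • (x - -(c⁻¹ • b)) := by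
          rw [sub_neg_eq_add, smul_add, smul_inv_smul₀ hc]
        rw [e, N.smul']
        exact mul_le_mul_of_nonneg_left
          (hxδ _ (Submodule.neg_mem _ (Submodule.smul_mem _ _ hb))) (norm_nonneg c)
    have h1 : ∀ n : ℕ, ∃ (c : 𝕜) (b : V), b ∈ Submodule.span 𝕜 s ∧
        N (a - (c • x + b)) < 1 / (n + 1) := by
      intro n
      obtain ⟨b, hb, hab⟩ := ha (1 / (n + 1)) (by positivity)
      obtain ⟨c, b', hb', rfl⟩ := Submodule.mem_span_insert.1 hb
      exact ⟨c, b', hb', hab⟩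
    choose c b hb hab using h1
    have hlim := tendsto_one_div_add_atTop_nhds_zero_nat (𝕜 := ℝ)
    have hN0 : Tendsto (fun n => N (a - (c n • x + b n))) atTop (𝓝 0) :=
      squeeze_zero (fun _ => N.nonneg' _) (fun n => (hab n).le) hlim
    have hbd : ∀ n, c n ∈ Metric.closedBall (0 : 𝕜) (D * (N a + 1) / δ) := by
      intro n
      rw [mem_closedBall_zero_iff, le_div_iff₀ hδ]
      refine (hlow _ _ (hb n)).trans ?_
      have h2 : c n • x + b n = a + -(a - (c n • x + b n)) := by abel
      rw [h2]
      refine (hD _ _).trans (mul_le_mul_of_nonneg_left ?_ hD0.le)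
      rw [N.map_neg]
      have h3 : (1 : ℝ) / (n + 1) ≤ 1 := by
        rw [div_le_one (by positivity)]
        linarith [(Nat.cast_nonneg n : (0 : ℝ) ≤ n)]
      linarith [hab n]
    -- The coefficients of the approximants stay in a compact ball and converge along a nonprincipal
    -- ultrafilter. With the limit `c0`, the vectors `b n` approximate `a - c0 • x`, to which the
    -- induction hypothesis applies.
    obtain ⟨c0, -, hc0⟩ := (isCompact_closedBall (0 : 𝕜) (D * (N a + 1) / δ)).ultrafilter_le_nhds'
      (Ultrafilter.map c (hyperfilter ℕ))
      (Filter.eventually_map.2 (Filter.Eventually.of_forall hbd))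
    have hc0' : Tendsto c (hyperfilter ℕ) (𝓝 c0) := hc0
    have hmem : a - c0 • x ∈ Submodule.span 𝕜 s := by
      refine ih fun ε hε => ?_
      have hz : Tendsto (fun n => N ((a - (c n • x + b n)) + (c n - c0) • x))
          (hyperfilter ℕ) (𝓝 0) := by
        refine N.tendsto_add_zero (hN0.mono_left Nat.hyperfilter_le_atTop) ?_
        have h3 : Tendsto (fun n => ‖c n - c0‖ * N x) (hyperfilter ℕ) (𝓝 0) := by
          have := (tendsto_iff_norm_sub_tendsto_zero.1 hc0').mul_const (N x)
          simpa using this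
        exact h3.congr fun n => (N.smul' _ _).symm
      obtain ⟨n, hn⟩ := (hz.eventually (gt_mem_nhds hε)).exists
      refine ⟨b n, hb n, ?_⟩
      have e : a - c0 • x - b n = (a - (c n • x + b n)) + (c n - c0) • x := by
        rw [sub_smul]
        abel
      rwa [e]
    have e : a = c0 • x + (a - c0 • x) := by abel
    rw [e]
    exact Submodule.mem_span_insert.2 ⟨c0, _, hmem, rfl⟩

/-- If the closed span of a sequence is infinite-dimensional, then infinitely many of its terms
are nonzero. -/
theorem infinite_setOf_ne_zero (N : QuasiNorm 𝕜 V) (e : ℕ → V)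
    (h : ¬ FiniteDimensional 𝕜 (N.closedSpan (Set.range e))) : {m | e m ≠ 0}.Infinite := by
  intro hfin
  have hf : (e '' {m | e m ≠ 0}).Finite := hfin.image e
  have hsp : Submodule.span 𝕜 (Set.range e) ≤ Submodule.span 𝕜 (e '' {m | e m ≠ 0}) := by
    rw [Submodule.span_le]
    rintro _ ⟨m, rfl⟩
    by_cases hm : e m = 0
    · rw [hm]
      exact Submodule.zero_mem _
    · exact Submodule.subset_span ⟨m, hm, rfl⟩
  have hle : N.closedSpan (Set.range e) ≤ Submodule.span 𝕜 (e '' {m | e m ≠ 0}) := by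
    intro a ha
    refine N.mem_span_of_forall_exists_lt hf fun ε hε => ?_
    obtain ⟨b, hb, hab⟩ := ha ε hε
    exact ⟨b, hsp hb, hab⟩
  have : FiniteDimensional 𝕜 (Submodule.span 𝕜 (e '' {m | e m ≠ 0})) :=
    FiniteDimensional.span_of_finite 𝕜 hf
  exact h (Submodule.finiteDimensional_of_le hle)

theorem exists_embedding_ne_zero (N : QuasiNorm 𝕜 V) (e : ℕ → V)
    (h : ¬ FiniteDimensional 𝕜 (N.closedSpan (Set.range e))) (n : ℕ) :
    ∃ g : Fin n → ℕ, Function.Injective g ∧ ∀ k, e (g k) ≠ 0 := by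
  have hinf := N.infinite_setOf_ne_zero e h
  refine ⟨fun k => hinf.natEmbedding _ k, fun k l hkl => ?_, fun k => (hinf.natEmbedding _ k).2⟩
  exact Fin.ext ((hinf.natEmbedding _).injective (Subtype.ext hkl))

theorem not_finiteDimensional_closedSpan (N : QuasiNorm 𝕜 V) {e : ℕ → V}
    (h : ∀ n : ℕ, LinearIndependent 𝕜 fun k : Fin n => e k) :
    ¬ FiniteDimensional 𝕜 (N.closedSpan (Set.range e)) := by
  intro hf
  let e' : ℕ → N.closedSpan (Set.range e) := fun k =>
    ⟨e k, N.span_le_closedSpan _ (Submodule.subset_span ⟨k, rfl⟩)⟩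
  have hli : LinearIndependent 𝕜
      fun k : Fin (Module.finrank 𝕜 (N.closedSpan (Set.range e)) + 1) => e' k :=
    LinearIndependent.of_comp (N.closedSpan (Set.range e)).subtype (h _)
  have := hli.fintype_card_le_finrank
  rw [Fintype.card_fin] at this
  omega

/-! ### Elements of ultrapowers -/

section Ultra

variable (N : QuasiNorm 𝕜 V) {ι : Type w} (U : Ultrafilter ι)

theorem ultraMk_add (a b : N.boundedFamilies ι) :
    N.ultraMk U (a + b) = N.ultraMk U a + N.ultraMk U b := LinearMap.map_add _ _ _

theorem ultraMk_sub (a b : N.boundedFamilies ι) :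
    N.ultraMk U (a - b) = N.ultraMk U a - N.ultraMk U b := LinearMap.map_sub _ _ _

theorem ultraMk_smul (c : 𝕜) (a : N.boundedFamilies ι) :
    N.ultraMk U (c • a) = c • N.ultraMk U a := LinearMap.map_smul _ _ _

theorem ultraMk_sum {κ : Type x} (s : Finset κ) (a : κ → N.boundedFamilies ι) :
    N.ultraMk U (∑ k ∈ s, a k) = ∑ k ∈ s, N.ultraMk U (a k) := map_sum (N.nullFamilies U).mkQ _ _

theorem ultraMk_eq_iff {a b : N.boundedFamilies ι} :
    N.ultraMk U a = N.ultraMk U b ↔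
      Tendsto (fun i => N ((a : ι → V) i - (b : ι → V) i)) U (𝓝 0) := by
  rw [← sub_eq_zero, ← ultraMk_sub, ultraMk_eq_zero_iff]
  rfl

theorem boundedFamilies_sum_smul_apply {κ : Type x} (s : Finset κ) (c : κ → 𝕜)
    (a : κ → N.boundedFamilies ι) (i : ι) :
    ((∑ k ∈ s, c k • a k : N.boundedFamilies ι) : ι → V) i = ∑ k ∈ s, c k • (a k : ι → V) i := by
  rw [Submodule.coe_sum, Finset.sum_apply]
  rfl

/-- A representative may be replaced by `0` outside a set of the ultrafilter, so a bound that holds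
eventually becomes a bound everywhere. -/
theorem ultrapower_le {a : N.boundedFamilies ι} {C : ℝ} (hC : 0 ≤ C)
    (h : ∀ᶠ i in (U : Filter ι), N ((a : ι → V) i) ≤ C) : N.ultrapower U (N.ultraMk U a) ≤ C := by
  classical
  refine csInf_le (N.ultraBounds_bddBelow U _) ⟨hC,
    ⟨fun i => if N ((a : ι → V) i) ≤ C then (a : ι → V) i else 0, C, fun i => ?_⟩, ?_, fun i => ?_⟩
  · beta_reduce
    split_ifs with hi
    · exact hi
    · rwa [N.map_zero]
  · rw [ultraMk_eq_iff]
    refine tendsto_const_nhds.congr' ?_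
    filter_upwards [h] with i hi
    simp only [if_pos hi, sub_self, N.map_zero]
  · change N (if N ((a : ι → V) i) ≤ C then (a : ι → V) i else 0) ≤ C
    split_ifs with hi
    · exact hi
    · rwa [N.map_zero]

/-- A partial converse to `ultrapower_le`. A quasi-norm need not be continuous, so changing the
representative by a null family costs the factor `D`. The infimum need not be attained either, so
the bound is stated for every `C` strictly above it; `le_mul_of_forall_gt` removes this slack later.
-/
theorem exists_eventually_lt : ∃ D : ℝ, 1 ≤ D ∧
    ∀ {ι : Type w} (U : Ultrafilter ι) (a : N.boundedFamilies ι) (C : ℝ),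
      N.ultrapower U (N.ultraMk U a) < C →
      ∀ᶠ i in (U : Filter ι), N ((a : ι → V) i) < D * C := by
  obtain ⟨D, hD1, hD⟩ := N.exists_add_le
  refine ⟨D, hD1, fun {ι} U a C h => ?_⟩
  obtain ⟨C', ⟨hC0, b, hb, hbC⟩, hlt⟩ :=
    exists_lt_of_csInf_lt (N.ultraBounds_nonempty U (N.ultraMk U a)) h
  have hn := (N.ultraMk_eq_iff U).1 hb.symm
  filter_upwards [hn.eventually (gt_mem_nhds (sub_pos.2 hlt))] with i hi
  have e : (a : ι → V) i = (b : ι → V) i + ((a : ι → V) i - (b : ι → V) i) := by abel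
  rw [e]
  refine (hD _ _).trans_lt (mul_lt_mul_of_pos_left ?_ (by linarith))
  linarith [hbC i]

theorem ultraMk_ne_zero {a : N.boundedFamilies ι} {δ : ℝ} (hδ : 0 < δ)
    (h : ∀ᶠ i in (U : Filter ι), δ ≤ N ((a : ι → V) i)) : N.ultraMk U a ≠ 0 := by
  intro h0
  rw [ultraMk_eq_zero_iff] at h0
  obtain ⟨i, hi, hi'⟩ := (h.and (h0.eventually (gt_mem_nhds hδ))).exists
  linarith

end Ultra

end General

/-! ### Bounded operators, their ultrapowers and lower bounds -/

section Maps

variable {𝕜 : Type u} [RCLike 𝕜] {Z : Type v} [AddCommGroup Z] [Module 𝕜 Z]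
  {X : Type x} [AddCommGroup X] [Module 𝕜 X] {NZ : QuasiNorm 𝕜 Z} {NX : QuasiNorm 𝕜 X}

theorem IsBoundedMap.exists_nonneg {q : Z →ₗ[𝕜] X} (hq : NZ.IsBoundedMap NX q) :
    ∃ C : ℝ, 0 ≤ C ∧ ∀ a, NX (q a) ≤ C * NZ a := by
  obtain ⟨C, hC⟩ := hq
  exact ⟨|C|, abs_nonneg C, fun a =>
    (hC a).trans (mul_le_mul_of_nonneg_right (le_abs_self C) (NZ.nonneg' a))⟩

theorem ultrapowerMap_mk {q : Z →ₗ[𝕜] X} (hq : NZ.IsBoundedMap NX q) {ι : Type w}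
    (U : Ultrafilter ι) (a : NZ.boundedFamilies ι) :
    NZ.ultrapowerMap NX q hq U (NZ.ultraMk U a) =
      NX.ultraMk U (boundedFamiliesMap NZ NX q hq ι a) := rfl

theorem ultrapowerMap_bounded {q : Z →ₗ[𝕜] X} (hq : NZ.IsBoundedMap NX q) {ι : Type w}
    (U : Ultrafilter ι) :
    (NZ.ultrapower U).IsBoundedMap (NX.ultrapower U) (NZ.ultrapowerMap NX q hq U) := by
  obtain ⟨C, hC0, hC⟩ := hq.exists_nonneg
  obtain ⟨D, hD1, hD⟩ := NZ.exists_eventually_lt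
  refine ⟨C * D, fun ζ => le_mul_of_forall_gt fun t ht => ?_⟩
  obtain ⟨a, rfl⟩ := NZ.ultraMk_surjective U ζ
  have ht0 : 0 ≤ t := ((NZ.ultrapower U).nonneg' _).trans ht.le
  rw [ultrapowerMap_mk]
  refine NX.ultrapower_le U (by positivity) ?_
  filter_upwards [hD U a t ht] with i hi
  refine (hC _).trans ?_
  rw [mul_assoc]
  exact mul_le_mul_of_nonneg_left hi.le hC0

/-- An operator that is bounded below on a subspace has a bounded linear right inverse on the image
of that subspace. -/
theorem exists_rightInverse_of_bddBelow (q : Z →ₗ[𝕜] X) (F : Submodule 𝕜 Z) {C : ℝ}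
    (h : ∀ z ∈ F, NZ z ≤ C * NX (q z)) :
    ∃ l : F.map q →ₗ[𝕜] Z, ∀ a, l a ∈ F ∧ q (l a) = a ∧ NZ (l a) ≤ C * NX a := by
  have hinj : Function.Injective (q.domRestrict F) := by
    rw [← LinearMap.ker_eq_bot, LinearMap.ker_eq_bot']
    intro z hz
    have hz' : q z = 0 := hz
    have h1 := h z z.2
    rw [hz', NX.map_zero, mul_zero] at h1
    exact Subtype.ext ((NZ.eq_zero_iff' _).1 (le_antisymm h1 (NZ.nonneg' _)))
  let E := LinearEquiv.ofInjective (q.domRestrict F) hinj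
  have hmem : ∀ a : F.map q, (a : X) ∈ LinearMap.range (q.domRestrict F) := by
    rintro ⟨_, z, hz, rfl⟩
    exact ⟨⟨z, hz⟩, rfl⟩
  let i : F.map q →ₗ[𝕜] LinearMap.range (q.domRestrict F) :=
    LinearMap.codRestrict _ (F.map q).subtype hmem
  have hq : ∀ a, q (E.symm (i a)) = a := fun a =>
    congrArg Subtype.val (E.apply_symm_apply (i a))
  refine ⟨F.subtype ∘ₗ E.symm.toLinearMap ∘ₗ i, fun a => ⟨(E.symm (i a)).2, hq a, ?_⟩⟩
  have h1 := h _ (E.symm (i a)).2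
  rwa [hq a] at h1

/-- An operator that is bounded below on a subspace is bounded below on its closure. -/
theorem bddBelow_closedSpan {q : Z →ₗ[𝕜] X} (hq : NZ.IsBoundedMap NX q) {s : Set Z} {C : ℝ}
    (h : ∀ z ∈ Submodule.span 𝕜 s, NZ z ≤ C * NX (q z)) :
    ∃ c : ℝ, 0 < c ∧ ∀ z ∈ NZ.closedSpan s, c * NZ z ≤ NX (q z) := by
  obtain ⟨B, hB0, hB⟩ := hq.exists_nonneg
  obtain ⟨D, hD1, hD⟩ := NZ.exists_add_le
  obtain ⟨D', hD1', hD'⟩ := NX.exists_add_le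
  have hC : ∀ z ∈ Submodule.span 𝕜 s, NZ z ≤ |C| * NX (q z) := fun z hz =>
    (h z hz).trans (mul_le_mul_of_nonneg_right (le_abs_self C) (NX.nonneg' _))
  have hC0 := abs_nonneg C
  -- The summand `1` only prevents inversion of zero. The estimate comes from approximating `z` by a
  -- vector of the span up to `t` and letting `t` tend to `0`.
  refine ⟨(D * |C| * D' + 1)⁻¹, by positivity, fun z hz => ?_⟩
  rw [inv_mul_le_iff₀ (by positivity)]
  have key : NZ z ≤ D * |C| * D' * NX (q z) := by
    have h1 : ∀ t, 0 < t → NZ z ≤ D * |C| * D' * NX (q z) + (D * |C| * D' * B + D) * t := by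
      intro t ht
      obtain ⟨b, hb, hzb⟩ := hz t ht
      have e1 : NZ z ≤ D * (NZ b + NZ (z - b)) := by
        have := hD b (z - b)
        rwa [add_sub_cancel] at this
      have e2 : NX (q b) ≤ D' * (NX (q z) + NX (q (z - b))) := by
        have := hD' (q z) (-(q (z - b)))
        rw [NX.map_neg] at this
        have e : q b = q z + -(q (z - b)) := by rw [map_sub]; abel
        rwa [← e] at this
      have e3 : NX (q (z - b)) ≤ B * t := (hB _).trans (mul_le_mul_of_nonneg_left hzb.le hB0)
      calc NZ z ≤ D * (NZ b + NZ (z - b)) := e1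
        _ ≤ D * (|C| * (D' * (NX (q z) + B * t)) + t) := by
          refine mul_le_mul_of_nonneg_left (add_le_add ((hC b hb).trans ?_) hzb.le) (by linarith)
          refine mul_le_mul_of_nonneg_left (e2.trans ?_) hC0
          exact mul_le_mul_of_nonneg_left (by linarith) (by linarith)
        _ = _ := by ring
    have h2 : Tendsto (fun t : ℝ => D * |C| * D' * NX (q z) + (D * |C| * D' * B + D) * t)
        (𝓝[>] 0) (𝓝 (D * |C| * D' * NX (q z) + (D * |C| * D' * B + D) * 0)) :=
      ((continuous_const.add (continuous_const.mul continuous_id)).tendsto 0).mono_left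
        nhdsWithin_le_nhds
    rw [mul_zero, add_zero] at h2
    exact ge_of_tendsto h2 (by filter_upwards [self_mem_nhdsWithin] with t ht using h1 t ht)
  linarith [NX.nonneg' (q z)]

end Maps

end QuasiNorm

/-! ### Exact sequences of quasi-normed spaces -/

section ExactSeq

variable {𝕜 : Type u} [RCLike 𝕜] {Y : Type v} [AddCommGroup Y] [Module 𝕜 Y]
  {Z : Type w} [AddCommGroup Z] [Module 𝕜 Z] {X : Type x} [AddCommGroup X] [Module 𝕜 X]
  {NY : QuasiNorm 𝕜 Y} {NZ : QuasiNorm 𝕜 Z} {NX : QuasiNorm 𝕜 X} {j : Y →ₗ[𝕜] Z} {q : Z →ₗ[𝕜] X}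

/-- A (not necessarily linear) bounded lifting exists for the operator `q`. -/
def HasBoundedLifting (NZ : QuasiNorm 𝕜 Z) (NX : QuasiNorm 𝕜 X) (q : Z →ₗ[𝕜] X) : Prop :=
  ∃ C : ℝ, 0 ≤ C ∧ ∀ a, ∃ z, q z = a ∧ NZ z ≤ C * NX a

/-- `0 → Y → Z → X → 0` is a short exact sequence of quasi-normed spaces and relatively open
bounded operators. -/
structure IsExactSeq (NY : QuasiNorm 𝕜 Y) (NZ : QuasiNorm 𝕜 Z) (NX : QuasiNorm 𝕜 X)
    (j : Y →ₗ[𝕜] Z) (q : Z →ₗ[𝕜] X) : Prop where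
  incl_bounded : NY.IsBoundedMap NZ j
  quot_bounded : NZ.IsBoundedMap NX q
  incl_bddBelow : ∃ C : ℝ, 0 ≤ C ∧ ∀ y, NY y ≤ C * NZ (j y)
  quot_incl : ∀ y, q (j y) = 0
  exists_incl : ∀ z, q z = 0 → ∃ y, j y = z
  exists_lift : HasBoundedLifting NZ NX q

/-- A family that is a representative of the image of `ζ` lifts to a representative of `ζ`. -/
theorem HasBoundedLifting.exists_rep (hl : HasBoundedLifting NZ NX q) (hq : NZ.IsBoundedMap NX q)
    {ι : Type y} (U : Ultrafilter ι) (ζ : NZ.Ultrapower U) (a : NX.boundedFamilies ι)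
    (ha : NX.ultraMk U a = NZ.ultrapowerMap NX q hq U ζ) :
    ∃ z : NZ.boundedFamilies ι, NZ.ultraMk U z = ζ ∧
      ∀ i, q ((z : ι → Z) i) = (a : ι → X) i := by
  obtain ⟨C, hC0, hC⟩ := hl
  obtain ⟨D, hD1, hD⟩ := NX.exists_add_le
  obtain ⟨z, rfl⟩ := NZ.ultraMk_surjective U ζ
  -- Any representative `z` of `ζ` lies above `a` up to a null family. Lifting that error
  -- coordinatewise with a uniform bound gives a null correction `r`.
  choose r hr hrC using fun i => hC ((a : ι → X) i - q ((z : ι → Z) i))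
  obtain ⟨A, hA⟩ := a.2
  obtain ⟨B, hB⟩ := (NZ.boundedFamiliesMap NX q hq ι z).2
  have hrb : r ∈ NZ.boundedFamilies ι := by
    refine ⟨C * (D * (A + B)), fun i => (hrC i).trans (mul_le_mul_of_nonneg_left ?_ hC0)⟩
    rw [sub_eq_add_neg]
    refine (hD _ _).trans (mul_le_mul_of_nonneg_left ?_ (by linarith))
    rw [NX.map_neg]
    exact add_le_add (hA i) (hB i)
  have hr0 : NZ.ultraMk U ⟨r, hrb⟩ = 0 := by
    rw [QuasiNorm.ultraMk_eq_zero_iff]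
    rw [QuasiNorm.ultrapowerMap_mk, QuasiNorm.ultraMk_eq_iff] at ha
    have h := ha.const_mul C
    rw [mul_zero] at h
    exact squeeze_zero (fun i => NZ.nonneg' _) hrC h
  refine ⟨z + ⟨r, hrb⟩, ?_, fun i => ?_⟩
  · rw [QuasiNorm.ultraMk_add, hr0, add_zero]
  · change q ((z : ι → Z) i + r i) = _
    rw [map_add, hr]
    abel

theorem HasBoundedLifting.ultrapower (hl : HasBoundedLifting NZ NX q) (hq : NZ.IsBoundedMap NX q)
    {ι : Type y} (U : Ultrafilter ι) :
    HasBoundedLifting (NZ.ultrapower U) (NX.ultrapower U) (NZ.ultrapowerMap NX q hq U) := by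
  obtain ⟨C, hC0, hC⟩ := hl
  refine ⟨C * 2, by positivity, fun ξ => ?_⟩
  rcases eq_or_ne ξ 0 with rfl | hξ
  · exact ⟨0, map_zero _, by rw [QuasiNorm.map_zero, QuasiNorm.map_zero, mul_zero]⟩
  have hpos := (NX.ultrapower U).pos_of_ne_zero hξ
  -- The infimum defining the quasi-norm of `ξ` need not be attained; the factor `2` leaves room for
  -- an actual representative, and this is where `ξ ≠ 0` is needed.
  have hlt : sInf (NX.ultraBounds U ξ) < 2 * NX.ultrapower U ξ := by
    change NX.ultrapower U ξ < _
    linarith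
  obtain ⟨B, ⟨hB0, a, rfl, ha⟩, hB⟩ := exists_lt_of_csInf_lt (NX.ultraBounds_nonempty U ξ) hlt
  choose r hr hrC using fun i => hC ((a : ι → X) i)
  have hrB : ∀ i, NZ (r i) ≤ C * B := fun i =>
    (hrC i).trans (mul_le_mul_of_nonneg_left (ha i) hC0)
  refine ⟨NZ.ultraMk U ⟨r, C * B, hrB⟩, ?_, ?_⟩
  · rw [QuasiNorm.ultrapowerMap_mk]
    exact congrArg (NX.ultraMk U) (Subtype.ext (funext hr))
  · refine (NZ.ultrapower_le U (by positivity) (Eventually.of_forall hrB)).trans ?_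
    rw [mul_assoc]
    exact mul_le_mul_of_nonneg_left hB.le hC0

/-- All constants of the sequence act coordinatewise, so they survive in the ultrapower up to the
moduli of concavity. -/
theorem IsExactSeq.ultrapower (h : IsExactSeq NY NZ NX j q) {ι : Type y} (U : Ultrafilter ι) :
    IsExactSeq (NY.ultrapower U) (NZ.ultrapower U) (NX.ultrapower U)
      (NY.ultrapowerMap NZ j h.incl_bounded U) (NZ.ultrapowerMap NX q h.quot_bounded U) where
  incl_bounded := QuasiNorm.ultrapowerMap_bounded _ U
  quot_bounded := QuasiNorm.ultrapowerMap_bounded _ U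
  incl_bddBelow := by
    obtain ⟨C, hC0, hC⟩ := h.incl_bddBelow
    obtain ⟨D, hD1, hD⟩ := NZ.exists_eventually_lt
    refine ⟨C * D, by positivity, fun η => le_mul_of_forall_gt fun t ht => ?_⟩
    have ht0 : 0 ≤ t := ((NZ.ultrapower U).nonneg' _).trans ht.le
    obtain ⟨b, rfl⟩ := NY.ultraMk_surjective U η
    rw [QuasiNorm.ultrapowerMap_mk] at ht
    refine NY.ultrapower_le U (by positivity) ?_
    filter_upwards [hD U _ t ht] with i hi
    refine (hC _).trans ?_
    rw [mul_assoc]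
    exact mul_le_mul_of_nonneg_left hi.le hC0
  quot_incl := by
    intro η
    obtain ⟨b, rfl⟩ := NY.ultraMk_surjective U η
    rw [QuasiNorm.ultrapowerMap_mk, QuasiNorm.ultrapowerMap_mk, QuasiNorm.ultraMk_eq_zero_iff]
    refine tendsto_const_nhds.congr fun i => ?_
    change 0 = NX (q (j ((b : ι → Y) i)))
    rw [h.quot_incl, NX.map_zero]
  exists_incl := by
    intro ζ hζ
    obtain ⟨C, hC0, hC⟩ := h.incl_bddBelow
    -- An element of the kernel is represented by a family lying exactly above the zero family, so
    -- each coordinate comes from `Y`.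
    obtain ⟨z, rfl, hz⟩ := h.exists_lift.exists_rep h.quot_bounded U ζ 0
      (by rw [hζ]; exact LinearMap.map_zero _)
    choose b hb using fun i => h.exists_incl _ (hz i)
    obtain ⟨B, hB⟩ := z.2
    refine ⟨NY.ultraMk U ⟨b, C * B, fun i => (hC _).trans ?_⟩, ?_⟩
    · rw [hb]
      exact mul_le_mul_of_nonneg_left (hB i) hC0
    · rw [QuasiNorm.ultrapowerMap_mk]
      exact congrArg (NZ.ultraMk U) (Subtype.ext (funext hb))
  exists_lift := h.exists_lift.ultrapower _ U

/-- Bounded liftings can be chosen homogeneous. -/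
theorem HasBoundedLifting.exists_homogeneous (hl : HasBoundedLifting NZ NX q) :
    ∃ C : ℝ, ∃ s : X → Z, (∀ (c : 𝕜) a, s (c • a) = c • s a) ∧ ∀ a, q (s a) = a ∧
      NZ (s a) ≤ C * NX a := by
  classical
  obtain ⟨C, hC0, hC⟩ := hl
  choose r hr hrC using hC
  -- One vector is selected in each orbit of `𝕜ˣ`, the given lifting is kept there, and it is
  -- extended along the orbit by homogeneity.
  have hrep : ∀ a : X, ∃ c : 𝕜ˣ, c • (Quotient.mk (MulAction.orbitRel 𝕜ˣ X) a).out = a := fun a =>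
    MulAction.orbitRel_apply.1
      ((MulAction.orbitRel 𝕜ˣ X).symm' (Quotient.mk_out (s := MulAction.orbitRel 𝕜ˣ X) a))
  choose c hc using hrep
  let p : X → X := fun a => (Quotient.mk (MulAction.orbitRel 𝕜ˣ X) a).out
  have hp : ∀ (d : 𝕜ˣ) (a : X), p (d • a) = p a := fun d a =>
    congrArg Quotient.out (Quotient.sound (s := MulAction.orbitRel 𝕜ˣ X) ⟨d, rfl⟩)
  have hc' : ∀ a, (c a : 𝕜) • p a = a := hc
  refine ⟨C, fun a => if a = 0 then 0 else (c a : 𝕜) • r (p a), ?_, fun a => ?_⟩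
  · intro d a
    rcases eq_or_ne d 0 with rfl | hd
    · simp
    rcases eq_or_ne a 0 with rfl | ha
    · simp
    have hda : d • a ≠ 0 := smul_ne_zero hd ha
    simp only [if_neg ha, if_neg hda]
    have h1 : p (d • a) = p a := hp (Units.mk0 d hd) a
    have h2 := hc' (d • a)
    rw [h1] at h2 ⊢
    have hpa : p a ≠ 0 := fun h0 => ha (by rw [← hc' a, h0, smul_zero])
    have h3 : ((c (d • a) : 𝕜)) • p a = (d * (c a : 𝕜)) • p a := by
      rw [h2, mul_smul, hc']
    rw [smul_smul, smul_left_injective 𝕜 hpa h3]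
  · beta_reduce
    split_ifs with ha
    · rw [ha, map_zero, NX.map_zero, NZ.map_zero, mul_zero]
      exact ⟨rfl, le_rfl⟩
    · refine ⟨by rw [map_smul, hr, hc'], ?_⟩
      rw [NZ.smul']
      calc ‖(c a : 𝕜)‖ * NZ (r (p a)) ≤ ‖(c a : 𝕜)‖ * (C * NX (p a)) :=
            mul_le_mul_of_nonneg_left (hrC _) (norm_nonneg _)
        _ = C * NX ((c a : 𝕜) • p a) := by rw [NX.smul']; ring
        _ = C * NX a := by rw [hc']

/-- Every exact sequence is equivalent to the twisted sum sequence of a quasi-linear map. -/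
theorem IsExactSeq.exists_isAssociated (h : IsExactSeq NY NZ NX j q) :
    ∃ ω : X → Y, IsAssociated NX NY NZ j q ω := by
  obtain ⟨C, s, hs, hsq⟩ := h.exists_lift.exists_homogeneous
  obtain ⟨B, hB0, hB⟩ := h.incl_bddBelow
  obtain ⟨J, hJ0, hJ⟩ := h.incl_bounded.exists_nonneg
  obtain ⟨Q, hQ0, hQ⟩ := h.quot_bounded.exists_nonneg
  obtain ⟨D, hD1, hD⟩ := NZ.exists_add_le
  have hsC : ∀ a, NZ (s a) ≤ |C| * NX a := fun a =>
    (hsq a).2.trans (mul_le_mul_of_nonneg_right (le_abs_self C) (NX.nonneg' a))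
  have hC0 := abs_nonneg C
  have hsub : ∀ a b, NZ (a - b) ≤ D * (NZ a + NZ b) := fun a b => by
    rw [sub_eq_add_neg, ← NZ.map_neg b]
    exact hD _ _
  -- `l` is a linear lifting with no bound, `s` a bounded homogeneous one with no linearity. Their
  -- difference takes values in the kernel of `q`, hence defines `ω`, whose failure of additivity is
  -- that of `s`.
  obtain ⟨l, hl⟩ := q.exists_rightInverse_of_surjective
    (LinearMap.range_eq_top.2 fun a => ⟨s a, (hsq a).1⟩)
  have hl' : ∀ a, q (l a) = a := fun a => LinearMap.congr_fun hl a
  have hinj : Function.Injective j := by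
    rw [← LinearMap.ker_eq_bot, LinearMap.ker_eq_bot']
    intro y hy
    have h1 := hB y
    rw [hy, NZ.map_zero, mul_zero] at h1
    exact (NY.eq_zero_iff' y).1 (le_antisymm h1 (NY.nonneg' y))
  choose ω hω using fun a => h.exists_incl (s a - l a) (by rw [map_sub, (hsq a).1, hl', sub_self])
  have hql : IsQuasiLinear NX NY ω := by
    refine ⟨fun c a => hinj ?_, ?_⟩
    · rw [map_smul, hω, hω, hs, map_smul, smul_sub]
    · obtain ⟨D', hD1', hD'⟩ := NX.exists_add_le
      refine ⟨B * (D * (D * (|C| * D') + |C|)) + B * (D * D * |C|), fun a b => ?_⟩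
      have e : j (ω (a + b) - ω a - ω b) = s (a + b) - s a - s b := by
        rw [map_sub, map_sub, hω, hω, hω, map_add]
        abel
      have p1 := NX.nonneg' a
      have p2 := NX.nonneg' b
      have h1 : NZ (s (a + b) - s a - s b) ≤
          D * (D * (|C| * (D' * (NX a + NX b)) + |C| * NX a) + |C| * NX b) := by
        refine (hsub _ _).trans (mul_le_mul_of_nonneg_left (add_le_add ?_ (hsC b)) (by linarith))
        refine (hsub _ _).trans (mul_le_mul_of_nonneg_left (add_le_add ?_ (hsC a)) (by linarith))
        exact (hsC _).trans (mul_le_mul_of_nonneg_left (hD' a b) hC0)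
      have h2 := hB (ω (a + b) - ω a - ω b)
      rw [e] at h2
      refine (h2.trans (mul_le_mul_of_nonneg_left h1 hB0)).trans ?_
      have q1 : 0 ≤ B * D * |C| * NX a := by positivity
      have q2 : 0 ≤ B * D * D * |C| * NX b := by positivity
      nlinarith
  have hT : ∀ z, ∃ y, j y = z - l (q z) := fun z =>
    h.exists_incl _ (by rw [map_sub, hl', sub_self])
  choose t ht using hT
  let T : (Y × X) ≃ₗ[𝕜] Z :=
    { toFun := fun p => j p.1 + l p.2
      map_add' := fun p p' => by
        simp only [Prod.fst_add, Prod.snd_add, map_add]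
        abel
      map_smul' := fun c p => by
        simp only [Prod.smul_fst, Prod.smul_snd, map_smul, smul_add, RingHom.id_apply]
      invFun := fun z => (t z, q z)
      left_inv := fun p => by
        have hq' : q (j p.1 + l p.2) = p.2 := by rw [map_add, h.quot_incl, hl', zero_add]
        refine Prod.ext (hinj ?_) hq'
        change j (t (j p.1 + l p.2)) = j p.1
        rw [ht, hq', add_sub_cancel_right]
      right_inv := fun z => by
        change j (t z) + l (q z) = z
        rw [ht, sub_add_cancel] }
  -- In this form both bounds for `T` are visible: the two terms are controlled by the two terms of
  -- the twisted quasi-norm.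
  have hTeq : ∀ p : Y × X, T p = j (p.1 - ω p.2) + s p.2 := fun p => by
    change j p.1 + l p.2 = _
    rw [map_sub, hω]
    abel
  refine ⟨ω, hql, T, ⟨D * (J + |C|), fun p => ?_⟩, ⟨B * D * (1 + |C| * Q) + Q, fun z => ?_⟩,
    fun y => ?_, fun y a => ?_⟩
  · change NZ (T p) ≤ D * (J + |C|) * (NY (p.1 - ω p.2) + NX p.2)
    rw [hTeq]
    have p1 := NY.nonneg' (p.1 - ω p.2)
    have p2 := NX.nonneg' p.2
    refine (hD _ _).trans ?_
    rw [mul_assoc]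
    refine mul_le_mul_of_nonneg_left ?_ (by linarith)
    have := hJ (p.1 - ω p.2)
    have := hsC p.2
    nlinarith
  · change NY (t z - ω (q z)) + NX (q z) ≤ _
    have e : j (t z - ω (q z)) = z - s (q z) := by
      rw [map_sub, ht, hω]
      abel
    have h1 := hB (t z - ω (q z))
    rw [e] at h1
    have h2 : NZ (s (q z)) ≤ |C| * (Q * NZ z) :=
      (hsC _).trans (mul_le_mul_of_nonneg_left (hQ z) hC0)
    have h3 := (hsub z (s (q z))).trans
      (mul_le_mul_of_nonneg_left (add_le_add le_rfl h2) (by linarith))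
    have h4 := h1.trans (mul_le_mul_of_nonneg_left h3 hB0)
    calc _ ≤ B * (D * (NZ z + |C| * (Q * NZ z))) + Q * NZ z := add_le_add h4 (hQ z)
      _ = _ := by ring
  · change j y + l 0 = j y
    rw [map_zero, add_zero]
  · change q (j y + l a) = a
    rw [map_add, h.quot_incl, hl', zero_add]

/-- A quasi-linear map associated to an exact sequence is trivial on a subspace if and only if
the quotient map of the sequence has a bounded linear lifting on that subspace. -/
theorem IsAssociated.isTrivialOn_iff {ω : X → Y} (h : IsAssociated NX NY NZ j q ω)
    (E : Submodule 𝕜 X) :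
    IsTrivialOn NX NY ω E ↔
      ∃ l : E →ₗ[𝕜] Z, ∃ C : ℝ, ∀ a : E, q (l a) = a ∧ NZ (l a) ≤ C * NX a := by
  obtain ⟨hω, T, hT, hT', -, hqT⟩ := h
  obtain ⟨A, hA0, hA⟩ := hT.exists_nonneg
  obtain ⟨B, hB0, hB⟩ := hT'.exists_nonneg
  constructor
  · rintro ⟨L, C, hL⟩
    -- In the twisted sum the lifting attached to `L` is `a ↦ (L a, a)`; its quasi-norm is `‖L a - ω
    -- a‖ + ‖a‖`. The other direction reads `L` off as the first coordinate.
    refine ⟨T.toLinearMap ∘ₗ L.prod E.subtype, A * (C + 1), fun a => ⟨hqT _ _, ?_⟩⟩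
    refine (hA _).trans ?_
    rw [mul_assoc]
    refine mul_le_mul_of_nonneg_left ?_ hA0
    change NY (L a - ω a) + NX a ≤ _
    rw [NY.map_sub_rev]
    linarith [hL a]
  · rintro ⟨l, C, hl⟩
    refine ⟨LinearMap.fst 𝕜 Y X ∘ₗ T.symm.toLinearMap ∘ₗ l, B * C, fun a => ?_⟩
    obtain ⟨⟨y, b⟩, hyb⟩ := T.surjective (l a)
    have hb : b = a := by rw [← (hl a).1, ← hyb, hqT]
    subst hb
    have h1 := hB (l a)
    have e : T.symm (l a) = (y, (a : X)) := by rw [← hyb, T.symm_apply_apply]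
    have e1 : T.symm.toLinearMap (l a) = (y, (a : X)) := e
    rw [e1] at h1
    have h2 : NY (y - ω a) + NX a ≤ B * NZ (l a) := h1
    have e2 : (LinearMap.fst 𝕜 Y X ∘ₗ T.symm.toLinearMap ∘ₗ l) a = y := congrArg Prod.fst e
    rw [e2, NY.map_sub_rev, mul_assoc]
    have h3 := mul_le_mul_of_nonneg_left (hl a).2 hB0
    linarith [NX.nonneg' (a : X)]

end ExactSeq

/-! ### Pointwise calculus of classes of measurable functions -/

namespace L0

variable {𝕜 : Type u} [RCLike 𝕜] {S : Type v} [MeasurableSpace S] {μ : Measure S}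

theorem coeFn_zero : ⇑(0 : L0 𝕜 μ) =ᵐ[μ] fun _ => 0 := AEEqFun.coeFn_zero

theorem coeFn_sub (f g : L0 𝕜 μ) : ⇑(f - g) =ᵐ[μ] fun t => f t - g t := AEEqFun.coeFn_sub f g

theorem coeFn_sum {κ : Type w} (s : Finset κ) (f : κ → L0 𝕜 μ) :
    ⇑(∑ k ∈ s, f k) =ᵐ[μ] fun t => ∑ k ∈ s, f k t := by
  classical
  induction s using Finset.induction_on with
  | empty => simpa using coeFn_zero
  | insert i s hi ih =>
    rw [Finset.sum_insert hi]
    filter_upwards [coeFn_add (f i) (∑ k ∈ s, f k), ih] with t h1 h2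
    rw [h1, h2, Finset.sum_insert hi]

theorem coeFn_sum_smul {κ : Type w} (s : Finset κ) (c : κ → 𝕜) (f : κ → L0 𝕜 μ) :
    ⇑(∑ k ∈ s, c k • f k) =ᵐ[μ] fun t => ∑ k ∈ s, c k * f k t := by
  have h : ∀ᵐ t ∂μ, ∀ k ∈ s, (c k • f k) t = c k * f k t :=
    (ae_ball_iff s.countable_toSet).2 fun k _ => coeFn_smul (c k) (f k)
  filter_upwards [coeFn_sum s fun k => c k • f k, h] with t h1 h2
  rw [h1]
  exact Finset.sum_congr rfl h2

theorem norm_infAbs (f g : L0 𝕜 μ) : ∀ᵐ t ∂μ, ‖infAbs f g t‖ = min ‖f t‖ ‖g t‖ := by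
  filter_upwards [coeFn_infAbs f g] with t ht
  rw [ht, RCLike.norm_ofReal, abs_of_nonneg (le_min (norm_nonneg _) (norm_nonneg _))]

theorem measurable (f : L0 𝕜 μ) : Measurable (⇑f) := (AEEqFun.stronglyMeasurable f).measurable

/-- The characteristic function of a measurable set. -/
noncomputable def ind (𝕜 : Type u) [RCLike 𝕜] (μ : Measure S) (A : Set S) (hA : MeasurableSet A) :
    L0 𝕜 μ :=
  mk (A.indicator fun _ => (1 : 𝕜)) (aestronglyMeasurable_const.indicator hA)

theorem coeFn_ind (A : Set S) (hA : MeasurableSet A) :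
    ⇑(ind 𝕜 μ A hA) =ᵐ[μ] A.indicator fun _ => (1 : 𝕜) := coeFn_mk _ _

theorem norm_ind_le (A : Set S) (hA : MeasurableSet A) : ∀ᵐ t ∂μ, ‖ind 𝕜 μ A hA t‖ ≤ 1 := by
  filter_upwards [coeFn_ind (𝕜 := 𝕜) (μ := μ) A hA] with t ht
  rw [ht]
  by_cases h : t ∈ A <;> simp [h]

end L0

/-! ### Disjointly supported vectors in Köthe spaces -/

namespace KotheSpace

variable {𝕜 : Type u} [RCLike 𝕜] {S : Type v} [MeasurableSpace S] {μ : Measure S}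
  (K : KotheSpace 𝕜 μ)

theorem qnorm_le {a b : K.carrier} (h : ∀ᵐ t ∂μ, ‖(a : L0 𝕜 μ) t‖ ≤ ‖(b : L0 𝕜 μ) t‖) :
    K.qnorm a ≤ K.qnorm b := (K.solid _ b h).2

theorem exists_mul_mem {f : L0 𝕜 μ} {M : ℝ} (hM : 0 ≤ M) (hf : ∀ᵐ t ∂μ, ‖f t‖ ≤ M)
    (a : K.carrier) : ∃ h : f * (a : L0 𝕜 μ) ∈ K.carrier, K.qnorm ⟨_, h⟩ ≤ M * K.qnorm a := by
  obtain ⟨h, hle⟩ := K.solid (f * (a : L0 𝕜 μ)) ((M : 𝕜) • a) (by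
    filter_upwards [hf, L0.coeFn_mul f (a : L0 𝕜 μ), L0.coeFn_smul (M : 𝕜) (a : L0 𝕜 μ)]
      with t h1 h2 h3
    rw [Submodule.coe_smul, h2, h3, norm_mul, norm_mul, RCLike.norm_ofReal, abs_of_nonneg hM]
    exact mul_le_mul_of_nonneg_right h1 (norm_nonneg _))
  rw [K.qnorm.smul', RCLike.norm_ofReal, abs_of_nonneg hM] at hle
  exact ⟨h, hle⟩

theorem Disj.symm {a b : K.carrier} (h : K.Disj a b) : K.Disj b a := by
  filter_upwards [h] with t ht using ht.symm

theorem qnorm_le_add {a b : K.carrier} (h : K.Disj a b) : K.qnorm a ≤ K.qnorm (a + b) := by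
  refine K.qnorm_le ?_
  filter_upwards [h, L0.coeFn_add (a : L0 𝕜 μ) b] with t h1 h2
  rw [Submodule.coe_add, h2]
  rcases h1 with h1 | h1
  · rw [h1, norm_zero]
    exact norm_nonneg _
  · rw [h1, add_zero]

theorem coeFn_sum_smul {κ : Type w} (s : Finset κ) (c : κ → 𝕜) (a : κ → K.carrier) :
    ⇑((∑ k ∈ s, c k • a k : K.carrier) : L0 𝕜 μ) =ᵐ[μ]
      fun t => ∑ k ∈ s, c k * (a k : L0 𝕜 μ) t := by
  have h := L0.coeFn_sum_smul s c fun k => (a k : L0 𝕜 μ)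
  have e : ((∑ k ∈ s, c k • a k : K.carrier) : L0 𝕜 μ) = ∑ k ∈ s, c k • (a k : L0 𝕜 μ) := by
    rw [Submodule.coe_sum]
    rfl
  rwa [e]

theorem Disj.sum_smul {κ : Type w} (s : Finset κ) (c : κ → 𝕜) {a : κ → K.carrier} {b : K.carrier}
    (h : ∀ k ∈ s, K.Disj b (a k)) : K.Disj b (∑ k ∈ s, c k • a k) := by
  have h' : ∀ᵐ t ∂μ, ∀ k ∈ s, (b : L0 𝕜 μ) t = 0 ∨ (a k : L0 𝕜 μ) t = 0 :=
    (ae_ball_iff s.countable_toSet).2 h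
  filter_upwards [h', K.coeFn_sum_smul s c a] with t h1 h2
  by_cases hb : (b : L0 𝕜 μ) t = 0
  · exact Or.inl hb
  · refine Or.inr ?_
    rw [h2]
    refine Finset.sum_eq_zero fun k hk => ?_
    rw [(h1 k hk).resolve_left hb, mul_zero]

/-- A disjoint sum dominates each of its summands pointwise, so monotonicity of the quasi-norm gives
constant `1`. -/
theorem norm_mul_qnorm_le_sum {κ : Type w} [Fintype κ] (c : κ → 𝕜) {a : κ → K.carrier}
    (h : Pairwise fun k l => K.Disj (a k) (a l)) (k : κ) :
    ‖c k‖ * K.qnorm (a k) ≤ K.qnorm (∑ l, c l • a l) := by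
  classical
  rw [← Finset.add_sum_erase _ _ (Finset.mem_univ k), ← K.qnorm.smul']
  refine K.qnorm_le_add (Disj.sum_smul K _ _ fun l hl => ?_)
  filter_upwards [h (Finset.ne_of_mem_erase hl).symm, L0.coeFn_smul (c k) (a k : L0 𝕜 μ)]
    with t h1 h2
  rw [Submodule.coe_smul, h2]
  exact h1.imp_left fun h0 => by rw [h0, mul_zero]

/-! ### Disjointness in the ultrapower -/

/-- The element `|a| ∧ |b|` of `K`. -/
noncomputable def inf (a b : K.carrier) : K.carrier :=
  ⟨L0.infAbs (a : L0 𝕜 μ) b, K.infAbs_mem _ _⟩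

theorem norm_inf (a b : K.carrier) :
    ∀ᵐ t ∂μ, ‖(K.inf a b : L0 𝕜 μ) t‖ = min ‖(a : L0 𝕜 μ) t‖ ‖(b : L0 𝕜 μ) t‖ :=
  L0.norm_infAbs _ _

theorem coeFn_inf (a b : K.carrier) : ⇑(K.inf a b : L0 𝕜 μ) =ᵐ[μ]
    fun t => ((min ‖(a : L0 𝕜 μ) t‖ ‖(b : L0 𝕜 μ) t‖ : ℝ) : 𝕜) := L0.coeFn_infAbs _ _

theorem qnorm_inf_eq_zero {a b : K.carrier} (h : K.Disj a b) : K.qnorm (K.inf a b) = 0 := by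
  rw [K.qnorm.eq_zero_iff']
  refine Subtype.ext (L0.ext ?_)
  filter_upwards [h, K.coeFn_inf a b, L0.coeFn_zero (𝕜 := 𝕜) (μ := μ)] with t h1 h2 h3
  rw [h2, Submodule.coe_zero, h3]
  rcases h1 with h1 | h1 <;> rw [h1, norm_zero]
  · rw [min_eq_left (norm_nonneg _), RCLike.ofReal_zero]
  · rw [min_eq_right (norm_nonneg _), RCLike.ofReal_zero]

variable {ι : Type w} (U : Ultrafilter ι)

theorem UltraDisj.of_disj {a b : K.qnorm.boundedFamilies ι}
    (h : ∀ i, K.Disj ((a : ι → K.carrier) i) ((b : ι → K.carrier) i)) :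
    K.UltraDisj U (K.qnorm.ultraMk U a) (K.qnorm.ultraMk U b) := by
  refine ⟨a, b, rfl, rfl, ?_⟩
  refine tendsto_const_nhds.congr fun i => ?_
  exact (K.qnorm_inf_eq_zero (h i)).symm

/-- Disjointness does not depend on the representatives, because `|a| ∧ |b| ≤ |a'| ∧ |b'| + |a' - a|
+ |b' - b|`. In the proof `K.inf d d` stands for `|d|`. -/
theorem UltraDisj.tendsto_inf {a b : K.qnorm.boundedFamilies ι}
    (h : K.UltraDisj U (K.qnorm.ultraMk U a) (K.qnorm.ultraMk U b)) :
    Tendsto (fun i => K.qnorm (K.inf ((a : ι → K.carrier) i) ((b : ι → K.carrier) i))) U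
      (𝓝 0) := by
  obtain ⟨a', b', ha, hb, hab⟩ := h
  rw [QuasiNorm.ultraMk_eq_iff] at ha hb
  have hself : ∀ d : K.carrier, K.qnorm (K.inf d d) ≤ K.qnorm d := fun d => by
    refine K.qnorm_le ?_
    filter_upwards [K.norm_inf d d] with t ht
    rw [ht, min_self]
  have hab' : Tendsto (fun i => K.qnorm (K.inf ((a' : ι → K.carrier) i)
    ((b' : ι → K.carrier) i))) U (𝓝 0) := hab
  have ha' := squeeze_zero (fun i => K.qnorm.nonneg' _) (fun i => hself _) ha
  have hb' := squeeze_zero (fun i => K.qnorm.nonneg' _) (fun i => hself _) hb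
  have hsum := K.qnorm.tendsto_add_zero (K.qnorm.tendsto_add_zero hab' ha') hb'
  refine squeeze_zero (fun i => K.qnorm.nonneg' _) (fun i => K.qnorm_le ?_) hsum
  generalize (a : ι → K.carrier) i = f
  generalize (b : ι → K.carrier) i = g
  generalize (a' : ι → K.carrier) i = f'
  generalize (b' : ι → K.carrier) i = g'
  change ∀ᵐ t ∂μ, ‖(K.inf f g : L0 𝕜 μ) t‖ ≤
    ‖((K.inf f' g' : L0 𝕜 μ) + (K.inf (f' - f) (f' - f) : L0 𝕜 μ) +
      (K.inf (g' - g) (g' - g) : L0 𝕜 μ)) t‖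
  filter_upwards [K.norm_inf f g, K.coeFn_inf f' g', K.coeFn_inf (f' - f) (f' - f),
    K.coeFn_inf (g' - g) (g' - g), L0.coeFn_sub (f' : L0 𝕜 μ) f, L0.coeFn_sub (g' : L0 𝕜 μ) g,
    L0.coeFn_add ((K.inf f' g' : L0 𝕜 μ) + (K.inf (f' - f) (f' - f) : L0 𝕜 μ))
      (K.inf (g' - g) (g' - g) : L0 𝕜 μ),
    L0.coeFn_add (K.inf f' g' : L0 𝕜 μ) (K.inf (f' - f) (f' - f) : L0 𝕜 μ)]
    with t h1 h2 h3 h4 h5 h6 h7 h8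
  rw [h1, h7, h8, h2, h3, h4, min_self, min_self, Submodule.coe_sub, Submodule.coe_sub, h5, h6,
    ← RCLike.ofReal_add, ← RCLike.ofReal_add, RCLike.norm_ofReal]
  refine le_trans ?_ (le_abs_self _)
  have e1 : ‖(f : L0 𝕜 μ) t‖ ≤ ‖(f' : L0 𝕜 μ) t‖ + ‖(f' : L0 𝕜 μ) t - (f : L0 𝕜 μ) t‖ := by
    rw [norm_sub_rev]
    exact norm_le_norm_add_norm_sub' _ _
  have e2 : ‖(g : L0 𝕜 μ) t‖ ≤ ‖(g' : L0 𝕜 μ) t‖ + ‖(g' : L0 𝕜 μ) t - (g : L0 𝕜 μ) t‖ := by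
    rw [norm_sub_rev]
    exact norm_le_norm_add_norm_sub' _ _
  have n1 := norm_nonneg ((f' : L0 𝕜 μ) t - (f : L0 𝕜 μ) t)
  have n2 := norm_nonneg ((g' : L0 𝕜 μ) t - (g : L0 𝕜 μ) t)
  rcases min_cases ‖(f' : L0 𝕜 μ) t‖ ‖(g' : L0 𝕜 μ) t‖ with ⟨h, -⟩ | ⟨h, -⟩ <;> rw [h]
  · exact (min_le_left _ _).trans (by linarith)
  · exact (min_le_right _ _).trans (by linarith)

/-- Finitely many disjoint elements of the ultrapower have disjoint representatives. -/
theorem UltraDisj.exists_disj_rep {n : ℕ} (ξ : Fin n → K.qnorm.Ultrapower U)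
    (h : Pairwise fun k l => K.UltraDisj U (ξ k) (ξ l)) :
    ∃ a : Fin n → K.qnorm.boundedFamilies ι, (∀ k, K.qnorm.ultraMk U (a k) = ξ k) ∧
      ∀ i, Pairwise fun k l =>
        K.Disj ((a k : ι → K.carrier) i) ((a l : ι → K.carrier) i) := by
  classical
  choose a ha using fun k => K.qnorm.ultraMk_surjective U (ξ k)
  -- In each coordinate `a k` is kept only where it is strictly larger in modulus than all the
  -- others. Strictness makes these sets disjoint.
  let A : ι → Fin n → Set S := fun i k =>
    {t | ∀ l, l ≠ k → ‖((a l : ι → K.carrier) i : L0 𝕜 μ) t‖ <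
      ‖((a k : ι → K.carrier) i : L0 𝕜 μ) t‖}
  have hA : ∀ i k, MeasurableSet (A i k) := fun i k => by
    have e : A i k = ⋂ l, ⋂ (_ : l ≠ k), {t | ‖((a l : ι → K.carrier) i : L0 𝕜 μ) t‖ <
      ‖((a k : ι → K.carrier) i : L0 𝕜 μ) t‖} := by
      ext t
      simp only [A, Set.mem_ofPred_eq, Set.mem_iInter]
    rw [e]
    exact MeasurableSet.iInter fun l => MeasurableSet.iInter fun _ =>
      measurableSet_lt (L0.measurable _).norm (L0.measurable _).norm
  choose hv hvle using fun i k =>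
    K.exists_mul_mem zero_le_one (L0.norm_ind_le (𝕜 := 𝕜) (μ := μ) (A i k) (hA i k))
      ((a k : ι → K.carrier) i)
  have hcoe : ∀ i k, ∀ᵐ t ∂μ, (L0.ind 𝕜 μ (A i k) (hA i k) * ((a k : ι → K.carrier) i : L0 𝕜 μ)) t =
      (A i k).indicator (fun t => ((a k : ι → K.carrier) i : L0 𝕜 μ) t) t := fun i k => by
    filter_upwards [L0.coeFn_ind (𝕜 := 𝕜) (μ := μ) (A i k) (hA i k),
      L0.coeFn_mul (L0.ind 𝕜 μ (A i k) (hA i k)) ((a k : ι → K.carrier) i : L0 𝕜 μ)] with t h1 h2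
    rw [h2, h1]
    by_cases ht : t ∈ A i k <;> simp [ht]
  refine ⟨fun k => ⟨fun i => ⟨_, hv i k⟩, ?_⟩, fun k => ?_, fun i k l hkl => ?_⟩
  · obtain ⟨C, hC⟩ := (a k).2
    exact ⟨1 * C, fun i => (hvle i k).trans (mul_le_mul_of_nonneg_left (hC i) zero_le_one)⟩
  · rw [← ha k, QuasiNorm.ultraMk_eq_iff]
    have hlim : Tendsto (fun i => K.qnorm (∑ l ∈ Finset.univ.erase k, K.inf ((a k : ι → K.carrier) i)
        ((a l : ι → K.carrier) i))) U (𝓝 0) := by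
      refine K.qnorm.tendsto_sum_zero _ _ fun l hl => UltraDisj.tendsto_inf K U ?_
      rw [ha, ha]
      exact h (Finset.ne_of_mem_erase hl).symm
    refine squeeze_zero (fun i => K.qnorm.nonneg' _) (fun i => K.qnorm_le ?_) hlim
    have hinf : ∀ᵐ t ∂μ, ∀ l, (K.inf ((a k : ι → K.carrier) i) ((a l : ι → K.carrier) i) :
        L0 𝕜 μ) t = ((min ‖((a k : ι → K.carrier) i : L0 𝕜 μ) t‖
          ‖((a l : ι → K.carrier) i : L0 𝕜 μ) t‖ : ℝ) : 𝕜) :=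
      ae_all_iff.2 fun l => K.coeFn_inf _ _
    have hsum := L0.coeFn_sum (μ := μ) (Finset.univ.erase k) fun l =>
      (K.inf ((a k : ι → K.carrier) i) ((a l : ι → K.carrier) i) : L0 𝕜 μ)
    have e : ((∑ l ∈ Finset.univ.erase k, K.inf ((a k : ι → K.carrier) i)
        ((a l : ι → K.carrier) i) : K.carrier) : L0 𝕜 μ) = ∑ l ∈ Finset.univ.erase k,
          (K.inf ((a k : ι → K.carrier) i) ((a l : ι → K.carrier) i) : L0 𝕜 μ) :=
      Submodule.coe_sum _ _ _
    rw [e]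
    filter_upwards [hinf, hsum, hcoe i k, L0.coeFn_sub (L0.ind 𝕜 μ (A i k) (hA i k) *
      ((a k : ι → K.carrier) i : L0 𝕜 μ)) ((a k : ι → K.carrier) i : L0 𝕜 μ)] with t h1 h2 h3 h4
    rw [Submodule.coe_sub, h4, h3, h2]
    by_cases ht : t ∈ A i k
    · rw [Set.indicator_of_mem ht, sub_self, norm_zero]
      exact norm_nonneg _
    · rw [Set.indicator_of_notMem ht, zero_sub, norm_neg]
      simp only [A, Set.mem_ofPred_eq, not_forall, not_lt] at ht
      -- At a point where `a k` is discarded some `a l` is at least as large, so `|a k| = |a k| ∧ |a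
      -- l|` there. The discarded part is thus dominated by a sum of null families.
      obtain ⟨l, hl, hle⟩ := ht
      have hs : ∑ l ∈ Finset.univ.erase k, (K.inf ((a k : ι → K.carrier) i)
          ((a l : ι → K.carrier) i) : L0 𝕜 μ) t =
          ((∑ l ∈ Finset.univ.erase k, min ‖((a k : ι → K.carrier) i : L0 𝕜 μ) t‖
          ‖((a l : ι → K.carrier) i : L0 𝕜 μ) t‖ : ℝ) : 𝕜) := by
        rw [RCLike.ofReal_sum]
        exact Finset.sum_congr rfl fun l _ => h1 l
      rw [hs, RCLike.norm_ofReal]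
      refine le_trans ?_ (le_abs_self _)
      refine (min_eq_left hle).symm.le.trans ?_
      exact Finset.single_le_sum
        (f := fun l => min ‖((a k : ι → K.carrier) i : L0 𝕜 μ) t‖
          ‖((a l : ι → K.carrier) i : L0 𝕜 μ) t‖)
        (fun l _ => le_min (norm_nonneg _) (norm_nonneg _))
        (Finset.mem_erase.2 ⟨hl, Finset.mem_univ l⟩)
  · change ∀ᵐ t ∂μ, _ ∨ _
    filter_upwards [hcoe i k, hcoe i l] with t h1 h2
    by_cases ht : t ∈ A i k
    · refine Or.inr (h2.trans (Set.indicator_of_notMem (fun ht' => ?_) _))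
      exact lt_asymm (ht l hkl.symm) (ht' k hkl)
    · exact Or.inl (h1.trans (Set.indicator_of_notMem ht _))

/-- With disjoint representatives, each term of a combination is dominated by the whole combination
in every coordinate, so a null combination has null terms. -/
theorem UltraDisj.linearIndependent {n : ℕ} (ξ : Fin n → K.qnorm.Ultrapower U)
    (h : Pairwise fun k l => K.UltraDisj U (ξ k) (ξ l)) (h0 : ∀ k, ξ k ≠ 0) :
    LinearIndependent 𝕜 ξ := by
  obtain ⟨a, ha, had⟩ := UltraDisj.exists_disj_rep K U ξ h
  rw [Fintype.linearIndependent_iff]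
  intro c hc k
  have e : ∑ l, c l • ξ l = K.qnorm.ultraMk U (∑ l, c l • a l) := by
    rw [QuasiNorm.ultraMk_sum]
    exact Finset.sum_congr rfl fun l _ => by rw [QuasiNorm.ultraMk_smul, ha]
  rw [e, QuasiNorm.ultraMk_eq_zero_iff] at hc
  have hk : K.qnorm.ultraMk U (c k • a k) = 0 := by
    rw [QuasiNorm.ultraMk_eq_zero_iff]
    refine squeeze_zero (fun i => K.qnorm.nonneg' _) (fun i => ?_) hc
    rw [QuasiNorm.boundedFamilies_sum_smul_apply]
    refine le_trans (le_of_eq ?_) (K.norm_mul_qnorm_le_sum c (had i) k)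
    exact K.qnorm.smul' _ _
  rw [QuasiNorm.ultraMk_smul, ha] at hk
  exact (smul_eq_zero.1 hk).resolve_right (h0 k)

end KotheSpace

/-! ### Ultraproducts of subspaces -/

section Ultraproduct

variable {𝕜 : Type u} [RCLike 𝕜] {Z : Type v} [AddCommGroup Z] [Module 𝕜 Z]
  {X : Type x} [AddCommGroup X] [Module 𝕜 X] {NZ : QuasiNorm 𝕜 Z} {NX : QuasiNorm 𝕜 X}

namespace QuasiNorm

/-- The ultraproduct of a family of subspaces, as a subspace of the ultrapower. -/
def ultraproduct (N : QuasiNorm 𝕜 Z) {ι : Type w} (U : Ultrafilter ι)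
    (E : ι → Submodule 𝕜 Z) : Submodule 𝕜 (N.Ultrapower U) where
  carrier := {ζ | ∃ a : N.boundedFamilies ι, (∀ i, (a : ι → Z) i ∈ E i) ∧ N.ultraMk U a = ζ}
  zero_mem' := ⟨0, fun i => (E i).zero_mem, LinearMap.map_zero _⟩
  add_mem' := by
    rintro _ _ ⟨a, ha, rfl⟩ ⟨b, hb, rfl⟩
    exact ⟨a + b, fun i => (E i).add_mem (ha i) (hb i), N.ultraMk_add U a b⟩
  smul_mem' := by
    rintro c _ ⟨a, ha, rfl⟩
    exact ⟨c • a, fun i => (E i).smul_mem c (ha i), N.ultraMk_smul U c a⟩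

/-- A common lower bound for `q` on all `E i` passes to the ultraproduct. This supplies a bounded
linear inverse on the image even when the dimensions of the `E i` are unbounded. -/
theorem exists_bddBelow_ultraproduct {q : Z →ₗ[𝕜] X} (hq : NZ.IsBoundedMap NX q) {ι : Type w}
    (U : Ultrafilter ι) {E : ι → Submodule 𝕜 Z} {C : ℝ} (hC : 0 ≤ C)
    (h : ∀ i, ∀ z ∈ E i, NZ z ≤ C * NX (q z)) :
    ∃ C' : ℝ, ∀ ζ ∈ NZ.ultraproduct U E,
      NZ.ultrapower U ζ ≤ C' * NX.ultrapower U (NZ.ultrapowerMap NX q hq U ζ) := by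
  obtain ⟨D, hD1, hD⟩ := NX.exists_eventually_lt
  refine ⟨C * D, ?_⟩
  rintro _ ⟨a, ha, rfl⟩
  refine le_mul_of_forall_gt fun t ht => ?_
  have ht0 : 0 ≤ t := ((NX.ultrapower U).nonneg' _).trans ht.le
  rw [ultrapowerMap_mk] at ht
  refine NZ.ultrapower_le U (by positivity) ?_
  filter_upwards [hD U _ t ht] with i hi
  refine (h i _ (ha i)).trans ?_
  rw [mul_assoc]
  exact mul_le_mul_of_nonneg_left hi.le hC

/-- Along a countably incomplete ultrafilter, ultraproducts of subspaces are closed. -/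
theorem closedSpan_le_map_ultraproduct {q : Z →ₗ[𝕜] X} (hq : NZ.IsBoundedMap NX q) {ι : Type w}
    (U : Ultrafilter ι) {r : ι → ℕ} (hr : Tendsto r U atTop) {E : ι → Submodule 𝕜 Z} {C : ℝ}
    (hC : 0 ≤ C) (h : ∀ i, ∀ z ∈ E i, NZ z ≤ C * NX (q z)) {s : Set (NX.Ultrapower U)}
    (hs : s ⊆ (NZ.ultraproduct U E).map (NZ.ultrapowerMap NX q hq U)) :
    (NX.ultrapower U).closedSpan s ≤
      (NZ.ultraproduct U E).map (NZ.ultrapowerMap NX q hq U) := by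
  intro ξ hξ
  obtain ⟨a, rfl⟩ := NX.ultraMk_surjective U ξ
  obtain ⟨D, hD1, hD⟩ := NX.exists_add_le
  obtain ⟨D', hD1', hD'⟩ := NX.exists_eventually_lt
  -- `T i` collects the distances from `a i` to the points of `q (E i)`. Since the infimum may not
  -- be attained, `b i` is chosen within `1 / (r i + 1)` of it, an error that vanishes along `U`.
  let T : ι → Set ℝ := fun i => (fun b => NX ((a : ι → X) i - q b)) '' (E i : Set Z)
  have hTb : ∀ i, BddBelow (T i) := fun i => ⟨0, by rintro _ ⟨b, -, rfl⟩; exact NX.nonneg' _⟩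
  have hTn : ∀ i, (T i).Nonempty := fun i => ⟨_, 0, (E i).zero_mem, rfl⟩
  have hpos : ∀ i, (0 : ℝ) < 1 / (r i + 1) := fun i => by positivity
  have hex : ∀ i, ∃ b ∈ E i, NX ((a : ι → X) i - q b) < sInf (T i) + 1 / (r i + 1) := fun i => by
    obtain ⟨_, ⟨b, hb, rfl⟩, hlt⟩ := Real.lt_sInf_add_pos (hTn i) (hpos i)
    exact ⟨b, hb, hlt⟩
  choose b hbE hb using hex
  have hT0 : ∀ i, sInf (T i) ≤ NX ((a : ι → X) i) := fun i =>
    csInf_le (hTb i) ⟨0, (E i).zero_mem, by simp⟩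
  obtain ⟨A, hA⟩ := a.2
  have hbb : b ∈ NZ.boundedFamilies ι := by
    refine ⟨C * (D * (A + (A + 1))), fun i => (h i _ (hbE i)).trans
      (mul_le_mul_of_nonneg_left ?_ hC)⟩
    have e : q (b i) = (a : ι → X) i + -((a : ι → X) i - q (b i)) := by abel
    rw [e]
    refine (hD _ _).trans (mul_le_mul_of_nonneg_left (add_le_add (hA i) ?_) (by linarith))
    rw [NX.map_neg]
    have h1 : (1 : ℝ) / (r i + 1) ≤ 1 := by
      rw [div_le_one (by positivity)]
      linarith [(Nat.cast_nonneg (r i) : (0 : ℝ) ≤ r i)]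
    linarith [hb i, hT0 i, hA i]
  refine ⟨NZ.ultraMk U ⟨b, hbb⟩, ⟨⟨b, hbb⟩, hbE, rfl⟩, ?_⟩
  rw [ultrapowerMap_mk, ultraMk_eq_iff]
  change Tendsto (fun i => NX (q (b i) - (a : ι → X) i)) U (𝓝 0)
  -- Every approximant of the class of `a` in the span of `s` has a representative in the images `q
  -- (E i)`, so the infima become smaller than any `ε`. A single near-minimizing family therefore
  -- represents the class exactly.
  have hinf : Tendsto (fun i => sInf (T i)) U (𝓝 0) := by
    rw [Metric.tendsto_nhds]
    intro ε hε
    have hD0 : 0 < D' := by linarith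
    obtain ⟨η, hη, hlt⟩ := hξ (ε / D') (by positivity)
    obtain ⟨_, ⟨c, hcE, rfl⟩, rfl⟩ := Submodule.span_le.2 hs hη
    rw [ultrapowerMap_mk, ← ultraMk_sub] at hlt
    filter_upwards [hD' U _ _ hlt] with i hi
    rw [Real.dist_eq, sub_zero, abs_of_nonneg (Real.sInf_nonneg (by
      rintro _ ⟨b, -, rfl⟩
      exact NX.nonneg' _))]
    rw [mul_div_cancel₀ _ hD0.ne'] at hi
    exact (csInf_le (hTb i) ⟨_, hcE i, rfl⟩).trans_lt hi
  have hlim : Tendsto (fun i => sInf (T i) + 1 / ((r i : ℝ) + 1)) U (𝓝 0) := by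
    simpa using hinf.add ((tendsto_one_div_add_atTop_nhds_zero_nat (𝕜 := ℝ)).comp hr)
  refine squeeze_zero (fun i => NX.nonneg' _) (fun i => ?_) hlim
  rw [NX.map_sub_rev]
  exact (hb i).le

end QuasiNorm

end Ultraproduct

namespace KotheSpace

variable {𝕜 : Type u} [RCLike 𝕜] {S : Type v} [MeasurableSpace S] {μ : Measure S}
  (K : KotheSpace 𝕜 μ) {Z : Type w} [AddCommGroup Z] [Module 𝕜 Z] {NZ : QuasiNorm 𝕜 Z}
  {q : Z →ₗ[𝕜] K.carrier}

/-! ### Liftings on spans of disjoint vectors -/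

/-- The quotient map `q` has a linear lifting of norm at most `C` on the span of some `n` disjoint
nonzero vectors. -/
def HasDisjointLifting (NZ : QuasiNorm 𝕜 Z) (q : Z →ₗ[𝕜] K.carrier) (n : ℕ) (C : ℝ) : Prop :=
  ∃ z : Fin n → Z, (∀ k, q (z k) ≠ 0) ∧ (Pairwise fun k l => K.Disj (q (z k)) (q (z l))) ∧
    ∀ c : Fin n → 𝕜, NZ (∑ k, c k • z k) ≤ C * K.qnorm (q (∑ k, c k • z k))

theorem HasDisjointLifting.mono {n m : ℕ} (hmn : m ≤ n) {C : ℝ}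
    (h : K.HasDisjointLifting NZ q n C) : K.HasDisjointLifting NZ q m C := by
  classical
  obtain ⟨z, h0, hd, hC⟩ := h
  refine ⟨fun k => z (Fin.castLE hmn k), fun k => h0 _, fun k l hkl => hd fun h => hkl
    (Fin.castLE_injective hmn h), fun c => ?_⟩
  have hinj : Function.Injective (Fin.castLE hmn) := Fin.castLE_injective hmn
  have e : ∑ k, Function.extend (Fin.castLE hmn) c 0 k • z k =
      ∑ k, c k • z (Fin.castLE hmn k) := by
    rw [← Finset.sum_subset (Finset.subset_univ (Finset.univ.map (Fin.castLEEmb hmn)))]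
    · rw [Finset.sum_map]
      refine Finset.sum_congr rfl fun k _ => ?_
      change Function.extend (Fin.castLE hmn) c 0 (Fin.castLE hmn k) • z (Fin.castLE hmn k) = _
      rw [hinj.extend_apply]
    · intro k _ hk
      rw [Function.extend_apply', Pi.zero_apply, zero_smul]
      rintro ⟨l, rfl⟩
      exact hk (Finset.mem_map.2 ⟨l, Finset.mem_univ l, rfl⟩)
  rw [← e]
  exact hC _

/-- Unit images make the diagonal families bounded and keep their classes nonzero in the ultrapower,
while the lower bound on the span is unchanged. -/
theorem exists_normalized {n : ℕ} {C : ℝ} (z : Fin n → Z) (h0 : ∀ k, q (z k) ≠ 0)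
    (hC : ∀ c : Fin n → 𝕜, NZ (∑ k, c k • z k) ≤ C * K.qnorm (q (∑ k, c k • z k))) :
    ∃ c : Fin n → 𝕜, (∀ k, K.qnorm (q (c k • z k)) = 1) ∧
      ∀ z' ∈ Submodule.span 𝕜 (Set.range fun k => c k • z k), NZ z' ≤ C * K.qnorm (q z') := by
  refine ⟨fun k => ((K.qnorm (q (z k)))⁻¹ : ℝ), fun k => ?_, fun z' hz' => ?_⟩
  · have hp := K.qnorm.pos_of_ne_zero (h0 k)
    rw [map_smul, K.qnorm.smul', RCLike.norm_ofReal, abs_of_nonneg (by positivity),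
      inv_mul_cancel₀ hp.ne']
  · obtain ⟨d, rfl⟩ := (Submodule.mem_span_range_iff_exists_fun 𝕜).1 hz'
    simp only [smul_smul]
    exact hC _

/-- Bounded liftings on spans of disjoint vectors of the ultrapower descend. -/
theorem HasDisjointLifting.of_ultrapower (hl : HasBoundedLifting NZ K.qnorm q)
    (hq : NZ.IsBoundedMap K.qnorm q) (C : ℝ) :
    ∃ C' : ℝ, ∀ {ι : Type y} (U : Ultrafilter ι) {n : ℕ} (ζ : Fin n → NZ.Ultrapower U),
      (∀ k, NZ.ultrapowerMap K.qnorm q hq U (ζ k) ≠ 0) →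
      (Pairwise fun k l => K.UltraDisj U (NZ.ultrapowerMap K.qnorm q hq U (ζ k))
        (NZ.ultrapowerMap K.qnorm q hq U (ζ l))) →
      (∀ c : Fin n → 𝕜, NZ.ultrapower U (∑ k, c k • ζ k) ≤
        C * K.qnorm.ultrapower U (NZ.ultrapowerMap K.qnorm q hq U (∑ k, c k • ζ k))) →
      K.HasDisjointLifting NZ q n C' := by
  obtain ⟨D, hD1, hD⟩ := NZ.exists_eventually_lt
  obtain ⟨D', hD1', hD'⟩ := NZ.exists_sum_le
  have hC0 := abs_nonneg C
  -- `D` pays for passing from the ultrapower quasi-norm to the coordinates, `|C| + 1` makes the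
  -- bound for the limit vector strict, and `2` leads to the contradiction `s ≤ s / 2` with `s > 0`.
  -- None of them depends on `n` or `U`.
  refine ⟨2 * D * (|C| + 1), fun {ι} U n ζ h0 hd hC => ?_⟩
  have hCpos : 0 < 2 * D * (|C| + 1) := by positivity
  obtain ⟨a, ha, had⟩ := UltraDisj.exists_disj_rep K U _ hd
  choose z hz hza using fun k => hl.exists_rep hq U (ζ k) (a k) (ha k)
  have hne : ∀ᶠ i in (U : Filter ι), ∀ k, q ((z k : ι → Z) i) ≠ 0 := by
    refine eventually_all.2 fun k => ?_
    by_contra hcon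
    rw [← Ultrafilter.eventually_not] at hcon
    refine h0 k ?_
    rw [← ha k, QuasiNorm.ultraMk_eq_zero_iff]
    refine tendsto_const_nhds.congr' ?_
    filter_upwards [hcon] with i hi
    rw [← hza k i, not_not.1 hi, K.qnorm.map_zero]
  by_contra hcon
  have hbad : ∀ᶠ i in (U : Filter ι), ∃ c ∈ Metric.sphere (0 : Fin n → 𝕜) 1,
      2 * D * (|C| + 1) * K.qnorm (q (∑ k, c k • (z k : ι → Z) i)) <
        NZ (∑ k, c k • (z k : ι → Z) i) := by
    filter_upwards [hne] with i hi
    by_contra! hall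
    refine hcon ⟨fun k => (z k : ι → Z) i, hi, fun k l hkl => ?_, fun c => ?_⟩
    · beta_reduce
      rw [hza, hza]
      exact had i hkl
    rcases eq_or_ne c 0 with rfl | hc
    · simp [NZ.map_zero, K.qnorm.map_zero]
    have hcn : 0 < ‖c‖ := norm_pos_iff.2 hc
    have h1 := hall (((‖c‖⁻¹ : ℝ) : 𝕜) • c) (by
      rw [mem_sphere_zero_iff_norm, norm_smul, RCLike.norm_ofReal, abs_of_nonneg (by positivity),
        inv_mul_cancel₀ hcn.ne'])
    have e : ∑ k, (((‖c‖⁻¹ : ℝ) : 𝕜) • c) k • (z k : ι → Z) i =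
        ((‖c‖⁻¹ : ℝ) : 𝕜) • ∑ k, c k • (z k : ι → Z) i := by
      rw [Finset.smul_sum]
      exact Finset.sum_congr rfl fun k _ => by rw [Pi.smul_apply, smul_eq_mul, mul_smul]
    rw [e, map_smul, NZ.smul', K.qnorm.smul', RCLike.norm_ofReal, abs_of_nonneg (by positivity),
      mul_left_comm] at h1
    exact le_of_mul_le_mul_left h1 (by positivity)
  -- A default point of the sphere for the coordinates where no bad vector exists. Taking it from
  -- `hbad` avoids treating `n = 0`, where the sphere is empty.
  obtain ⟨i0, c1, hc1, -⟩ := hbad.exists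
  have hchoice : ∀ i, ∃ c ∈ Metric.sphere (0 : Fin n → 𝕜) 1,
      (∃ c ∈ Metric.sphere (0 : Fin n → 𝕜) 1,
        2 * D * (|C| + 1) * K.qnorm (q (∑ k, c k • (z k : ι → Z) i)) <
          NZ (∑ k, c k • (z k : ι → Z) i)) →
        2 * D * (|C| + 1) * K.qnorm (q (∑ k, c k • (z k : ι → Z) i)) <
          NZ (∑ k, c k • (z k : ι → Z) i) := fun i => by
    by_cases h : ∃ c ∈ Metric.sphere (0 : Fin n → 𝕜) 1,
        2 * D * (|C| + 1) * K.qnorm (q (∑ k, c k • (z k : ι → Z) i)) <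
          NZ (∑ k, c k • (z k : ι → Z) i)
    · obtain ⟨c, hc, hc'⟩ := h
      exact ⟨c, hc, fun _ => hc'⟩
    · exact ⟨c1, hc1, fun h' => absurd h' h⟩
  choose c hcs hcbad using hchoice
  obtain ⟨c0, hc0, hcc0⟩ := (isCompact_sphere (0 : Fin n → 𝕜) 1).ultrafilter_le_nhds'
    (Ultrafilter.map c U) (Filter.eventually_map.2 (Eventually.of_forall hcs))
  have hlim : Tendsto c U (𝓝 c0) := hcc0
  choose B hB using fun k => (z k).2
  have hxb : (fun i => ∑ k, c i k • (z k : ι → Z) i) ∈ NZ.boundedFamilies ι := by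
    refine ⟨D' ^ (Finset.univ : Finset (Fin n)).card * ∑ k, 1 * B k, fun i => (hD' _ _).trans ?_⟩
    refine mul_le_mul_of_nonneg_left (Finset.sum_le_sum fun k _ => ?_) (by positivity)
    rw [NZ.smul']
    have h1 : ‖c i k‖ ≤ 1 :=
      (norm_le_pi_norm (c i) k).trans (mem_sphere_zero_iff_norm.1 (hcs i)).le
    exact mul_le_mul h1 (hB k i) (NZ.nonneg' _) zero_le_one
  -- The bad coefficients vary with `i`, but they converge along `U` to `c0` and the `z k` are
  -- bounded, so the bad vectors represent a fixed combination of the `ζ k`.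
  have hx : NZ.ultraMk U ⟨_, hxb⟩ = ∑ k, c0 k • ζ k := by
    have e : ∑ k, c0 k • ζ k = NZ.ultraMk U (∑ k, c0 k • z k) := by
      rw [QuasiNorm.ultraMk_sum]
      exact Finset.sum_congr rfl fun k _ => by rw [QuasiNorm.ultraMk_smul, hz]
    rw [e, QuasiNorm.ultraMk_eq_iff]
    have h1 : Tendsto (fun i => NZ (∑ k, (c i k - c0 k) • (z k : ι → Z) i)) U (𝓝 0) := by
      refine NZ.tendsto_sum_zero _ _ fun k _ => ?_
      have h2 : Tendsto (fun i => ‖c i k - c0 k‖ * B k) U (𝓝 0) := by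
        simpa using (tendsto_iff_norm_sub_tendsto_zero.1
          (tendsto_pi_nhds.1 hlim k)).mul_const (B k)
      refine squeeze_zero (fun i => NZ.nonneg' _) (fun i => ?_) h2
      rw [NZ.smul']
      exact mul_le_mul_of_nonneg_left (hB k i) (norm_nonneg _)
    refine h1.congr fun i => ?_
    rw [QuasiNorm.boundedFamilies_sum_smul_apply, ← Finset.sum_sub_distrib]
    simp only [sub_smul]
  -- The limit `c0` is still on the sphere, and the images of the `ζ k` are linearly independent, so
  -- the limit vector has a nonzero image.
  have hs : 0 < K.qnorm.ultrapower U (NZ.ultrapowerMap K.qnorm q hq U (∑ k, c0 k • ζ k)) := by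
    refine (K.qnorm.ultrapower U).pos_of_ne_zero fun h => ?_
    rw [map_sum] at h
    simp only [map_smul] at h
    have h1 := Fintype.linearIndependent_iff.1 (UltraDisj.linearIndependent K U _ hd h0) c0 h
    have h2 : c0 = 0 := funext h1
    rw [h2, mem_sphere_zero_iff_norm, norm_zero] at hc0
    exact zero_ne_one hc0
  have hCc := hC c0
  rw [← hx] at hs hCc
  have hlt : NZ.ultrapower U (NZ.ultraMk U ⟨_, hxb⟩) < (|C| + 1) *
      K.qnorm.ultrapower U (NZ.ultrapowerMap K.qnorm q hq U (NZ.ultraMk U ⟨_, hxb⟩)) := by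
    have := mul_le_mul_of_nonneg_right (le_abs_self C) hs.le
    linarith
  have hfin : K.qnorm.ultrapower U (NZ.ultrapowerMap K.qnorm q hq U (NZ.ultraMk U ⟨_, hxb⟩)) ≤
      K.qnorm.ultrapower U (NZ.ultrapowerMap K.qnorm q hq U (NZ.ultraMk U ⟨_, hxb⟩)) / 2 := by
    rw [QuasiNorm.ultrapowerMap_mk] at hlt hs ⊢
    refine K.qnorm.ultrapower_le U (by positivity) ?_
    filter_upwards [hbad, hD U _ _ hlt] with i hi hi'
    have h1 := (hcbad i hi).trans hi'
    change K.qnorm (q (∑ k, c i k • (z k : ι → Z) i)) ≤ _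
    refine le_of_mul_le_mul_left (h1.le.trans (le_of_eq ?_)) hCpos
    ring
  linarith

end KotheSpace

namespace KotheSpace

variable {𝕜 : Type u} [RCLike 𝕜] {S : Type v} [MeasurableSpace S] {μ : Measure S}
  (K : KotheSpace 𝕜 μ) {Z : Type w} [AddCommGroup Z] [Module 𝕜 Z] {NZ : QuasiNorm 𝕜 Z}
  {q : Z →ₗ[𝕜] K.carrier}

/-! ### From finite families to sequences in an ultrapower -/

section Diagonal

variable {ι : Type y} {r : ι → ℕ} (z : (n : ℕ) → Fin n → Z)

/-- The `k`-th terms of finite families of lengths `r i`. -/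
def diagonal (r : ι → ℕ) (k : ℕ) (i : ι) : Z := if hk : k < r i then z (r i) ⟨k, hk⟩ else 0

theorem diagonal_mem (k : ℕ) (i : ι) :
    diagonal z r k i ∈ Submodule.span 𝕜 (Set.range (z (r i))) := by
  unfold diagonal
  split_ifs with hk
  · exact Submodule.subset_span ⟨_, rfl⟩
  · exact Submodule.zero_mem _

theorem diagonal_rel {R : Z → Z → Prop} (hz : ∀ n, Pairwise fun k l => R (z n k) (z n l))
    (h1 : ∀ b, R 0 b) (h2 : ∀ b, R b 0) {k l : ℕ} (hkl : k ≠ l) (i : ι) :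
    R (diagonal z r k i) (diagonal z r l i) := by
  unfold diagonal
  split_ifs with hk hl
  · exact hz _ fun h => hkl (congrArg Fin.val h)
  · exact h2 _
  · exact h1 _
  · exact h1 _

variable {z}

theorem diagonal_bounded {C : ℝ} (hC0 : 0 ≤ C)
    (hz : ∀ n, ∀ a ∈ Submodule.span 𝕜 (Set.range (z n)), NZ a ≤ C * K.qnorm (q a))
    (h1 : ∀ n k, K.qnorm (q (z n k)) = 1) (k : ℕ) : diagonal z r k ∈ NZ.boundedFamilies ι := by
  refine ⟨C, fun i => (hz _ _ (diagonal_mem z k i)).trans (mul_le_of_le_one_right hC0 ?_)⟩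
  unfold diagonal
  split_ifs with hk
  · exact (h1 _ _).le
  · rw [map_zero, K.qnorm.map_zero]
    exact zero_le_one

theorem diagonal_ultra_ne_zero {U : Ultrafilter ι} (hr : Tendsto r U atTop)
    (hq : NZ.IsBoundedMap K.qnorm q) (h1 : ∀ n k, K.qnorm (q (z n k)) = 1) (k : ℕ)
    (hb : diagonal z r k ∈ NZ.boundedFamilies ι) :
    NZ.ultrapowerMap K.qnorm q hq U (NZ.ultraMk U ⟨_, hb⟩) ≠ 0 := by
  rw [QuasiNorm.ultrapowerMap_mk]
  refine K.qnorm.ultraMk_ne_zero U zero_lt_one ?_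
  filter_upwards [hr.eventually_gt_atTop k] with i hi
  change 1 ≤ K.qnorm (q (diagonal z r k i))
  unfold diagonal
  rw [dif_pos hi, h1]

end Diagonal

theorem disj_zero_left (b : K.carrier) : K.Disj 0 b := by
  filter_upwards [L0.coeFn_zero (𝕜 := 𝕜) (μ := μ)] with t ht using Or.inl ht

theorem disj_zero_right (b : K.carrier) : K.Disj b 0 := Disj.symm K (K.disj_zero_left b)

/-- Uniformly bounded linear liftings on spans of `n` disjoint vectors give, in the ultrapower by
a countably incomplete ultrafilter, a bounded lifting on the closed span of a disjoint sequence. -/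
theorem exists_lifting_closedSpan (hq : NZ.IsBoundedMap K.qnorm q) {C : ℝ}
    (h : ∀ n, K.HasDisjointLifting NZ q n C) {ι : Type y} (U : Ultrafilter ι) {r : ι → ℕ}
    (hr : Tendsto r U atTop) :
    ∃ e : ℕ → K.qnorm.Ultrapower U, (Pairwise fun k l => K.UltraDisj U (e k) (e l)) ∧
      ¬ FiniteDimensional 𝕜 ((K.qnorm.ultrapower U).closedSpan (Set.range e)) ∧
      ∃ l : (K.qnorm.ultrapower U).closedSpan (Set.range e) →ₗ[𝕜] NZ.Ultrapower U, ∃ C' : ℝ,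
        ∀ a : (K.qnorm.ultrapower U).closedSpan (Set.range e),
          NZ.ultrapowerMap K.qnorm q hq U (l a) = a ∧
            NZ.ultrapower U (l a) ≤ C' * K.qnorm.ultrapower U a := by
  choose z h0 hd hC using h
  choose c hc1 hcC using fun n => K.exists_normalized (z n) (h0 n) (hC n)
  let z' : (n : ℕ) → Fin n → Z := fun n k => c n k • z n k
  have hz' : ∀ n, ∀ a ∈ Submodule.span 𝕜 (Set.range (z' n)), NZ a ≤ |C| * K.qnorm (q a) :=
    fun n a ha => (hcC n a ha).trans
      (mul_le_mul_of_nonneg_right (le_abs_self C) (K.qnorm.nonneg' _))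
  have hd' : ∀ n, Pairwise fun k l => K.Disj (q (z' n k)) (q (z' n l)) := fun n k l hkl => by
    filter_upwards [hd n hkl, L0.coeFn_smul (c n k) (q (z n k) : L0 𝕜 μ),
      L0.coeFn_smul (c n l) (q (z n l) : L0 𝕜 μ)] with t h1 h2 h3
    simp only [z', map_smul, Submodule.coe_smul]
    rw [h2, h3]
    exact h1.imp (fun h => by rw [h, mul_zero]) fun h => by rw [h, mul_zero]
  have hb : ∀ k, diagonal z' r k ∈ NZ.boundedFamilies ι :=
    K.diagonal_bounded (abs_nonneg C) hz' hc1
  -- The `k`-th element collects the `k`-th vectors of all systems. It is missing only where `r i ≤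
  -- k`, which is negligible along `U`.
  let e : ℕ → K.qnorm.Ultrapower U := fun k =>
    NZ.ultrapowerMap K.qnorm q hq U (NZ.ultraMk U ⟨_, hb k⟩)
  have hed : Pairwise fun k l => K.UltraDisj U (e k) (e l) := fun k l hkl => by
    refine UltraDisj.of_disj K U fun i => ?_
    refine diagonal_rel (R := fun a b => K.Disj (q a) (q b)) z' hd' (fun b => ?_) (fun b => ?_)
      hkl i
    · rw [map_zero]
      exact K.disj_zero_left _
    · rw [map_zero]
      exact K.disj_zero_right _
  let E : ι → Submodule 𝕜 Z := fun i => Submodule.span 𝕜 (Set.range (z' (r i)))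
  have hE : ∀ i, ∀ a ∈ E i, NZ a ≤ |C| * K.qnorm (q a) := fun i => hz' (r i)
  obtain ⟨C', hC'⟩ := QuasiNorm.exists_bddBelow_ultraproduct hq U (abs_nonneg C) hE
  obtain ⟨l, hl⟩ := QuasiNorm.exists_rightInverse_of_bddBelow _ _ hC'
  -- The inverse `l` lives on the image of the ultraproduct. That image absorbs the closed span
  -- because `r` tends to infinity along `U`.
  have hle : (K.qnorm.ultrapower U).closedSpan (Set.range e) ≤
      (NZ.ultraproduct U E).map (NZ.ultrapowerMap K.qnorm q hq U) := by
    refine QuasiNorm.closedSpan_le_map_ultraproduct hq U hr (abs_nonneg C) hE ?_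
    rintro _ ⟨k, rfl⟩
    exact ⟨_, ⟨⟨_, hb k⟩, fun i => diagonal_mem z' k i, rfl⟩, rfl⟩
  refine ⟨e, hed, ?_, l ∘ₗ Submodule.inclusion hle, C', fun a => (hl _).2⟩
  refine QuasiNorm.not_finiteDimensional_closedSpan _ fun n => ?_
  exact UltraDisj.linearIndependent K U (fun k : Fin n => e k)
    (fun k l hkl => hed fun h => hkl (Fin.ext h))
    fun k => K.diagonal_ultra_ne_zero hr hq hc1 k (hb k)

/-- Countable incompleteness enters only as a function `r` tending to infinity along `U`. A
nonprincipal ultrafilter on `ℕ` suffices; `ULift` moves it to the universe of the index sets. -/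
theorem exists_ultrafilter_tendsto_atTop :
    ∃ (U : Ultrafilter (ULift.{y} ℕ)) (r : ULift.{y} ℕ → ℕ), Tendsto r U atTop :=
  ⟨(hyperfilter ℕ).map ULift.up, ULift.down, by
    rw [Ultrafilter.coe_map, tendsto_map'_iff]
    exact Nat.hyperfilter_le_atTop⟩

/-- All ultrapowers of an exact sequence are disjointly singular if and only if there are no
uniformly bounded liftings on spans of disjoint vectors. -/
theorem ultrapowerDisjointlySingular_iff {Y : Type x} [AddCommGroup Y] [Module 𝕜 Y]
    {NY : QuasiNorm 𝕜 Y} {j : Y →ₗ[𝕜] Z} (h : IsExactSeq NY NZ K.qnorm j q) :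
    (∀ (ι : Type y) (U : Ultrafilter ι),
      K.UltrapowerDisjointlySingular NY NZ j h.incl_bounded q h.quot_bounded U) ↔
      ¬ ∃ C, ∀ n, K.HasDisjointLifting NZ q n C := by
  constructor
  · rintro hds ⟨C, hC⟩
    obtain ⟨U, r, hr⟩ := exists_ultrafilter_tendsto_atTop.{y}
    obtain ⟨ω, hω⟩ := (h.ultrapower U).exists_isAssociated
    obtain ⟨e, hed, hinf, l, C', hl⟩ := K.exists_lifting_closedSpan h.quot_bounded hC U hr
    exact hds _ U ω hω e hed hinf ((hω.isTrivialOn_iff _).2 ⟨l, C', hl⟩)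
  · intro hno ι U ω hω e hed hinf htriv
    obtain ⟨l, C, hl⟩ := (hω.isTrivialOn_iff _).1 htriv
    -- The constant is fixed before `n`: the same bounded lifting on the closed span is tested on
    -- more and more nonzero terms of the sequence.
    obtain ⟨C', hC'⟩ := HasDisjointLifting.of_ultrapower.{u, v, w, y} K h.exists_lift
      h.quot_bounded C
    refine hno ⟨C', fun n => ?_⟩
    obtain ⟨g, hg, hg0⟩ := (K.qnorm.ultrapower U).exists_embedding_ne_zero e hinf n
    let e' : ℕ → (K.qnorm.ultrapower U).closedSpan (Set.range e) := fun k =>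
      ⟨e k, QuasiNorm.span_le_closedSpan _ _ (Submodule.subset_span ⟨k, rfl⟩)⟩
    have hle : ∀ k, NZ.ultrapowerMap K.qnorm q h.quot_bounded U (l (e' k)) = e k :=
      fun k => (hl _).1
    refine hC' U (fun k => l (e' (g k))) (fun k => ?_) (fun k k' hkk => ?_) fun c => ?_
    · rw [hle]
      exact hg0 k
    · beta_reduce
      rw [hle, hle]
      exact hed fun h => hkk (hg h)
    · have e1 : ∑ k, c k • l (e' (g k)) = l (∑ k, c k • e' (g k)) := by
        rw [map_sum]
        simp only [map_smul]
      rw [e1, (hl _).1]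
      exact (hl _).2

/-! ### The modulus -/

section Modulus

variable {W : Type x} [AddCommGroup W] [Module 𝕜 W] {size : W → ℝ≥0∞} {Ω : K.carrier → W}
  {π : Z →ₗ[𝕜] W}

/-- If `l` inverts `q` on the lifted span, then `π ∘ l` is a linear map whose distance from `Ω` is
at most the norm of `l`. Here `π` plays the role of the first coordinate, so that twisted sums and
`d_Ω K` are treated together. -/
theorem HasDisjointLifting.modulus_le
    (hsmall : ∀ z, size (Ω (q z) - π z) ≤ ENNReal.ofReal (NZ z)) {n : ℕ} {C : ℝ}
    (h : K.HasDisjointLifting NZ q n C) : K.modulus size Ω n ≤ ENNReal.ofReal |C| := by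
  obtain ⟨z, h0, hd, hC⟩ := h
  refine iInf₂_le_of_le (fun k => q (z k)) h0 (iInf_le_of_le hd ?_)
  obtain ⟨l, hl⟩ := QuasiNorm.exists_rightInverse_of_bddBelow (NZ := NZ) (NX := K.qnorm) q
    (Submodule.span 𝕜 (Set.range z)) (C := C) (by
      intro a ha
      obtain ⟨c, rfl⟩ := (Submodule.mem_span_range_iff_exists_fun 𝕜).1 ha
      exact hC c)
  have hle : Submodule.span 𝕜 (Set.range fun k => q (z k)) ≤
      (Submodule.span 𝕜 (Set.range z)).map q := by
    rw [Submodule.map_span, ← Set.range_comp]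
    rfl
  refine iInf_le_of_le (π ∘ₗ l ∘ₗ Submodule.inclusion hle) (iSup₂_le fun a ha => ?_)
  obtain ⟨-, h1, h2⟩ := hl (Submodule.inclusion hle a)
  have h3 := hsmall (l (Submodule.inclusion hle a))
  rw [h1] at h3
  refine h3.trans (ENNReal.ofReal_le_ofReal (h2.trans ?_))
  change C * K.qnorm a ≤ _
  have h4 := mul_le_mul_of_nonneg_right (le_abs_self C) (K.qnorm.nonneg' a)
  have h5 := mul_le_of_le_one_right (abs_nonneg C) ha
  exact h4.trans h5

theorem HasDisjointLifting.of_modulus_lt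
    (hsmul : ∀ (c : 𝕜) w, size (c • w) = ENNReal.ofReal ‖c‖ * size w)
    (hΩ : ∀ (c : 𝕜) a, Ω (c • a) = c • Ω a)
    (hlift : ∀ a w (t : ℝ), 0 ≤ t → size (Ω a - w) ≤ ENNReal.ofReal t →
      ∃ z, q z = a ∧ π z = w ∧ NZ z ≤ t + K.qnorm a)
    (hinj : ∀ z, q z = 0 → π z = 0 → z = 0) {n : ℕ} {C : ℝ} (hC : 0 ≤ C)
    (h : K.modulus size Ω n < ENNReal.ofReal C) : K.HasDisjointLifting NZ q n (C + 1) := by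
  obtain ⟨e, h⟩ := iInf_lt_iff.1 h
  obtain ⟨h0, h⟩ := iInf_lt_iff.1 h
  obtain ⟨hd, h⟩ := iInf_lt_iff.1 h
  obtain ⟨L, h⟩ := iInf_lt_iff.1 h
  have hsize0 : size 0 = 0 := by simpa using hsmul 0 0
  have hΩ0 : Ω 0 = 0 := by simpa using hΩ 0 0
  -- Homogeneity of `Ω` and `size` turns the supremum over the unit ball into a bound proportional
  -- to the quasi-norm.
  have hL : ∀ a : Submodule.span 𝕜 (Set.range e),
      size (Ω a - L a) ≤ ENNReal.ofReal (C * K.qnorm a) := by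
    intro a
    rcases eq_or_ne a 0 with rfl | ha
    · rw [map_zero, sub_zero, Submodule.coe_zero, hΩ0, hsize0]
      exact zero_le
    have hp : 0 < K.qnorm a := K.qnorm.pos_of_ne_zero fun h => ha (Subtype.ext h)
    have hne : ((K.qnorm a : ℝ) : 𝕜) ≠ 0 := RCLike.ofReal_ne_zero.2 hp.ne'
    have hnorm : ‖((K.qnorm a : ℝ) : 𝕜)‖ = K.qnorm a := by
      rw [RCLike.norm_ofReal, abs_of_pos hp]
    have h1 : size (Ω (((K.qnorm a : ℝ) : 𝕜)⁻¹ • a : Submodule.span 𝕜 (Set.range e)) -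
        L (((K.qnorm a : ℝ) : 𝕜)⁻¹ • a)) ≤ ENNReal.ofReal C := by
      refine le_trans ?_ h.le
      refine le_iSup₂ (f := fun (a : Submodule.span 𝕜 (Set.range e))
        (_ : K.qnorm (a : K.carrier) ≤ 1) => size (Ω a - L a)) _ ?_
      rw [Submodule.coe_smul, K.qnorm.smul', norm_inv, hnorm, inv_mul_cancel₀ hp.ne']
    rw [Submodule.coe_smul, hΩ, map_smul, ← smul_sub] at h1
    calc size (Ω a - L a) = size (((K.qnorm a : ℝ) : 𝕜) • ((K.qnorm a : ℝ) : 𝕜)⁻¹ •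
          (Ω a - L a)) := by rw [smul_inv_smul₀ hne]
      _ = ENNReal.ofReal (K.qnorm a) * size (((K.qnorm a : ℝ) : 𝕜)⁻¹ • (Ω a - L a)) := by
        rw [hsmul, hnorm]
      _ ≤ ENNReal.ofReal (K.qnorm a) * ENNReal.ofReal C := mul_le_mul_right h1 _
      _ = _ := by rw [mul_comm, ENNReal.ofReal_mul hC]
  have hlift' : ∀ a : Submodule.span 𝕜 (Set.range e), ∃ z, q z = a ∧ π z = L a ∧
      NZ z ≤ C * K.qnorm a + K.qnorm a := fun a =>
    hlift a (L a) _ (mul_nonneg hC (K.qnorm.nonneg' _)) (hL a)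
  let e' : Fin n → Submodule.span 𝕜 (Set.range e) := fun k =>
    ⟨e k, Submodule.subset_span ⟨k, rfl⟩⟩
  choose z hz hzπ hzC using hlift'
  refine ⟨fun k => z (e' k), fun k => ?_, fun k l hkl => ?_, fun c => ?_⟩
  · rw [hz]
    exact h0 k
  · beta_reduce
    rw [hz, hz]
    exact hd hkl
  · have hq : q (∑ k, c k • z (e' k)) = (∑ k, c k • e' k : Submodule.span 𝕜 (Set.range e)) := by
      rw [map_sum, Submodule.coe_sum]
      exact Finset.sum_congr rfl fun k _ => by rw [map_smul, hz, Submodule.coe_smul]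
    have hπ : π (∑ k, c k • z (e' k)) = L (∑ k, c k • e' k) := by
      rw [map_sum, map_sum]
      exact Finset.sum_congr rfl fun k _ => by rw [map_smul, hzπ, map_smul]
    -- The lifts are chosen without linearity. By `hinj` a vector is determined by its images under
    -- `q` and `π`, both linear in `a` on the chosen lifts, so the choice is automatically linear.
    have heq : ∑ k, c k • z (e' k) = z (∑ k, c k • e' k) := by
      rw [← sub_eq_zero]
      refine hinj _ ?_ ?_
      · rw [map_sub, hq, hz, sub_self]
      · rw [map_sub, hπ, hzπ, sub_self]
    rw [hq, heq, add_mul, one_mul]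
    exact hzC _

/-- The modulus tends to infinity if and only if there are no uniformly bounded liftings on spans
of disjoint vectors. -/
theorem tendsto_modulus_iff (hsmul : ∀ (c : 𝕜) w, size (c • w) = ENNReal.ofReal ‖c‖ * size w)
    (hΩ : ∀ (c : 𝕜) a, Ω (c • a) = c • Ω a)
    (hsmall : ∀ z, size (Ω (q z) - π z) ≤ ENNReal.ofReal (NZ z))
    (hlift : ∀ a w (t : ℝ), 0 ≤ t → size (Ω a - w) ≤ ENNReal.ofReal t →
      ∃ z, q z = a ∧ π z = w ∧ NZ z ≤ t + K.qnorm a)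
    (hinj : ∀ z, q z = 0 → π z = 0 → z = 0) :
    Tendsto (K.modulus size Ω) atTop (𝓝 ⊤) ↔ ¬ ∃ C, ∀ n, K.HasDisjointLifting NZ q n C := by
  constructor
  · rintro h ⟨C, hC⟩
    obtain ⟨n, hn⟩ := (h.eventually (lt_mem_nhds
      (ENNReal.ofReal_lt_top : ENNReal.ofReal |C| < ⊤))).exists
    exact absurd (HasDisjointLifting.modulus_le K hsmall (hC n)) (not_le.2 hn)
  · intro hno
    by_contra hnt
    rw [ENNReal.tendsto_nhds_top_iff_nat, not_forall] at hnt
    obtain ⟨M, hM⟩ := hnt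
    -- The modulus is at most `M` only for arbitrarily large `m`; every `n` is then reached by
    -- discarding vectors from such a system.
    rw [not_eventually, frequently_atTop] at hM
    refine hno ⟨(M + 1 : ℝ) + 1, fun n => ?_⟩
    obtain ⟨m, hnm, hm⟩ := hM n
    refine HasDisjointLifting.mono K hnm (HasDisjointLifting.of_modulus_lt K hsmul hΩ hlift hinj
      (by positivity) ((not_lt.1 hm).trans_lt ?_))
    have : ((M : ℝ≥0∞)) = ENNReal.ofReal (M : ℝ) := (ENNReal.ofReal_natCast M).symm
    rw [this]
    exact (ENNReal.ofReal_lt_ofReal_iff (by positivity)).2 (by linarith)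

end Modulus

/-! ### The sequence defined by a quasi-linear map -/

theorem isExactSeq_twisted {Y : Type x} [AddCommGroup Y] [Module 𝕜 Y] (NY : QuasiNorm 𝕜 Y)
    (Ω : K.carrier → Y) (hΩ : IsQuasiLinear K.qnorm NY Ω) :
    IsExactSeq NY (twistedQuasiNorm K.qnorm NY Ω hΩ) K.qnorm (LinearMap.inl 𝕜 Y K.carrier)
      (LinearMap.snd 𝕜 Y K.carrier) where
  incl_bounded := K.inl_isBoundedMap NY Ω hΩ
  quot_bounded := K.snd_isBoundedMap NY Ω hΩ
  incl_bddBelow := by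
    have hz : Ω 0 = 0 := by simpa using hΩ.1 0 0
    refine ⟨1, zero_le_one, fun y => ?_⟩
    change NY y ≤ 1 * (NY (y - Ω 0) + K.qnorm 0)
    rw [hz, sub_zero, K.qnorm.map_zero, add_zero, one_mul]
  quot_incl := fun _ => rfl
  exists_incl := fun z hz => ⟨z.1, Prod.ext rfl hz.symm⟩
  exists_lift := ⟨1, zero_le_one, fun a => ⟨(Ω a, a), rfl, by
    change NY (Ω a - Ω a) + K.qnorm a ≤ 1 * K.qnorm a
    rw [sub_self, NY.map_zero, zero_add, one_mul]⟩⟩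

theorem tendsto_modulus_quasiLinear_iff {Y : Type x} [AddCommGroup Y] [Module 𝕜 Y]
    (NY : QuasiNorm 𝕜 Y) (Ω : K.carrier → Y) (hΩ : IsQuasiLinear K.qnorm NY Ω) :
    Tendsto (K.modulus (fun b => ENNReal.ofReal (NY b)) Ω) atTop (𝓝 ⊤) ↔
      ¬ ∃ C, ∀ n, K.HasDisjointLifting (twistedQuasiNorm K.qnorm NY Ω hΩ)
        (LinearMap.snd 𝕜 Y K.carrier) n C := by
  refine K.tendsto_modulus_iff (π := LinearMap.fst 𝕜 Y K.carrier) (fun c w => ?_) hΩ.1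
    (fun z => ?_) (fun a w t ht h => ⟨(w, a), rfl, rfl, ?_⟩) fun z h1 h2 => Prod.ext h2 h1
  · rw [NY.smul', ENNReal.ofReal_mul (norm_nonneg c)]
  · refine ENNReal.ofReal_le_ofReal ?_
    change NY (Ω z.2 - z.1) ≤ NY (z.1 - Ω z.2) + K.qnorm z.2
    rw [NY.map_sub_rev]
    linarith [K.qnorm.nonneg' z.2]
  · rw [ENNReal.ofReal_le_ofReal_iff ht] at h
    change NY (w - Ω a) + K.qnorm a ≤ _
    rw [NY.map_sub_rev]
    linarith

end KotheSpace

theorem L0.mul_sub {𝕜 : Type u} [RCLike 𝕜] {S : Type v} [MeasurableSpace S] {μ : Measure S}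
    (f g h : L0 𝕜 μ) : f * (g - h) = f * g - f * h := by
  refine ext ?_
  filter_upwards [coeFn_mul f (g - h), coeFn_sub g h, coeFn_mul f g, coeFn_mul f h,
    coeFn_sub (f * g) (f * h)] with t h1 h2 h3 h4 h5
  rw [h1, h5, h2, h3, h4, _root_.mul_sub]

namespace KotheSpace

variable {𝕜 : Type u} [RCLike 𝕜] {S : Type v} [MeasurableSpace S] {μ : Measure S}
  (K : KotheSpace 𝕜 μ) (Ω : K.carrier → L0 𝕜 μ) (hΩ : K.IsCentralizer Ω)

/-! ### The sequence defined by a centralizer -/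

theorem extNorm_of_mem {f : L0 𝕜 μ} (hf : f ∈ K.carrier) :
    K.extNorm f = ENNReal.ofReal (K.qnorm ⟨f, hf⟩) := by
  rw [extNorm, dif_pos hf]

theorem extNorm_smul (c : 𝕜) (f : L0 𝕜 μ) :
    K.extNorm (c • f) = ENNReal.ofReal ‖c‖ * K.extNorm f := by
  rcases eq_or_ne c 0 with rfl | hc
  · rw [zero_smul, K.extNorm_of_mem K.carrier.zero_mem, norm_zero, ENNReal.ofReal_zero, zero_mul]
    have : K.qnorm ⟨0, K.carrier.zero_mem⟩ = 0 := K.qnorm.map_zero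
    rw [this, ENNReal.ofReal_zero]
  by_cases hf : f ∈ K.carrier
  · rw [K.extNorm_of_mem hf, K.extNorm_of_mem (K.carrier.smul_mem c hf),
      ← ENNReal.ofReal_mul (norm_nonneg c), ← K.qnorm.smul']
    rfl
  · have hcf : c • f ∉ K.carrier := fun h => hf ((K.carrier.smul_mem_iff hc).1 h)
    rw [extNorm, extNorm, dif_neg hf, dif_neg hcf, ENNReal.mul_top]
    rw [Ne, ENNReal.ofReal_eq_zero, not_le]
    exact norm_pos_iff.2 hc

variable {Ω}

theorem defect_mk_self (a : K.carrier) (h : (Ω a, a) ∈ K.derived Ω hΩ) :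
    K.defect Ω hΩ ⟨(Ω a, a), h⟩ = 0 := Subtype.ext (sub_self (Ω a))

theorem isExactSeq_derived : IsExactSeq K.qnorm (K.derivedQuasiNorm Ω hΩ) K.qnorm
    (K.derivedIncl Ω hΩ) (K.derivedQuot Ω hΩ) where
  incl_bounded := K.derivedIncl_isBoundedMap Ω hΩ
  quot_bounded := K.derivedQuot_isBoundedMap Ω hΩ
  incl_bddBelow := by
    refine ⟨1, zero_le_one, fun a => ?_⟩
    have h : K.defect Ω hΩ (K.derivedIncl Ω hΩ a) = a := by
      refine Subtype.ext ?_
      change (a : L0 𝕜 μ) - Ω 0 = a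
      rw [hΩ.map_zero, sub_zero]
    change K.qnorm a ≤ 1 * (K.qnorm 0 + K.qnorm (K.defect Ω hΩ (K.derivedIncl Ω hΩ a)))
    rw [h, K.qnorm.map_zero, one_mul, zero_add]
  quot_incl := fun _ => rfl
  exists_incl := by
    rintro ⟨⟨f, a⟩, hz⟩ h
    have ha : a = 0 := h
    subst ha
    have hf : f - Ω 0 ∈ K.carrier := hz
    rw [hΩ.map_zero, sub_zero] at hf
    exact ⟨⟨f, hf⟩, rfl⟩
  exists_lift := by
    refine ⟨1, zero_le_one, fun a => ?_⟩
    have h : (Ω a, a) ∈ K.derived Ω hΩ := by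
      change Ω a - Ω a ∈ K.carrier
      rw [sub_self]
      exact K.carrier.zero_mem
    refine ⟨⟨(Ω a, a), h⟩, rfl, ?_⟩
    change K.qnorm a + K.qnorm (K.defect Ω hΩ ⟨(Ω a, a), h⟩) ≤ 1 * K.qnorm a
    rw [K.defect_mk_self, K.qnorm.map_zero, add_zero, one_mul]

/-- The map `(w, a) ↦ w` from `d_Ω K` to `L₀`. -/
noncomputable def derivedFst : K.derived Ω hΩ →ₗ[𝕜] L0 𝕜 μ :=
  LinearMap.fst 𝕜 (L0 𝕜 μ) K.carrier ∘ₗ (K.derived Ω hΩ).subtype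

theorem coe_defect (z : K.derived Ω hΩ) : (K.defect Ω hΩ z : L0 𝕜 μ) =
    K.derivedFst hΩ z - Ω (K.derivedQuot Ω hΩ z) := rfl

theorem derivedQuasiNorm_apply (z : K.derived Ω hΩ) : K.derivedQuasiNorm Ω hΩ z =
    K.qnorm (K.derivedQuot Ω hΩ z) + K.qnorm (K.defect Ω hΩ z) := rfl

theorem tendsto_modulus_centralizer_iff :
    Tendsto (K.modulus K.extNorm Ω) atTop (𝓝 ⊤) ↔
      ¬ ∃ C, ∀ n, K.HasDisjointLifting (K.derivedQuasiNorm Ω hΩ) (K.derivedQuot Ω hΩ) n C := by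
  refine K.tendsto_modulus_iff (π := K.derivedFst hΩ) K.extNorm_smul hΩ.1 (fun z => ?_)
    (fun a f t ht h => ?_) fun z h1 h2 => Subtype.ext (Prod.ext h2 h1)
  · have e : Ω (K.derivedQuot Ω hΩ z) - K.derivedFst hΩ z = ((-K.defect Ω hΩ z : K.carrier) :
        L0 𝕜 μ) := by
      rw [Submodule.coe_neg, coe_defect, neg_sub]
    rw [e, K.extNorm_of_mem (Subtype.prop _)]
    refine ENNReal.ofReal_le_ofReal ?_
    change K.qnorm (-K.defect Ω hΩ z) ≤ _
    rw [K.qnorm.map_neg, derivedQuasiNorm_apply]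
    linarith [K.qnorm.nonneg' (K.derivedQuot Ω hΩ z)]
  -- A finite value of `extNorm` forces the difference into `K`, which is the condition for `(f, a)`
  -- to belong to `d_Ω K`. Linear maps into `L₀` therefore do give liftings into `d_Ω K`.
  · have hmem : Ω a - f ∈ K.carrier := by
      by_contra hn
      rw [extNorm, dif_neg hn] at h
      exact absurd h (not_le.2 ENNReal.ofReal_lt_top)
    rw [K.extNorm_of_mem hmem, ENNReal.ofReal_le_ofReal_iff ht] at h
    have hmem' : f - Ω a ∈ K.carrier := by
      rw [← neg_sub]
      exact K.carrier.neg_mem hmem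
    refine ⟨⟨(f, a), hmem'⟩, rfl, rfl, ?_⟩
    change K.qnorm a + K.qnorm ⟨f - Ω a, hmem'⟩ ≤ _
    have e : (⟨f - Ω a, hmem'⟩ : K.carrier) = -⟨Ω a - f, hmem⟩ := Subtype.ext (neg_sub _ _).symm
    rw [e, K.qnorm.map_neg]
    linarith

/-! ### The module structure of `d_Ω K` over `L_∞` -/

/-- The product is `f (w, a) = (f w, f a)`. Its defect is `f (w - Ω a)` minus `Ω (f a) - f Ω a`, and
the last term is what the centralizer inequality bounds. -/
theorem exists_derived_mul : ∃ B : ℝ, 0 ≤ B ∧ ∀ (f : L0 𝕜 μ), (∀ᵐ t ∂μ, ‖f t‖ ≤ 1) →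
    ∀ z : K.derived Ω hΩ, ∃ z' : K.derived Ω hΩ,
      K.derivedFst hΩ z' = f * K.derivedFst hΩ z ∧
      (K.derivedQuot Ω hΩ z' : L0 𝕜 μ) = f * (K.derivedQuot Ω hΩ z : L0 𝕜 μ) ∧
      K.derivedQuasiNorm Ω hΩ z' ≤ B * K.derivedQuasiNorm Ω hΩ z := by
  obtain ⟨C, hC⟩ := hΩ.2
  obtain ⟨D, hD1, hD⟩ := K.qnorm.exists_add_le
  have hC0 := abs_nonneg C
  refine ⟨1 + D + D * |C|, by positivity, fun f hf z => ?_⟩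
  obtain ⟨hb, hbM⟩ := K.exists_mul_mem zero_le_one hf (K.derivedQuot Ω hΩ z)
  obtain ⟨hd, hdM⟩ := K.exists_mul_mem zero_le_one hf (K.defect Ω hΩ z)
  obtain ⟨hc, hcM⟩ := hC f 1 hf (K.derivedQuot Ω hΩ z) ⟨_, hb⟩ rfl
  have e : f * K.derivedFst hΩ z - Ω ⟨_, hb⟩ = f * (K.defect Ω hΩ z : L0 𝕜 μ) -
      (Ω ⟨_, hb⟩ - f * Ω (K.derivedQuot Ω hΩ z)) := by
    rw [coe_defect, L0.mul_sub]
    abel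
  have hmem : f * K.derivedFst hΩ z - Ω ⟨_, hb⟩ ∈ K.carrier := by
    rw [e]
    exact K.carrier.sub_mem hd hc
  refine ⟨⟨(f * K.derivedFst hΩ z, ⟨_, hb⟩), hmem⟩, rfl, rfl, ?_⟩
  change K.qnorm ⟨_, hb⟩ + K.qnorm ⟨_, hmem⟩ ≤ _
  have e' : (⟨_, hmem⟩ : K.carrier) = ⟨_, hd⟩ + -⟨_, hc⟩ := Subtype.ext
    (e.trans (sub_eq_add_neg _ _))
  have h1 := hD ⟨_, hd⟩ (-⟨_, hc⟩)
  rw [← e', K.qnorm.map_neg] at h1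
  rw [derivedQuasiNorm_apply]
  have p1 := K.qnorm.nonneg' (K.derivedQuot Ω hΩ z)
  have p2 := K.qnorm.nonneg' (K.defect Ω hΩ z)
  have h2 : K.qnorm ⟨_, hc⟩ ≤ |C| * K.qnorm (K.derivedQuot Ω hΩ z) := by
    rw [mul_one] at hcM
    exact hcM.trans (mul_le_mul_of_nonneg_right (le_abs_self C) p1)
  rw [one_mul] at hbM hdM
  have h3 := h1.trans (mul_le_mul_of_nonneg_left (add_le_add hdM h2) (by linarith))
  have q1 : 0 ≤ D * K.qnorm (K.derivedQuot Ω hΩ z) := by positivity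
  have q2 : 0 ≤ D * |C| * K.qnorm (K.defect Ω hΩ z) := by positivity
  nlinarith

/-! ### Disjointness in `d_Ω K` -/

theorem derivedDisj_iff {z z' : K.derived Ω hΩ} : K.DerivedDisj Ω hΩ z z' ↔ ∀ᵐ t ∂μ,
    (K.derivedFst hΩ z t = 0 ∧ (K.derivedQuot Ω hΩ z : L0 𝕜 μ) t = 0) ∨
    (K.derivedFst hΩ z' t = 0 ∧ (K.derivedQuot Ω hΩ z' : L0 𝕜 μ) t = 0) := Iff.rfl

variable {K hΩ}

theorem DerivedDisj.symm {z z' : K.derived Ω hΩ} (h : K.DerivedDisj Ω hΩ z z') :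
    K.DerivedDisj Ω hΩ z' z := by
  filter_upwards [h] with t ht using ht.symm

theorem DerivedDisj.quot {z z' : K.derived Ω hΩ} (h : K.DerivedDisj Ω hΩ z z') :
    K.Disj (K.derivedQuot Ω hΩ z) (K.derivedQuot Ω hΩ z') := by
  filter_upwards [h] with t ht using ht.imp And.right And.right

theorem derivedDisj_zero_right (z : K.derived Ω hΩ) : K.DerivedDisj Ω hΩ z 0 := by
  rw [derivedDisj_iff]
  filter_upwards [L0.coeFn_zero (𝕜 := 𝕜) (μ := μ)] with t ht
  rw [map_zero, map_zero, Submodule.coe_zero]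
  exact Or.inr ⟨ht, ht⟩

theorem DerivedDisj.add_right {z a b : K.derived Ω hΩ} (ha : K.DerivedDisj Ω hΩ z a)
    (hb : K.DerivedDisj Ω hΩ z b) : K.DerivedDisj Ω hΩ z (a + b) := by
  rw [derivedDisj_iff] at ha hb ⊢
  filter_upwards [ha, hb, L0.coeFn_add (K.derivedFst hΩ a) (K.derivedFst hΩ b),
    L0.coeFn_add (K.derivedQuot Ω hΩ a : L0 𝕜 μ) (K.derivedQuot Ω hΩ b)] with t h1 h2 h3 h4
  rw [map_add, map_add, Submodule.coe_add, h3, h4]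
  rcases h1 with h1 | h1
  · exact Or.inl h1
  rcases h2 with h2 | h2
  · exact Or.inl h2
  rw [h1.1, h1.2, h2.1, h2.2, add_zero]
  exact Or.inr ⟨rfl, rfl⟩

theorem DerivedDisj.smul_right {z a : K.derived Ω hΩ} (c : 𝕜) (ha : K.DerivedDisj Ω hΩ z a) :
    K.DerivedDisj Ω hΩ z (c • a) := by
  rw [derivedDisj_iff] at ha ⊢
  filter_upwards [ha, L0.coeFn_smul c (K.derivedFst hΩ a),
    L0.coeFn_smul c (K.derivedQuot Ω hΩ a : L0 𝕜 μ)] with t h1 h3 h4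
  rw [map_smul, map_smul, Submodule.coe_smul, h3, h4]
  refine h1.imp_right fun h1 => ?_
  rw [h1.1, h1.2, mul_zero]
  exact ⟨rfl, rfl⟩

theorem DerivedDisj.span_right {z a : K.derived Ω hΩ} {s : Set (K.derived Ω hΩ)}
    (h : ∀ b ∈ s, K.DerivedDisj Ω hΩ z b) (ha : a ∈ Submodule.span 𝕜 s) :
    K.DerivedDisj Ω hΩ z a := by
  induction ha using Submodule.span_induction with
  | mem b hb => exact h b hb
  | zero => exact derivedDisj_zero_right z
  | add b b' _ _ hb hb' => exact hb.add_right hb'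
  | smul c b _ hb => exact hb.smul_right c

theorem DerivedDisj.span {a b : K.derived Ω hΩ} {s t : Set (K.derived Ω hΩ)}
    (h : ∀ a ∈ s, ∀ b ∈ t, K.DerivedDisj Ω hΩ a b) (ha : a ∈ Submodule.span 𝕜 s)
    (hb : b ∈ Submodule.span 𝕜 t) : K.DerivedDisj Ω hΩ a b :=
  span_right (fun b' hb' => (span_right (fun a' ha' => (h a' ha' b' hb').symm) ha).symm) hb

variable (K) (hΩ)

/-- Multiplying `a + b` by the characteristic function of the support of `a` recovers `a`, so
disjoint vectors of `d_Ω K` are unconditional with the constant of the module structure. -/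
theorem exists_derived_le_add : ∃ B : ℝ, 0 ≤ B ∧ ∀ a b : K.derived Ω hΩ,
    K.DerivedDisj Ω hΩ a b →
      K.derivedQuasiNorm Ω hΩ a ≤ B * K.derivedQuasiNorm Ω hΩ (a + b) := by
  obtain ⟨B, hB0, hB⟩ := K.exists_derived_mul hΩ
  refine ⟨B, hB0, fun a b hab => ?_⟩
  let A : Set S := {t | K.derivedFst hΩ a t = 0 ∧ (K.derivedQuot Ω hΩ a : L0 𝕜 μ) t = 0}ᶜ
  have hA : MeasurableSet A :=
    ((measurableSet_eq_fun (L0.measurable _) measurable_const).inter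
      (measurableSet_eq_fun (L0.measurable _) measurable_const)).compl
  obtain ⟨z, hz1, hz2, hz⟩ := hB (L0.ind 𝕜 μ A hA) (L0.norm_ind_le A hA) (a + b)
  have hza : z = a := by
    refine Subtype.ext (Prod.ext ?_ (Subtype.ext ?_))
    · refine hz1.trans (L0.ext ?_)
      filter_upwards [hab, L0.coeFn_ind (𝕜 := 𝕜) (μ := μ) A hA,
        L0.coeFn_mul (L0.ind 𝕜 μ A hA) (K.derivedFst hΩ (a + b)),
        L0.coeFn_add (K.derivedFst hΩ a) (K.derivedFst hΩ b)] with t h1 h2 h3 h4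
      change _ = K.derivedFst hΩ a t
      rw [h3, h2, map_add, h4]
      by_cases ht : t ∈ A
      · have h5 := h1.resolve_left ht
        have h6 : K.derivedFst hΩ b t = 0 := h5.1
        rw [Set.indicator_of_mem ht, one_mul, h6, add_zero]
      · rw [Set.indicator_of_notMem ht, zero_mul]
        exact (not_not.1 ht).1.symm
    · refine hz2.trans (L0.ext ?_)
      filter_upwards [hab, L0.coeFn_ind (𝕜 := 𝕜) (μ := μ) A hA,
        L0.coeFn_mul (L0.ind 𝕜 μ A hA) (K.derivedQuot Ω hΩ (a + b) : L0 𝕜 μ),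
        L0.coeFn_add (K.derivedQuot Ω hΩ a : L0 𝕜 μ) (K.derivedQuot Ω hΩ b)] with t h1 h2 h3 h4
      change _ = (K.derivedQuot Ω hΩ a : L0 𝕜 μ) t
      rw [h3, h2, map_add, Submodule.coe_add, h4]
      by_cases ht : t ∈ A
      · have h5 := h1.resolve_left ht
        have h6 : (K.derivedQuot Ω hΩ b : L0 𝕜 μ) t = 0 := h5.2
        rw [Set.indicator_of_mem ht, one_mul, h6, add_zero]
      · rw [Set.indicator_of_notMem ht, zero_mul]
        exact (not_not.1 ht).2.symm
  rwa [hza] at hz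

/-! ### Super disjoint singularity of the quotient map -/

theorem UltraDerivedDisj.quot {ι : Type y} {U : Ultrafilter ι}
    {ζ ζ' : (K.derivedQuasiNorm Ω hΩ).Ultrapower U} (h : K.UltraDerivedDisj Ω hΩ U ζ ζ') :
    K.UltraDisj U
      ((K.derivedQuasiNorm Ω hΩ).ultrapowerMap K.qnorm (K.derivedQuot Ω hΩ)
        (K.derivedQuot_isBoundedMap Ω hΩ) U ζ)
      ((K.derivedQuasiNorm Ω hΩ).ultrapowerMap K.qnorm (K.derivedQuot Ω hΩ)
        (K.derivedQuot_isBoundedMap Ω hΩ) U ζ') := by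
  obtain ⟨z, z', rfl, rfl, h⟩ := h
  exact UltraDisj.of_disj K U fun i => (h i).quot

/-- On a disjoint closed span where the quotient is bounded below by `c`, its inverse is a lifting
of norm `c⁻¹`. Disjointness passes to the images, so the lifting descends to uniform
finite-dimensional ones. -/
theorem quotUltrapowerDisjointlySingular
    (h : ¬ ∃ C, ∀ n, K.HasDisjointLifting (K.derivedQuasiNorm Ω hΩ) (K.derivedQuot Ω hΩ) n C)
    {ι : Type y} (U : Ultrafilter ι) : K.QuotUltrapowerDisjointlySingular Ω hΩ U := by
  rintro e hed hinf ⟨c, hc, hce⟩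
  obtain ⟨C', hC'⟩ := HasDisjointLifting.of_ultrapower.{u, v, max u v, y} K
    (K.isExactSeq_derived hΩ).exists_lift (K.derivedQuot_isBoundedMap Ω hΩ) c⁻¹
  refine h ⟨C', fun n => ?_⟩
  obtain ⟨g, hg, hg0⟩ := ((K.derivedQuasiNorm Ω hΩ).ultrapower U).exists_embedding_ne_zero e hinf n
  have hmem : ∀ k, e k ∈ ((K.derivedQuasiNorm Ω hΩ).ultrapower U).closedSpan (Set.range e) :=
    fun k => QuasiNorm.span_le_closedSpan _ _ (Submodule.subset_span ⟨k, rfl⟩)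
  refine hC' U (fun k => e (g k)) (fun k h0 => ?_) (fun k l hkl => ?_) fun d => ?_
  · have h1 := hce _ (hmem (g k))
    rw [h0, QuasiNorm.map_zero] at h1
    have h2 := mul_pos hc (((K.derivedQuasiNorm Ω hΩ).ultrapower U).pos_of_ne_zero (hg0 k))
    linarith
  · exact UltraDerivedDisj.quot K hΩ (hed fun h => hkl (hg h))
  · rw [inv_mul_eq_div, le_div_iff₀' hc]
    exact hce _ (Submodule.sum_mem _ fun k _ => Submodule.smul_mem _ _ (hmem _))

/-- If some `z k` has zero image it already serves. Otherwise the images are disjoint and nonzero,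
and the failure of the lifting bound for this very system provides the combination. -/
theorem exists_block_vector {n : ℕ} {C : ℝ}
    (h : ¬ K.HasDisjointLifting (K.derivedQuasiNorm Ω hΩ) (K.derivedQuot Ω hΩ) n C)
    (hC : 0 ≤ C) (z : Fin n → K.derived Ω hΩ) (h0 : ∀ k, z k ≠ 0)
    (hd : Pairwise fun k l => K.DerivedDisj Ω hΩ (z k) (z l)) :
    ∃ f ∈ Submodule.span 𝕜 (Set.range z), f ≠ 0 ∧
      C * K.qnorm (K.derivedQuot Ω hΩ f) ≤ K.derivedQuasiNorm Ω hΩ f := by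
  by_cases hq : ∀ k, K.derivedQuot Ω hΩ (z k) ≠ 0
  · have h1 : ∃ c : Fin n → 𝕜, C * K.qnorm (K.derivedQuot Ω hΩ (∑ k, c k • z k)) <
        K.derivedQuasiNorm Ω hΩ (∑ k, c k • z k) := by
      by_contra! hcon
      exact h ⟨z, hq, fun k l hkl => (hd hkl).quot, hcon⟩
    obtain ⟨c, hc⟩ := h1
    refine ⟨_, Submodule.sum_mem _ fun k _ => Submodule.smul_mem _ _
      (Submodule.subset_span ⟨k, rfl⟩), fun h2 => ?_, hc.le⟩
    rw [h2, QuasiNorm.map_zero] at hc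
    have := mul_nonneg hC (K.qnorm.nonneg' (K.derivedQuot Ω hΩ 0))
    linarith
  · push Not at hq
    obtain ⟨k, hk⟩ := hq
    refine ⟨z k, Submodule.subset_span ⟨k, rfl⟩, h0 k, ?_⟩
    rw [hk, K.qnorm.map_zero, mul_zero]
    exact QuasiNorm.nonneg' _ _

/-- Liftings with a large constant fail for some `m`. Cutting `k * m` vectors into `k` blocks of
length `m` gives `k` disjoint vectors that the quotient map shrinks, and unconditionality extends
the smallness to their span. -/
theorem exists_disjoint_small
    (h : ¬ ∃ C, ∀ n, K.HasDisjointLifting (K.derivedQuasiNorm Ω hΩ) (K.derivedQuot Ω hΩ) n C)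
    (k : ℕ) : ∃ m : ℕ, ∀ n, m ≤ n → ∀ e : Fin n → K.derived Ω hΩ, (∀ i, e i ≠ 0) →
      (Pairwise fun i j => K.DerivedDisj Ω hΩ (e i) (e j)) →
      ∃ f : Fin k → K.derived Ω hΩ, (∀ i, f i ≠ 0) ∧
        (Pairwise fun i j => K.DerivedDisj Ω hΩ (f i) (f j)) ∧
        (∀ i, f i ∈ Submodule.span 𝕜 (Set.range e)) ∧
        ∀ z ∈ Submodule.span 𝕜 (Set.range f),
          K.qnorm (K.derivedQuot Ω hΩ z) ≤ 1 / (k + 1) * K.derivedQuasiNorm Ω hΩ z := by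
  classical
  obtain ⟨B, hB0, hB⟩ := K.exists_derived_le_add hΩ
  obtain ⟨D, hD1, hD⟩ := K.qnorm.exists_sum_le
  -- The loss in passing from single vectors to their span: `D ^ k` and `k` come from the
  -- quasi-triangle inequality for `k` terms, `B` from bounding each term by the sum. The block
  -- constant `(P + 1) * (k + 1)` absorbs it, with `P + 1` positive.
  let P : ℝ := D ^ k * (k * B)
  have hP : 0 ≤ P := by positivity
  have hC0 : 0 ≤ (P + 1) * (k + 1) := by positivity
  obtain ⟨m, hm⟩ : ∃ m, ¬ K.HasDisjointLifting (K.derivedQuasiNorm Ω hΩ) (K.derivedQuot Ω hΩ)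
      m ((P + 1) * (k + 1)) := by
    by_contra! hcon
    exact h ⟨_, hcon⟩
  refine ⟨k * m, fun n hn e he0 hed => ?_⟩
  let b : Fin k → Fin m → Fin n := fun j i => Fin.castLE hn (finProdFinEquiv (j, i))
  have hb : ∀ {j i j' i'}, b j i = b j' i' → (j, i) = (j', i') := fun h =>
    finProdFinEquiv.injective (Fin.castLE_injective hn h)
  have hblock : ∀ j, ∃ f ∈ Submodule.span 𝕜 (Set.range fun i => e (b j i)), f ≠ 0 ∧
      (P + 1) * (k + 1) * K.qnorm (K.derivedQuot Ω hΩ f) ≤ K.derivedQuasiNorm Ω hΩ f :=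
    fun j => K.exists_block_vector hΩ hm hC0 (fun i => e (b j i)) (fun i => he0 _)
      fun i i' hii => hed fun h => hii (congrArg Prod.snd (hb h))
  choose f hfs hf0 hfC using hblock
  have hfd : Pairwise fun i j => K.DerivedDisj Ω hΩ (f i) (f j) := by
    intro i j hij
    refine DerivedDisj.span ?_ (hfs i) (hfs j)
    rintro _ ⟨l, rfl⟩ _ ⟨l', rfl⟩
    exact hed fun h => hij (congrArg Prod.fst (hb h))
  refine ⟨f, hf0, hfd, fun j => ?_, fun z hz => ?_⟩
  · refine Submodule.span_mono ?_ (hfs j)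
    rintro _ ⟨i, rfl⟩
    exact ⟨_, rfl⟩
  · obtain ⟨c, rfl⟩ := (Submodule.mem_span_range_iff_exists_fun 𝕜).1 hz
    have hterm : ∀ j, (P + 1) * (k + 1) * K.qnorm (c j • K.derivedQuot Ω hΩ (f j)) ≤
        B * K.derivedQuasiNorm Ω hΩ (∑ j, c j • f j) := by
      intro j
      have h1 : K.derivedQuasiNorm Ω hΩ (c j • f j) ≤
          B * K.derivedQuasiNorm Ω hΩ (∑ j, c j • f j) := by
        rw [← Finset.add_sum_erase _ _ (Finset.mem_univ j)]
        refine hB _ _ (DerivedDisj.span_right (s := Set.range fun l : {l // l ≠ j} => f l) ?_ ?_)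
        · rintro _ ⟨⟨l, hl⟩, rfl⟩
          exact ((hfd hl).smul_right (c j)).symm
        · refine Submodule.sum_mem _ fun l hl => Submodule.smul_mem _ _ ?_
          exact Submodule.subset_span ⟨⟨l, Finset.ne_of_mem_erase hl⟩, rfl⟩
      refine le_trans ?_ h1
      rw [K.qnorm.smul', QuasiNorm.smul', mul_left_comm]
      exact mul_le_mul_of_nonneg_left (hfC j) (norm_nonneg _)
    have hsum : (P + 1) * (k + 1) * K.qnorm (K.derivedQuot Ω hΩ (∑ j, c j • f j)) ≤
        P * K.derivedQuasiNorm Ω hΩ (∑ j, c j • f j) := by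
      rw [map_sum]
      simp only [map_smul]
      have h1 := hD Finset.univ fun j => c j • K.derivedQuot Ω hΩ (f j)
      rw [Finset.card_univ, Fintype.card_fin] at h1
      refine (mul_le_mul_of_nonneg_left h1 hC0).trans ?_
      rw [mul_left_comm, Finset.mul_sum]
      have h2 := Finset.sum_le_sum fun j (_ : j ∈ (Finset.univ : Finset (Fin k))) => hterm j
      rw [Finset.sum_const, Finset.card_univ, Fintype.card_fin, nsmul_eq_mul] at h2
      refine (mul_le_mul_of_nonneg_left h2 (by positivity)).trans (le_of_eq ?_)
      simp only [P]
      ring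
    have hN := (K.derivedQuasiNorm Ω hΩ).nonneg' (∑ j, c j • f j)
    rw [one_div, inv_mul_eq_div, le_div_iff₀' (by positivity)]
    have h3 : (P + 1) * ((k + 1) * K.qnorm (K.derivedQuot Ω hΩ (∑ j, c j • f j))) ≤
        (P + 1) * K.derivedQuasiNorm Ω hΩ (∑ j, c j • f j) := by linarith
    exact le_of_mul_le_mul_left h3 (by positivity)

/-- For each `n` the largest admissible dimension not exceeding `n` is taken; dimension `0` is
always admissible. `exists_disjoint_small` makes these dimensions tend to infinity, and the bound `1
/ (k + 1)` to `0`. -/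
theorem isFinitelySuperDisjointlySingularOp
    (h : ¬ ∃ C, ∀ n, K.HasDisjointLifting (K.derivedQuasiNorm Ω hΩ) (K.derivedQuot Ω hΩ) n C) :
    IsFinitelySuperDisjointlySingularOp (K.derivedQuasiNorm Ω hΩ) K.qnorm (K.DerivedDisj Ω hΩ)
      (K.derivedQuot Ω hΩ) := by
  classical
  intro e he0 hed
  let P : ℕ → ℕ → Prop := fun n k => ∃ f : Fin k → K.derived Ω hΩ, (∀ i, f i ≠ 0) ∧
        (Pairwise fun i j => K.DerivedDisj Ω hΩ (f i) (f j)) ∧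
        (∀ i, f i ∈ Submodule.span 𝕜 (Set.range (e n))) ∧
        ∀ z ∈ Submodule.span 𝕜 (Set.range f),
          K.qnorm (K.derivedQuot Ω hΩ z) ≤ 1 / (k + 1) * K.derivedQuasiNorm Ω hΩ z
  have hP0 : ∀ n, P n 0 := fun n => by
    refine ⟨fun i => i.elim0, fun i => i.elim0, fun i => i.elim0, fun i => i.elim0,
      fun z hz => ?_⟩
    rw [Set.range_eq_empty, Submodule.span_empty, Submodule.mem_bot] at hz
    rw [hz, map_zero, QuasiNorm.map_zero, QuasiNorm.map_zero, mul_zero]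
  have hspec : ∀ n, P n (Nat.findGreatest (P n) n) := fun n =>
    Nat.findGreatest_spec (Nat.zero_le n) (hP0 n)
  have hk : Tendsto (fun n => Nat.findGreatest (P n) n) atTop atTop := by
    rw [tendsto_atTop]
    intro b
    obtain ⟨m, hm⟩ := K.exists_disjoint_small hΩ h b
    filter_upwards [eventually_ge_atTop b, eventually_ge_atTop m] with n hb hmn
    exact Nat.le_findGreatest hb (hm n hmn (e n) (he0 n) (hed n))
  choose f h0 hd hs hle using hspec
  exact ⟨_, f, _, h0, hd, hs, hk,
    (tendsto_one_div_add_atTop_nhds_zero_nat (𝕜 := ℝ)).comp hk, hle⟩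

end KotheSpace

/-! ### Averages over signs -/

section Signs

variable {𝕜 : Type u} [RCLike 𝕜]

theorem norm_intUnit (s : ℤˣ) : ‖((s : ℤ) : 𝕜)‖ = 1 := by
  rcases Int.units_eq_one_or s with rfl | rfl <;> simp

theorem intUnit_mul_self (s : ℤˣ) : ((s : ℤ) : 𝕜) * ((s : ℤ) : 𝕜) = 1 := by
  rcases Int.units_eq_one_or s with rfl | rfl <;> simp

/-- The diagonal part of a randomly signed sum is dominated by the `L_p`-average of the sum. -/
theorem card_mul_norm_rpow_le {n : ℕ} (j : Fin n) (d : Fin n → 𝕜) (g : 𝕜) {p : ℝ} (hp : 0 < p) :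
    (Fintype.card (Fin n → ℤˣ) : ℝ) * ‖d j - g‖ ^ p ≤
      2 * ∑ s : Fin n → ℤˣ, ‖((s j : ℤ) : 𝕜) * ∑ k, ((s k : ℤ) : 𝕜) * d k - g‖ ^ p := by
  classical
  let F : (Fin n → ℤˣ) → 𝕜 := fun s => ((s j : ℤ) : 𝕜) * ∑ k, ((s k : ℤ) : 𝕜) * d k - g
  -- Multiplication by `τ` flips every sign except the `j`-th, so the off-diagonal terms cancel in
  -- `F s + F (s * τ)`.
  let τ : Fin n → ℤˣ := fun k => if k = j then 1 else -1
  have hsum : ∀ s, F s + F (s * τ) = 2 * (d j - g) := by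
    intro s
    have h1 : (((s * τ) j : ℤ) : 𝕜) = ((s j : ℤ) : 𝕜) := by simp [τ]
    have h2 : (∑ k, ((s k : ℤ) : 𝕜) * d k) + ∑ k, (((s * τ) k : ℤ) : 𝕜) * d k =
        2 * (((s j : ℤ) : 𝕜) * d j) := by
      rw [← Finset.sum_add_distrib, Finset.sum_eq_single j]
      · rw [h1]
        ring
      · intro k _ hk
        simp [τ, hk]
      · intro hj
        exact absurd (Finset.mem_univ j) hj
    calc F s + F (s * τ) = ((s j : ℤ) : 𝕜) * ((∑ k, ((s k : ℤ) : 𝕜) * d k) +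
          ∑ k, (((s * τ) k : ℤ) : 𝕜) * d k) - 2 * g := by
          simp only [F]
          rw [h1]
          ring
      _ = 2 * ((((s j : ℤ) : 𝕜) * ((s j : ℤ) : 𝕜)) * d j) - 2 * g := by
          rw [h2]
          ring
      _ = _ := by
          rw [intUnit_mul_self]
          ring
  -- The larger of the two values is at least `‖d j - g‖`, which needs no convexity of the power and
  -- works for every `p > 0`. Summing over `s` counts each value twice, whence the factor `2`.
  have hle : ∀ s, ‖d j - g‖ ^ p ≤ ‖F s‖ ^ p + ‖F (s * τ)‖ ^ p := by
    intro s
    have h1 : 2 * ‖d j - g‖ ≤ ‖F s‖ + ‖F (s * τ)‖ := by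
      refine le_trans (le_of_eq ?_) (norm_add_le _ _)
      rw [hsum, norm_mul, RCLike.norm_ofNat]
    have h0 := norm_nonneg (d j - g)
    have p1 := Real.rpow_nonneg (norm_nonneg (F s)) p
    have p2 := Real.rpow_nonneg (norm_nonneg (F (s * τ))) p
    rcases le_total ‖F s‖ ‖F (s * τ)‖ with h | h
    · have := Real.rpow_le_rpow h0 (by linarith : ‖d j - g‖ ≤ ‖F (s * τ)‖) hp.le
      linarith
    · have := Real.rpow_le_rpow h0 (by linarith : ‖d j - g‖ ≤ ‖F s‖) hp.le
      linarith
  have h1 := Finset.sum_le_sum fun s (_ : s ∈ (Finset.univ : Finset (Fin n → ℤˣ))) => hle s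
  rw [Finset.sum_const, Finset.card_univ, nsmul_eq_mul, Finset.sum_add_distrib] at h1
  have h2 : ∑ s, ‖F (s * τ)‖ ^ p = ∑ s, ‖F s‖ ^ p :=
    Equiv.sum_comp (Equiv.mulRight τ) fun s => ‖F s‖ ^ p
  rw [h2, ← two_mul] at h1
  exact h1

end Signs

/-! ### Disjointness preserving liftings in convex Köthe spaces -/

namespace KotheSpace

variable {𝕜 : Type u} [RCLike 𝕜] {S : Type v} [MeasurableSpace S] {μ : Measure S}
  {K : KotheSpace 𝕜 μ}

/-- In a `p`-convex space, elements dominated by the `L_p`-average of a family are controlled by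
the family. -/
theorem HasConvexity.exists_average (h : K.HasConvexity) : ∃ p : ℝ, 0 < p ∧ ∃ M : ℝ, 0 ≤ M ∧
    ∀ {κ : Type w} [Fintype κ] [Nonempty κ] (a : κ → K.carrier) (f : K.carrier) (B : ℝ), 0 ≤ B →
      (∀ k, K.qnorm (a k) ≤ B) →
      (∀ᵐ t ∂μ, (Fintype.card κ : ℝ) * ‖(f : L0 𝕜 μ) t‖ ^ p ≤
        2 * ∑ k, ‖(a k : L0 𝕜 μ) t‖ ^ p) → K.qnorm f ≤ M * B := by
  obtain ⟨p, hp, M, hM⟩ := h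
  refine ⟨p, hp, |M| * 2 ^ (1 / p), by positivity, fun {κ} _ _ a f B hB ha hf => ?_⟩
  have hcard : (0 : ℝ) < Fintype.card κ := Nat.cast_pos.2 Fintype.card_pos
  -- Scaling by `s`, with `s ^ p = 2 / card κ`, turns twice the average of the `p`-th powers into
  -- the `p`-sum appearing in the convexity inequality.
  let s : ℝ := (2 / Fintype.card κ) ^ (1 / p)
  have hs0 : 0 ≤ s := by positivity
  have hsp : s ^ p = 2 / Fintype.card κ := by
    rw [← Real.rpow_mul (by positivity), one_div_mul_cancel hp.ne', Real.rpow_one]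
  let E := (Fintype.equivFin κ).symm
  obtain ⟨_, hle⟩ := hM (Fintype.card κ) (fun i => (s : 𝕜) • a (E i)) f (by
    have hsm : ∀ᵐ t ∂μ, ∀ i, (((s : 𝕜) • a (E i) : K.carrier) : L0 𝕜 μ) t =
        (s : 𝕜) * (a (E i) : L0 𝕜 μ) t := ae_all_iff.2 fun i => L0.coeFn_smul _ _
    filter_upwards [hf, hsm] with t h1 h2
    have h3 : ∀ i, ‖(((s : 𝕜) • a (E i) : K.carrier) : L0 𝕜 μ) t‖ ^ p =
        2 / Fintype.card κ * ‖(a (E i) : L0 𝕜 μ) t‖ ^ p := fun i => by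
      rw [h2, norm_mul, RCLike.norm_ofReal, abs_of_nonneg hs0,
        Real.mul_rpow hs0 (norm_nonneg _), hsp]
    simp only [h3]
    rw [← Finset.mul_sum, Equiv.sum_comp E fun k => ‖(a k : L0 𝕜 μ) t‖ ^ p]
    have h4 : ‖(f : L0 𝕜 μ) t‖ ^ p ≤ 2 / Fintype.card κ * ∑ k, ‖(a k : L0 𝕜 μ) t‖ ^ p := by
      rw [div_mul_eq_mul_div, le_div_iff₀' hcard]
      exact h1
    have h5 := Real.rpow_le_rpow (by positivity) h4 (by positivity : 0 ≤ 1 / p)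
    rwa [← Real.rpow_mul (norm_nonneg _), mul_one_div_cancel hp.ne', Real.rpow_one] at h5)
  have hsum : ∑ i, K.qnorm ((s : 𝕜) • a (E i)) ^ p ≤ 2 * B ^ p := by
    have h1 : ∀ i, K.qnorm ((s : 𝕜) • a (E i)) ^ p ≤ 2 / Fintype.card κ * B ^ p := fun i => by
      rw [K.qnorm.smul', RCLike.norm_ofReal, abs_of_nonneg hs0,
        Real.mul_rpow hs0 (K.qnorm.nonneg' _), hsp]
      exact mul_le_mul_of_nonneg_left
        (Real.rpow_le_rpow (K.qnorm.nonneg' _) (ha _) hp.le) (by positivity)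
    refine (Finset.sum_le_sum fun i _ => h1 i).trans (le_of_eq ?_)
    rw [Finset.sum_const, Finset.card_univ, Fintype.card_fin, nsmul_eq_mul]
    field_simp
  have hroot : (∑ i, K.qnorm ((s : 𝕜) • a (E i)) ^ p) ^ (1 / p) ≤ 2 ^ (1 / p) * B := by
    refine (Real.rpow_le_rpow (Finset.sum_nonneg fun i _ => Real.rpow_nonneg (K.qnorm.nonneg' _) _)
      hsum (by positivity)).trans (le_of_eq ?_)
    rw [Real.mul_rpow (by norm_num) (by positivity), ← Real.rpow_mul hB,
      mul_one_div_cancel hp.ne', Real.rpow_one]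
  refine hle.trans ?_
  rw [mul_assoc]
  refine (mul_le_mul_of_nonneg_right (le_abs_self M) (Real.rpow_nonneg (Finset.sum_nonneg
    fun i _ => Real.rpow_nonneg (K.qnorm.nonneg' _) _) _)).trans ?_
  exact mul_le_mul_of_nonneg_left hroot (abs_nonneg M)

variable {Ω : K.carrier → L0 𝕜 μ} (hΩ : K.IsCentralizer Ω)

theorem coeFn_derivedFst_sum_smul {κ : Type w} (s : Finset κ) (c : κ → 𝕜)
    (z : κ → K.derived Ω hΩ) :
    ⇑(K.derivedFst hΩ (∑ k ∈ s, c k • z k)) =ᵐ[μ] fun t => ∑ k ∈ s, c k * K.derivedFst hΩ (z k) t := by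
  have h := L0.coeFn_sum_smul s c fun k => K.derivedFst hΩ (z k)
  have e : K.derivedFst hΩ (∑ k ∈ s, c k • z k) = ∑ k ∈ s, c k • K.derivedFst hΩ (z k) := by
    rw [map_sum]
    simp only [map_smul]
  rwa [e]

theorem coeFn_derivedQuot_sum_smul {κ : Type w} (s : Finset κ) (c : κ → 𝕜)
    (z : κ → K.derived Ω hΩ) :
    ⇑(K.derivedQuot Ω hΩ (∑ k ∈ s, c k • z k) : L0 𝕜 μ) =ᵐ[μ]
      fun t => ∑ k ∈ s, c k * (K.derivedQuot Ω hΩ (z k) : L0 𝕜 μ) t := by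
  have h := K.coeFn_sum_smul s c fun k => K.derivedQuot Ω hΩ (z k)
  have e : K.derivedQuot Ω hΩ (∑ k ∈ s, c k • z k) = ∑ k ∈ s, c k • K.derivedQuot Ω hΩ (z k) := by
    rw [map_sum]
    simp only [map_smul]
  rwa [e]

/-- If `K` is `p`-convex, then bounded linear liftings on spans of disjoint vectors can be chosen
disjointness preserving. -/
theorem exists_disjoint_lifting (hconv : K.HasConvexity) (C : ℝ) : ∃ C' : ℝ, 0 ≤ C' ∧
    ∀ n, K.HasDisjointLifting (K.derivedQuasiNorm Ω hΩ) (K.derivedQuot Ω hΩ) n C →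
      ∃ z : Fin n → K.derived Ω hΩ, (∀ k, K.derivedQuot Ω hΩ (z k) ≠ 0) ∧
        (Pairwise fun k l => K.DerivedDisj Ω hΩ (z k) (z l)) ∧
        ∀ c : Fin n → 𝕜, K.derivedQuasiNorm Ω hΩ (∑ k, c k • z k) ≤
          C' * K.qnorm (K.derivedQuot Ω hΩ (∑ k, c k • z k)) := by
  classical
  obtain ⟨B, hB0, hB⟩ := K.exists_derived_mul hΩ
  obtain ⟨p, hp, M, hM0, hM⟩ := HasConvexity.exists_average.{u, v, 0} hconv
  have hC0 := abs_nonneg C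
  -- The `1` accounts for the image in `K`. For the defect, `|C|` bounds the signed lifts, `B` the
  -- multiplication by a function of modulus at most one, and `M` the average over signs.
  refine ⟨1 + M * (B * |C|), by positivity, ?_⟩
  rintro n ⟨z, h0, hd, hC⟩
  let x : Fin n → K.carrier := fun k => K.derivedQuot Ω hΩ (z k)
  let A : Fin n → Set S := fun k => {t | (x k : L0 𝕜 μ) t = 0}ᶜ
  have hA : ∀ k, MeasurableSet (A k) := fun k =>
    (measurableSet_eq_fun (L0.measurable _) measurable_const).compl
  have hind : ∀ᵐ t ∂μ, ∀ k, L0.ind 𝕜 μ (A k) (hA k) t =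
      if (x k : L0 𝕜 μ) t = 0 then 0 else 1 := ae_all_iff.2 fun k => by
    filter_upwards [L0.coeFn_ind (𝕜 := 𝕜) (μ := μ) (A k) (hA k)] with t ht
    rw [ht]
    by_cases h : (x k : L0 𝕜 μ) t = 0
    · rw [if_pos h, Set.indicator_of_notMem (show t ∉ A k from fun h' => h' h)]
    · rw [if_neg h, Set.indicator_of_mem (show t ∈ A k from h)]
  have hdisj : ∀ᵐ t ∂μ, ∀ k l, k ≠ l → (x k : L0 𝕜 μ) t = 0 ∨ (x l : L0 𝕜 μ) t = 0 :=
    ae_all_iff.2 fun k => ae_all_iff.2 fun l => by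
      by_cases hkl : k = l
      · exact Eventually.of_forall fun t h => absurd hkl h
      · filter_upwards [hd hkl] with t ht _ using ht
  -- `y k` is `z k` cut down to the support of `x k`: it still lies above `x k`, and the `y k` are
  -- disjoint. Only the bound on their span, uniform in `n`, remains to be proved.
  choose y hy1 hy2 hyB using fun k => hB (L0.ind 𝕜 μ (A k) (hA k)) (L0.norm_ind_le (A k) (hA k))
    (z k)
  have hyt : ∀ᵐ t ∂μ, ∀ k, K.derivedFst hΩ (y k) t =
      (if (x k : L0 𝕜 μ) t = 0 then 0 else 1) * K.derivedFst hΩ (z k) t := by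
    have h1 : ∀ᵐ t ∂μ, ∀ k, K.derivedFst hΩ (y k) t =
        L0.ind 𝕜 μ (A k) (hA k) t * K.derivedFst hΩ (z k) t := ae_all_iff.2 fun k => by
      rw [hy1]
      exact L0.coeFn_mul _ _
    filter_upwards [h1, hind] with t h1 h2 k
    rw [h1, h2]
  have hyx : ∀ k, K.derivedQuot Ω hΩ (y k) = x k := fun k => Subtype.ext (L0.ext (by
    rw [hy2]
    filter_upwards [hind, L0.coeFn_mul (L0.ind 𝕜 μ (A k) (hA k)) (x k : L0 𝕜 μ)] with t h1 h2
    rw [h2, h1]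
    by_cases h : (x k : L0 𝕜 μ) t = 0
    · rw [h, mul_zero]
    · rw [if_neg h, one_mul]))
  refine ⟨y, fun k => by rw [hyx]; exact h0 k, fun k l hkl => ?_, fun c => ?_⟩
  · refine (K.derivedDisj_iff hΩ).2 ?_
    filter_upwards [hyt, hdisj] with t h1 h2
    rw [hyx, hyx, h1, h1]
    refine (h2 k l hkl).imp (fun h => ?_) fun h => ?_
    · rw [if_pos h, zero_mul]
      exact ⟨rfl, h⟩
    · rw [if_pos h, zero_mul]
      exact ⟨rfl, h⟩
  have hquot : K.derivedQuot Ω hΩ (∑ k, c k • y k) = ∑ k, c k • x k := by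
    rw [map_sum]
    exact Finset.sum_congr rfl fun k _ => by rw [map_smul, hyx]
  -- The signs are inserted in the combination of the lifts and undone by the function `f s`, equal
  -- to `s k` on the support of `x k`. All products `f s * w s` then lie above the same vector `∑ c
  -- k x k`.
  let w : (Fin n → ℤˣ) → K.derived Ω hΩ := fun s => ∑ k, (((s k : ℤ) : 𝕜) * c k) • z k
  let f : (Fin n → ℤˣ) → L0 𝕜 μ := fun s => ∑ k, ((s k : ℤ) : 𝕜) • L0.ind 𝕜 μ (A k) (hA k)
  have hft : ∀ s, ∀ᵐ t ∂μ, f s t = ∑ k, ((s k : ℤ) : 𝕜) *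
      (if (x k : L0 𝕜 μ) t = 0 then 0 else 1) := fun s => by
    filter_upwards [L0.coeFn_sum_smul Finset.univ (fun k => ((s k : ℤ) : 𝕜))
      fun k => L0.ind 𝕜 μ (A k) (hA k), hind] with t h1 h2
    refine h1.trans (Finset.sum_congr rfl fun k _ => ?_)
    rw [h2]
  have hsupp : ∀ t, (∀ k l, k ≠ l → (x k : L0 𝕜 μ) t = 0 ∨ (x l : L0 𝕜 μ) t = 0) →
      ∀ j, (x j : L0 𝕜 μ) t ≠ 0 → ∀ d : Fin n → 𝕜,
        ∑ k, d k * (if (x k : L0 𝕜 μ) t = 0 then 0 else 1) = d j := by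
    intro t ht j hj d
    rw [Finset.sum_eq_single j]
    · rw [if_neg hj, mul_one]
    · intro k _ hk
      rw [if_pos ((ht k j hk).resolve_right hj), mul_zero]
    · exact fun h => absurd (Finset.mem_univ j) h
  have hfle : ∀ s, ∀ᵐ t ∂μ, ‖f s t‖ ≤ 1 := fun s => by
    filter_upwards [hft s, hdisj] with t h1 h2
    rw [h1]
    by_cases h : ∃ j, (x j : L0 𝕜 μ) t ≠ 0
    · obtain ⟨j, hj⟩ := h
      rw [hsupp t h2 j hj, norm_intUnit]
    · push Not at h
      rw [Finset.sum_eq_zero fun k _ => by rw [if_pos (h k), mul_zero], norm_zero]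
      exact zero_le_one
  choose v hv1 hv2 hvB using fun s => hB (f s) (hfle s) (w s)
  have hwt : ∀ s, ∀ᵐ t ∂μ, (K.derivedQuot Ω hΩ (w s) : L0 𝕜 μ) t =
      ∑ k, ((s k : ℤ) : 𝕜) * c k * (x k : L0 𝕜 μ) t := fun s =>
    coeFn_derivedQuot_sum_smul hΩ _ _ _
  have hxt : ∀ᵐ t ∂μ, ((∑ k, c k • x k : K.carrier) : L0 𝕜 μ) t =
      ∑ k, c k * (x k : L0 𝕜 μ) t := K.coeFn_sum_smul _ _ _
  have hsingle : ∀ t, (∀ k l, k ≠ l → (x k : L0 𝕜 μ) t = 0 ∨ (x l : L0 𝕜 μ) t = 0) →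
      ∀ j, (x j : L0 𝕜 μ) t ≠ 0 → ∀ d : Fin n → 𝕜,
        ∑ k, d k * (x k : L0 𝕜 μ) t = d j * (x j : L0 𝕜 μ) t := by
    intro t ht j hj d
    rw [Finset.sum_eq_single j]
    · intro k _ hk
      rw [(ht k j hk).resolve_right hj, mul_zero]
    · exact fun h => absurd (Finset.mem_univ j) h
  have hvx : ∀ s, K.derivedQuot Ω hΩ (v s) = ∑ k, c k • x k := fun s =>
    Subtype.ext (L0.ext (by
      rw [hv2]
      filter_upwards [L0.coeFn_mul (f s) (K.derivedQuot Ω hΩ (w s) : L0 𝕜 μ), hft s, hwt s, hxt,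
        hdisj] with t h1 h2 h3 h4 h5
      rw [h1, h2, h3, h4]
      by_cases h : ∃ j, (x j : L0 𝕜 μ) t ≠ 0
      · obtain ⟨j, hj⟩ := h
        rw [hsupp t h5 j hj, hsingle t h5 j hj, hsingle t h5 j hj, ← mul_assoc, ← mul_assoc,
          intUnit_mul_self, one_mul]
      · push Not at h
        simp only [h, mul_zero, Finset.sum_const_zero]))
  have hwx : ∀ s, K.qnorm (K.derivedQuot Ω hΩ (w s)) ≤ K.qnorm (∑ k, c k • x k) := fun s => by
    refine K.qnorm_le ?_
    filter_upwards [hwt s, hxt, hdisj] with t h3 h4 h5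
    rw [h3, h4]
    by_cases h : ∃ j, (x j : L0 𝕜 μ) t ≠ 0
    · obtain ⟨j, hj⟩ := h
      rw [hsingle t h5 j hj, hsingle t h5 j hj, mul_assoc, norm_mul, norm_intUnit, one_mul]
    · push Not at h
      simp only [h, mul_zero, Finset.sum_const_zero, le_refl]
  have hnn := K.qnorm.nonneg' (∑ k, c k • x k)
  have hdef : ∀ s, K.qnorm (K.defect Ω hΩ (v s)) ≤ B * |C| * K.qnorm (∑ k, c k • x k) := fun s => by
    have h1 : K.qnorm (K.defect Ω hΩ (v s)) ≤ K.derivedQuasiNorm Ω hΩ (v s) := by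
      rw [derivedQuasiNorm_apply]
      linarith [K.qnorm.nonneg' (K.derivedQuot Ω hΩ (v s))]
    refine (h1.trans (hvB s)).trans ?_
    rw [mul_assoc]
    refine mul_le_mul_of_nonneg_left ?_ hB0
    refine (hC fun k => ((s k : ℤ) : 𝕜) * c k).trans ?_
    exact (mul_le_mul_of_nonneg_right (le_abs_self C) (K.qnorm.nonneg' _)).trans
      (mul_le_mul_of_nonneg_left (hwx s) hC0)
  have hmain : K.qnorm (K.defect Ω hΩ (∑ k, c k • y k)) ≤
      M * (B * |C| * K.qnorm (∑ k, c k • x k)) := by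
    -- On the support of `x j`, the defect of `v s` is `s j ∑ s k d k - g`, with `d k` the value of
    -- `c k z k` and `g` that of `Ω (∑ c k x k)`, while the cut sum has defect `d j - g`. The
    -- inequality for signed sums applies pointwise.
    refine hM (fun s => K.defect Ω hΩ (v s)) _ _ (by positivity) hdef ?_
    have hvt : ∀ᵐ t ∂μ, ∀ s, (K.defect Ω hΩ (v s) : L0 𝕜 μ) t =
        (∑ k, ((s k : ℤ) : 𝕜) * (if (x k : L0 𝕜 μ) t = 0 then 0 else 1)) *
          (∑ k, ((s k : ℤ) : 𝕜) * (c k * K.derivedFst hΩ (z k) t)) -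
          Ω (∑ k, c k • x k) t := ae_all_iff.2 fun s => by
      have e : (K.defect Ω hΩ (v s) : L0 𝕜 μ) = f s * K.derivedFst hΩ (w s) -
          Ω (∑ k, c k • x k) := by
        rw [coe_defect, hv1, hvx]
      rw [e]
      filter_upwards [L0.coeFn_sub (f s * K.derivedFst hΩ (w s)) (Ω (∑ k, c k • x k)),
        L0.coeFn_mul (f s) (K.derivedFst hΩ (w s)), hft s,
        coeFn_derivedFst_sum_smul hΩ Finset.univ (fun k => ((s k : ℤ) : 𝕜) * c k) z]
        with t h1 h2 h3 h4
      rw [h1, h2, h3, h4]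
      simp only [mul_assoc]
    have hyd : ∀ᵐ t ∂μ, (K.defect Ω hΩ (∑ k, c k • y k) : L0 𝕜 μ) t =
        (∑ k, c k * K.derivedFst hΩ (z k) t * (if (x k : L0 𝕜 μ) t = 0 then 0 else 1)) -
          Ω (∑ k, c k • x k) t := by
      rw [coe_defect, hquot]
      filter_upwards [L0.coeFn_sub (K.derivedFst hΩ (∑ k, c k • y k)) (Ω (∑ k, c k • x k)),
        coeFn_derivedFst_sum_smul hΩ Finset.univ c y, hyt] with t h1 h2 h3
      rw [h1, h2]
      congr 1
      refine Finset.sum_congr rfl fun k _ => ?_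
      rw [h3]
      ring
    filter_upwards [hvt, hyd, hdisj] with t h1 h2 h3
    simp only [h1]
    rw [h2]
    by_cases h : ∃ j, (x j : L0 𝕜 μ) t ≠ 0
    · obtain ⟨j, hj⟩ := h
      rw [hsupp t h3 j hj]
      have h4 := card_mul_norm_rpow_le j (fun k => c k * K.derivedFst hΩ (z k) t)
        (Ω (∑ k, c k • x k) t) hp
      refine h4.trans (le_of_eq ?_)
      congr 1
      refine Finset.sum_congr rfl fun s _ => ?_
      rw [hsupp t h3 j hj]
    -- Outside all supports the multipliers vanish, and every defect equals `-Ω (∑ c k x k)`; the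
    -- factor `2` only helps.
    · push Not at h
      simp only [h, if_true, mul_zero, Finset.sum_const_zero, zero_mul, Finset.sum_const,
        Finset.card_univ, nsmul_eq_mul]
      have : 0 ≤ (Fintype.card (Fin n → ℤˣ) : ℝ) * ‖0 - Ω (∑ k, c k • x k) t‖ ^ p := by positivity
      linarith
  rw [derivedQuasiNorm_apply, hquot, add_mul, one_mul]
  refine add_le_add le_rfl (hmain.trans (le_of_eq ?_))
  ring

/-- With disjoint lifts, the diagonal classes form a disjoint sequence already in the ultrapower of
`d_Ω K`. Their span lies in an ultraproduct where the quotient is bounded below, and the bound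
extends to the closure. -/
theorem not_quotUltrapowerDisjointlySingular (hconv : K.HasConvexity) {C : ℝ}
    (h : ∀ n, K.HasDisjointLifting (K.derivedQuasiNorm Ω hΩ) (K.derivedQuot Ω hΩ) n C)
    {ι : Type y} (U : Ultrafilter ι) {r : ι → ℕ} (hr : Tendsto r U atTop) :
    ¬ K.QuotUltrapowerDisjointlySingular Ω hΩ U := by
  obtain ⟨C', hC'0, hC'⟩ := exists_disjoint_lifting hΩ hconv C
  choose z h0 hd hC using fun n => hC' n (h n)
  choose c hc1 hcC using fun n => K.exists_normalized (z n) (h0 n) (hC n)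
  have hq := K.derivedQuot_isBoundedMap Ω hΩ
  let z' : (n : ℕ) → Fin n → K.derived Ω hΩ := fun n k => c n k • z n k
  have hd' : ∀ n, Pairwise fun k l => K.DerivedDisj Ω hΩ (z' n k) (z' n l) := fun n k l hkl =>
    ((((hd n hkl).smul_right (c n l)).symm).smul_right (c n k)).symm
  have hb : ∀ k, diagonal z' r k ∈ (K.derivedQuasiNorm Ω hΩ).boundedFamilies ι :=
    K.diagonal_bounded hC'0 hcC hc1
  let e : ℕ → (K.derivedQuasiNorm Ω hΩ).Ultrapower U := fun k =>
    (K.derivedQuasiNorm Ω hΩ).ultraMk U ⟨_, hb k⟩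
  have hed : Pairwise fun k l => K.UltraDerivedDisj Ω hΩ U (e k) (e l) := fun k l hkl =>
    ⟨⟨_, hb k⟩, ⟨_, hb l⟩, rfl, rfl, fun i => diagonal_rel z' hd'
      (fun b => (derivedDisj_zero_right b).symm) derivedDisj_zero_right hkl i⟩
  obtain ⟨C'', hC''⟩ := QuasiNorm.exists_bddBelow_ultraproduct hq U hC'0
    (E := fun i => Submodule.span 𝕜 (Set.range (z' (r i)))) fun i => hcC (r i)
  have hspan : Submodule.span 𝕜 (Set.range e) ≤ (K.derivedQuasiNorm Ω hΩ).ultraproduct U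
      fun i => Submodule.span 𝕜 (Set.range (z' (r i))) := by
    rw [Submodule.span_le]
    rintro _ ⟨k, rfl⟩
    exact ⟨⟨_, hb k⟩, fun i => diagonal_mem z' k i, rfl⟩
  intro hds
  refine hds e hed (QuasiNorm.not_finiteDimensional_closedSpan _ fun n => ?_)
    (QuasiNorm.bddBelow_closedSpan (QuasiNorm.ultrapowerMap_bounded hq U)
      fun ζ hζ => hC'' ζ (hspan hζ))
  -- Independence is checked on the images in `K_U`, which are disjoint and nonzero.
  refine LinearIndependent.of_comp ((K.derivedQuasiNorm Ω hΩ).ultrapowerMap K.qnorm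
    (K.derivedQuot Ω hΩ) hq U) ?_
  exact UltraDisj.linearIndependent K U _
    (fun k l hkl => UltraDerivedDisj.quot K hΩ (hed fun h => hkl (Fin.ext h)))
    fun k => K.diagonal_ultra_ne_zero hr hq hc1 k (hb k)

/-- On the spans of the disjoint lifts the quotient map is bounded below uniformly in `n`, so it
cannot have small norm on any nonzero subspace of them. -/
theorem not_isFinitelySuperDisjointlySingularOp (hconv : K.HasConvexity) {C : ℝ}
    (h : ∀ n, K.HasDisjointLifting (K.derivedQuasiNorm Ω hΩ) (K.derivedQuot Ω hΩ) n C) :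
    ¬ IsFinitelySuperDisjointlySingularOp (K.derivedQuasiNorm Ω hΩ) K.qnorm
      (K.DerivedDisj Ω hΩ) (K.derivedQuot Ω hΩ) := by
  obtain ⟨C', hC'0, hC'⟩ := exists_disjoint_lifting hΩ hconv C
  choose z h0 hd hC using fun n => hC' n (h n)
  intro hfs
  obtain ⟨k, f, ε, hf0, -, hfs, hk, hε, hle⟩ := hfs z
    (fun n k hz => h0 n k (by rw [hz, map_zero])) hd
  have hlim : Tendsto (fun n => C' * ε n) atTop (𝓝 0) := by simpa using hε.const_mul C'
  -- `k n > 0` provides a nonzero vector, and `C' * ε n < 1` contradicts the lower bound at it.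
  obtain ⟨n, hkn, hεn⟩ := ((hk.eventually_gt_atTop 0).and
    (hlim.eventually (gt_mem_nhds zero_lt_one))).exists
  have hpos := (K.derivedQuasiNorm Ω hΩ).pos_of_ne_zero (hf0 n ⟨0, hkn⟩)
  have h1 := hle n _ (Submodule.subset_span ⟨⟨0, hkn⟩, rfl⟩)
  obtain ⟨c, hc⟩ := (Submodule.mem_span_range_iff_exists_fun 𝕜).1 (hfs n ⟨0, hkn⟩)
  have h2 := hC n c
  rw [hc] at h2
  have h3 := h2.trans (mul_le_mul_of_nonneg_left h1 hC'0)
  rw [← mul_assoc] at h3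
  have h4 := mul_lt_mul_of_pos_right hεn hpos
  linarith

end KotheSpace

/-! ### All conditions compared through uniform disjoint liftings -/

theorem mainTheorem9 {𝕜 : Type u} [RCLike 𝕜] {S : Type v} [MeasurableSpace S] (μ : Measure S)
    [SigmaFinite μ] (K : KotheSpace 𝕜 μ) :
    -- quasi-linear maps `Ω : K → Y`
    (∀ (Y : Type x) [AddCommGroup Y] [Module 𝕜 Y] (NY : QuasiNorm 𝕜 Y) (Ω : K.carrier → Y)
      (hΩ : IsQuasiLinear K.qnorm NY Ω),
      -- all ultrapowers of `Ω` are disjointly singular iff `ψ_Ω(n) → ∞`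
      (∀ (ι : Type w) (U : Ultrafilter ι),
        K.UltrapowerDisjointlySingular NY (twistedQuasiNorm K.qnorm NY Ω hΩ)
          (LinearMap.inl 𝕜 Y K.carrier) (K.inl_isBoundedMap NY Ω hΩ)
          (LinearMap.snd 𝕜 Y K.carrier) (K.snd_isBoundedMap NY Ω hΩ) U) ↔
      Tendsto (K.modulus (fun b => ENNReal.ofReal (NY b)) Ω) atTop (𝓝 ⊤)) ∧
    -- centralizers `Ω : K → L₀`
    (∀ (Ω : K.carrier → L0 𝕜 μ) (hΩ : K.IsCentralizer Ω),
      -- all ultrapowers of `Ω` are disjointly singular iff `ψ_Ω(n) → ∞`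
      ((∀ (ι : Type w) (U : Ultrafilter ι),
        K.UltrapowerDisjointlySingular K.qnorm (K.derivedQuasiNorm Ω hΩ)
          (K.derivedIncl Ω hΩ) (K.derivedIncl_isBoundedMap Ω hΩ)
          (K.derivedQuot Ω hΩ) (K.derivedQuot_isBoundedMap Ω hΩ) U) ↔
        Tendsto (K.modulus K.extNorm Ω) atTop (𝓝 ⊤)) ∧
      -- `ψ_Ω(n) → ∞` implies that `q_Ω` is super disjointly singular, in both forms
      (Tendsto (K.modulus K.extNorm Ω) atTop (𝓝 ⊤) →
        (∀ (ι : Type w) (U : Ultrafilter ι), K.QuotUltrapowerDisjointlySingular Ω hΩ U) ∧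
        IsFinitelySuperDisjointlySingularOp (K.derivedQuasiNorm Ω hΩ) K.qnorm
          (K.DerivedDisj Ω hΩ) (K.derivedQuot Ω hΩ)) ∧
      -- the converse implications
      (K.HasConvexity →
        ((∀ (ι : Type w) (U : Ultrafilter ι), K.QuotUltrapowerDisjointlySingular Ω hΩ U) →
          Tendsto (K.modulus K.extNorm Ω) atTop (𝓝 ⊤)) ∧
        (IsFinitelySuperDisjointlySingularOp (K.derivedQuasiNorm Ω hΩ) K.qnorm
            (K.DerivedDisj Ω hΩ) (K.derivedQuot Ω hΩ) →
          Tendsto (K.modulus K.extNorm Ω) atTop (𝓝 ⊤)))) := by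
  refine ⟨fun Y _ _ NY Ω hΩ => ?_, fun Ω hΩ => ⟨?_, fun h => ?_, fun hconv => ⟨fun h => ?_,
    fun h => ?_⟩⟩⟩
  · rw [K.tendsto_modulus_quasiLinear_iff NY Ω hΩ]
    exact K.ultrapowerDisjointlySingular_iff (K.isExactSeq_twisted NY Ω hΩ)
  · rw [K.tendsto_modulus_centralizer_iff hΩ]
    exact K.ultrapowerDisjointlySingular_iff (K.isExactSeq_derived hΩ)
  · rw [K.tendsto_modulus_centralizer_iff hΩ] at h
    exact ⟨fun ι U => K.quotUltrapowerDisjointlySingular hΩ h U,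
      K.isFinitelySuperDisjointlySingularOp hΩ h⟩
  · rw [K.tendsto_modulus_centralizer_iff hΩ]
    rintro ⟨C, hC⟩
    obtain ⟨U, r, hr⟩ := KotheSpace.exists_ultrafilter_tendsto_atTop.{w}
    exact KotheSpace.not_quotUltrapowerDisjointlySingular hΩ hconv hC U hr (h _ U)
  · rw [K.tendsto_modulus_centralizer_iff hΩ]
    rintro ⟨C, hC⟩
    exact KotheSpace.not_isFinitelySuperDisjointlySingularOp hΩ hconv hC h
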